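/- Let $d \ge 0$ be an integer. $\mathcal P_2(\mathbb R^d)$ is the set of Borel probability measures on $\mathbb R^d$ with finite second moment, with the 2-Wasserstein distance $d_2(\mu,\nu)=\bigl(\inf_\gamma\iint|x-y|^2d\gamma(x,y)\bigr)^{1/2}$, the infimum being over couplings $\gamma$ of $\mu$ and $\nu$; $\mathcal P_{2,\mathrm{ac}}(\mathbb R^d)$ is the subset of measures with a Lebesgue density, and a measure is identified with its density. The Fisher information is $\mathcal I(\mu)=4\int_{\mathbb R^d}|\nabla\sqrt{\mu}|^2dx$ if $\mu\in\mathcal P_{2,\mathrm{ac}}(\mathbb R^d)$ and $\sqrt\mu\in H^1(\mathbb R^d)$, and $\mathcal I(\mu)=+\infty$ otherwise. For $\mu\in\mathcal P_{2,\mathrm{ac}}(\mathbb R^d)$ and $\nu\in\mathcal P_2(\mathbb R^d)$, $T_\mu^\nu$ denotes the ($\mu$-a.e. unique) optimal transport map from $\mu$ to $\nu$ for the cost $|x-y|^2$. Let $T\ge 0$, $t_0\in[0,T]$ and $\mu_0\in\mathcal P_{2,\mathrm{ac}}(\mathbb R^d)$ with $\mathcal I(\mu_0)<+\infty$. Let $\mu\in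 C([t_0,T],\mathcal P_2(\mathbb R^d))$, and let $\alpha$ be a Borel vector field whose norm $\|\alpha\|_\infty$ in $L^\infty([t_0,T]\times\mathbb R^d;\mathbb R^d)$ (Lebesgue essential supremum) is finite and which satisfies $\int_{t_0}^T\int|\alpha_t|^2d\mu_t\,dt<\infty$ (this is automatic for a bounded representative). Suppose that, in the sense of distributions, \[ \partial_t\mu+\operatorname{div}(\alpha_t\mu)-\Delta\mu=0\ \text{ in }(t_0,T)\times\mathbb R^d,\qquad \mu_{t_0}=\mu_0. \] Then the following hold. (a) For all $t\in[t_0,T]$, \[ d_2(\mu_t,\mu_0)\le\bigl(\|\alpha\|_\infty+\mathcal I(\mu_0)^{1/2}\bigr)|t-t_0|. \] (b) There is a constant $C>0$, depending only on $\mathcal I(\mu_0)$ and $\|\alpha\|_\infty$, such that, for all $\varphi\in C_c^\infty(\mathbb R^d)$ and all $h>0$ with $t_0+h\le T$, \[ \left|\int_{\mathbb R^d}\nabla\varphi(x)\cdot\bigl(T_{\mu_0}^{\mu_{t_0+h}}(x)-x\bigr)d\mu_0(x)-\int_{t_0}^{t_0+h}\int_{\mathbb R^d}\bigl[\alpha_t(x)\cdot\nabla\varphi(x)+\Delta\varphi(x)\bigr]d\mu_t(x)\,dt\right|\le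 C\,\|\nabla^2\varphi\|_\infty\,h^2, \] where $\|\nabla^2\varphi\|_\infty$ is the supremum of the operator norm of the Hessian. In particular, if $t_0<T$, $\alpha_{t_0}\in L^2(\mu_0)$ and $\alpha_t\to\alpha_{t_0}$ in $L^2(\mu_0)$ as $t\to t_0^+$, then, for all $\varphi\in C_c^\infty(\mathbb R^d)$, \[ \lim_{h\to0^+}\int_{\mathbb R^d}\nabla\varphi(x)\cdot\frac{T_{\mu_0}^{\mu_{t_0+h}}(x)-x}{h}\,d\mu_0(x)=\int_{\mathbb R^d}\bigl[\alpha_{t_0}(x)\cdot\nabla\varphi(x)+\Delta\varphi(x)\bigr]d\mu_0(x). \] -/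

import Mathlib

open MeasureTheory Set Filter Topology
open scoped NNReal ContDiff InnerProductSpace

noncomputable section

namespace FokkerPlanck

/-- The Euclidean space `ℝᵈ`. -/
abbrev Sp (d : ℕ) : Type := EuclideanSpace ℝ (Fin d)

variable {d : ℕ}

/-- `μ ∈ 𝒫₂(ℝᵈ)`: a Borel probability measure with finite second moment. -/
structure IsP2 (μ : Measure (Sp d)) : Prop where
  isProbabilityMeasure : IsProbabilityMeasure μ
  second_moment : ∫⁻ x, ‖x‖ₑ ^ 2 ∂μ < ⊤

/-- `μ ∈ 𝒫₂,ac(ℝᵈ)`: moreover `μ` has a density with respect to Lebesgue measure. -/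
structure IsP2ac (μ : Measure (Sp d)) : Prop extends IsP2 μ where
  absolutelyContinuous : μ ≪ volume

/-- `γ` is a coupling (transport plan) of `μ` and `ν`. -/
def IsCoupling (μ ν : Measure (Sp d)) (γ : Measure (Sp d × Sp d)) : Prop :=
  γ.map Prod.fst = μ ∧ γ.map Prod.snd = ν

/-- The 2-Wasserstein distance, with values in `[0, ∞]` (finite on `𝒫₂`). -/
def d2 (μ ν : Measure (Sp d)) : ENNReal :=
  (⨅ (γ : Measure (Sp d × Sp d)) (_ : IsCoupling μ ν γ),
    ∫⁻ p, ‖p.1 - p.2‖ₑ ^ 2 ∂γ) ^ (1 / 2 : ℝ)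

/-- `T` is an optimal transport map from `μ` to `ν` for the quadratic cost: `T_# μ = ν`, and the
plan `(Id, T)_# μ` attains the infimum defining `d2 μ ν ^ 2`. For `μ ∈ 𝒫₂,ac` and `ν ∈ 𝒫₂` such a
map is unique up to equality `μ`-a.e. -/
structure IsOptimalMap (μ ν : Measure (Sp d)) (T : Sp d → Sp d) : Prop where
  aemeasurable : AEMeasurable T μ
  map_eq : μ.map T = ν
  cost_eq : ∫⁻ x, ‖T x - x‖ₑ ^ 2 ∂μ = d2 μ ν ^ 2

/-- `f ∈ H¹(ℝᵈ)` with weak gradient `g`. -/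
structure IsH1WithGradient (f : Sp d → ℝ) (g : Sp d → Sp d) : Prop where
  memLp : MemLp f 2 volume
  memLp_gradient : MemLp g 2 volume
  integral_by_parts : ∀ φ : Sp d → ℝ, ContDiff ℝ ∞ φ → HasCompactSupport φ →
    ∀ v : Sp d, ∫ x, f x * fderiv ℝ φ x v = - ∫ x, ⟪g x, v⟫_ℝ * φ x

/-- The square root of the Lebesgue density of `μ`. -/
def sqrtDensity (μ : Measure (Sp d)) (x : Sp d) : ℝ :=
  √((μ.rnDeriv volume x).toReal)

/-- The Fisher information: `4 ∫ |∇√μ|² dx` if `μ ∈ 𝒫₂,ac` and `√μ ∈ H¹`, and `+∞` otherwise.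
The weak gradient `g` of `√μ` is a.e. unique, so the infimum is over one value (or over none,
in which case it is `+∞`). -/
def fisher (μ : Measure (Sp d)) : ENNReal :=
  ⨅ (g : Sp d → Sp d) (_ : IsP2ac μ ∧ IsH1WithGradient (sqrtDensity μ) g),
    4 * ∫⁻ x, ‖g x‖ₑ ^ 2

/-- The norm of `α` in `L^∞([t₀,T] × ℝᵈ; ℝᵈ)` (essential supremum for Lebesgue measure). -/
def supNorm (t₀ T : ℝ) (α : ℝ → Sp d → Sp d) : ENNReal :=
  eLpNorm (Function.uncurry α) ⊤ ((volume : Measure (ℝ × Sp d)).restrict (Icc t₀ T ×ˢ univ))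

/-- `μ ∈ C([t₀,T], 𝒫₂(ℝᵈ))`, where `𝒫₂` carries the distance `d2`. -/
structure IsP2Curve (t₀ T : ℝ) (μ : ℝ → Measure (Sp d)) : Prop where
  isP2 : ∀ t ∈ Icc t₀ T, IsP2 (μ t)
  continuous : ∀ t ∈ Icc t₀ T, Tendsto (fun s => d2 (μ s) (μ t)) (𝓝[Icc t₀ T] t) (𝓝 0)

/-- `(μ, α)` satisfies `∂ₜμ + div(α μ) - Δμ = 0` in `(t₀,T) × ℝᵈ`, `μ(t₀) = μ₀`, in the sense of
distributions, where `μ ∈ C([t₀,T], 𝒫₂(ℝᵈ))` and `α ∈ L²([t₀,T] × ℝᵈ, dt ⊗ μₜ)`. -/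
structure IsSolution (t₀ T : ℝ) (μ₀ : Measure (Sp d)) (μ : ℝ → Measure (Sp d))
    (α : ℝ → Sp d → Sp d) : Prop where
  curve : IsP2Curve t₀ T μ
  measurable : Measurable (Function.uncurry α)
  square_integrable : ∫⁻ t in Icc t₀ T, ∫⁻ x, ‖α t x‖ₑ ^ 2 ∂(μ t) < ⊤
  initial : μ t₀ = μ₀
  equation : ∀ ψ : ℝ × Sp d → ℝ, ContDiff ℝ ∞ ψ → HasCompactSupport ψ →
    tsupport ψ ⊆ Ioo t₀ T ×ˢ univ →
    ∫ t in t₀..T, ∫ x, (deriv (fun s => ψ (s, x)) t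
      + ⟪α t x, gradient (fun y => ψ (t, y)) x⟫_ℝ
      + Laplacian.laplacian (fun y => ψ (t, y)) x) ∂(μ t) = 0

/-- `‖∇²φ‖_∞`, the supremum over `x` of the operator norm of the Hessian of `φ` at `x`
(finite for `φ ∈ C_c^∞`). -/
def hessianNorm (φ : Sp d → ℝ) : ℝ := ⨆ x, ‖fderiv ℝ (gradient φ) x‖

/-- `t ↦ αₜ` is continuous at `t₀⁺` in `L²(μ₀)`. -/
def RightContinuousL2 (t₀ : ℝ) (μ₀ : Measure (Sp d)) (α : ℝ → Sp d → Sp d) : Prop :=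
  MemLp (α t₀) 2 μ₀ ∧
    Tendsto (fun t => eLpNorm (fun x => α t x - α t₀ x) 2 μ₀) (𝓝[>] t₀) (𝓝 0)

end FokkerPlanck

end

/-!
Written as a continuity equation, `∂ₜμ = Δμ - div (α μ)` has formally the velocity `α - ∇ log μ`.
The drift has size `‖α‖_∞` and the initial osmotic velocity `∇ log μ₀` has `L²(μ₀)` norm
`I(μ₀)^{1/2}`; this is the Lipschitz constant. Only the initial Fisher information enters, since the
heat flow started from `μ₀` moves at most at its initial speed, and the drift perturbs it by at most
`‖α‖_∞` per unit of time.

**The Lipschitz estimate.** The argument is dual, without optimal maps. By Kantorovich duality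
(`exists_coupling_of_dual_bound`, from the Hahn-Banach and Riesz theorems) it suffices to bound
`∫ ψ dμₜ - ∫ f dμ₀` when `ψ(y) ≤ f(x) + |x - y|²`. The unit transport time is divided between drift
and diffusion in proportion to their speeds, and each share is run through many short Hopf-Lax steps. A
Hopf-Lax step of length `δ` lowers a smooth function by about `(δ/4) |∇u|²`
(`HopfLaxBelow.sq_gradient_le`). This gap absorbs the kinetic term `α · ∇u ≤ A²/c + (c/4) |∇u|²` of
a short step of the equation (`IsSolution.exists_drift_step`), and likewise the term `∫ Δu dμ₀`,
bounded through the Fisher information (`FisherBound`), in a short step of the heat flow from `μ₀`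
(`FisherBound.exists_heat_step`). Chaining the drift steps compares `μₜ` with the heat flow of `μ₀`
at time `t - t₀`, and chaining the heat steps compares that heat flow with `μ₀`. All functions are
mollified by a fixed kernel, so that a single derivative bound makes the step errors uniform.

**The drift along the solution.** The bound on `α` holds almost everywhere for Lebesgue measure and
has to be transferred to `μₜ`. This is possible because `μₜ` has a density for almost every `t`
(`IsSolution.ae_absolutelyContinuous`): Duhamel's formula (`IsSolution.abs_integral_sub_heat_le`)
compares `μₜ` with the heat flow of `μ₀` on bumps around a null set, for which the heat semigroup is
small, and the smoothing rate `τ^{-1/2}` is integrable against the drift at almost every time.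

**The expansion.** Taylor's formula along the optimal map has an error at most
`‖∇²φ‖_∞ d₂(μ₀, μ_{t₀+h})²`, which the Lipschitz estimate makes quadratic in `h`; the increment of `∫ φ dμₜ` is
given by the equation. For the derivative at `t₀`, the drift at time `r` has to be integrated
against `μ₀` instead of `μᵣ`. Since `αᵣ` is bounded but not continuous, this takes the continuity of
`μᵣ` at `t₀` in total variation (`IsSolution.abs_integral_sub_initial_le_of_measurable`), which
again follows from Duhamel's formula and the finite Fisher information of `μ₀`.
-/

noncomputable section

namespace FokkerPlanck

/-! ### Kantorovich duality for bounded continuous potentials -/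

section Duality

open scoped BoundedContinuousFunction CompactlySupported

variable {X : Type*} [MetricSpace X] [ProperSpace X] [MeasurableSpace X] [BorelSpace X]

/-- The values `∫ φ dμ + ∫ ψ dν + l K` over all `φ, ψ` bounded and continuous and `l > 0` such that
`u ≤ φ ⊕ ψ + l c`. The infimum of this set is a sublinear functional of `u`; a linear functional
below it is a coupling of `μ` and `ν` of cost at most `K`. -/
def dualValues (μ ν : Measure X) (c : X × X → ℝ) (K : ℝ) (u : X × X →ᵇ ℝ) : Set ℝ :=
  {r | ∃ (φ ψ : X →ᵇ ℝ) (l : ℝ), 0 < l ∧ (∀ x y, u (x, y) ≤ φ x + ψ y + l * c (x, y)) ∧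
    r = ∫ x, φ x ∂μ + ∫ y, ψ y ∂ν + l * K}

section Sublinear

set_option linter.unusedSectionVars false

variable {μ ν : Measure X} [IsProbabilityMeasure μ] [IsProbabilityMeasure ν]
  {c : X × X → ℝ} {K : ℝ}

lemma dualValues_nonempty (hc0 : ∀ p, 0 ≤ c p) (u : X × X →ᵇ ℝ) :
    (dualValues μ ν c K u).Nonempty := by
  refine ⟨_, BoundedContinuousFunction.const X ‖u‖, 0, 1, one_pos, fun x y => ?_, rfl⟩
  have h1 := (le_abs_self _).trans (u.norm_coe_le_norm (x, y))
  have h2 := hc0 (x, y)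
  simp only [BoundedContinuousFunction.const_apply, BoundedContinuousFunction.coe_zero,
    Pi.zero_apply]
  linarith

lemma neg_norm_le_of_mem_dualValues
    (h : ∀ φ ψ : X →ᵇ ℝ, (∀ x y, φ x + ψ y ≤ c (x, y)) → ∫ x, φ x ∂μ + ∫ y, ψ y ∂ν ≤ K)
    {u : X × X →ᵇ ℝ} {r : ℝ} (hr : r ∈ dualValues μ ν c K u) : -‖u‖ ≤ r := by
  obtain ⟨φ, ψ, l, hl, hle, rfl⟩ := hr
  have key := h (-(l⁻¹ • φ) - BoundedContinuousFunction.const X (l⁻¹ * ‖u‖)) (-(l⁻¹ • ψ)) ?_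
  · have e1 : ∫ x, (-(l⁻¹ • φ) - BoundedContinuousFunction.const X (l⁻¹ * ‖u‖)) x ∂μ
        = -(l⁻¹ * ∫ x, φ x ∂μ) - l⁻¹ * ‖u‖ := by
      simp only [BoundedContinuousFunction.coe_sub, BoundedContinuousFunction.coe_neg,
        BoundedContinuousFunction.coe_smul, Pi.sub_apply, Pi.neg_apply, smul_eq_mul,
        BoundedContinuousFunction.const_apply]
      have hi : Integrable (fun x => -(l⁻¹ * φ x)) μ := ((φ.integrable μ).const_mul _).neg
      rw [integral_sub hi (integrable_const _), integral_neg, integral_const_mul]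
      simp
    have e2 : ∫ x, (-(l⁻¹ • ψ)) x ∂ν = -(l⁻¹ * ∫ x, ψ x ∂ν) := by
      simp only [BoundedContinuousFunction.coe_neg,
        BoundedContinuousFunction.coe_smul, Pi.neg_apply, smul_eq_mul]
      rw [integral_neg, integral_const_mul]
    rw [e1, e2] at key
    have := mul_le_mul_of_nonneg_left key hl.le
    field_simp at this
    linarith
  · intro x y
    have h1 := (abs_le.1 (u.norm_coe_le_norm (x, y))).1
    have h2 := hle x y
    simp only [BoundedContinuousFunction.coe_sub, BoundedContinuousFunction.coe_neg,
        BoundedContinuousFunction.coe_smul, Pi.sub_apply, Pi.neg_apply, smul_eq_mul,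
        BoundedContinuousFunction.const_apply]
    have h3 : -φ x - ‖u‖ - ψ y ≤ l * c (x, y) := by linarith
    have := mul_le_mul_of_nonneg_left h3 (inv_pos.2 hl).le
    rw [inv_mul_cancel_left₀ hl.ne'] at this
    linarith

/-- Any linear functional below the infimum of `dualValues` behaves like integration against a
coupling of cost at most `K`; it exists by Hahn–Banach. -/
lemma exists_linear_le_dualValues (hc0 : ∀ p, 0 ≤ c p)
    (h : ∀ φ ψ : X →ᵇ ℝ, (∀ x y, φ x + ψ y ≤ c (x, y)) → ∫ x, φ x ∂μ + ∫ y, ψ y ∂ν ≤ K) :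
    ∃ L : (X × X →ᵇ ℝ) →ₗ[ℝ] ℝ, ∀ u, ∀ r ∈ dualValues μ ν c K u, L u ≤ r := by
  have bdd : ∀ u, BddBelow (dualValues μ ν c K u) := fun u =>
    ⟨-‖u‖, fun r hr => neg_norm_le_of_mem_dualValues h hr⟩
  have ne := fun u => dualValues_nonempty (μ := μ) (ν := ν) (K := K) hc0 u
  have hom : ∀ l : ℝ, 0 < l → ∀ u, sInf (dualValues μ ν c K (l • u)) ≤
      l * sInf (dualValues μ ν c K u) := by
    intro l hl u
    rw [← div_le_iff₀' hl]
    refine le_csInf (ne u) ?_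
    rintro r ⟨φ, ψ, m, hm, hle, rfl⟩
    rw [div_le_iff₀' hl]
    refine csInf_le (bdd _) ⟨l • φ, l • ψ, l * m, by positivity, fun x y => ?_, ?_⟩
    · have := mul_le_mul_of_nonneg_left (hle x y) hl.le
      simp only [BoundedContinuousFunction.coe_smul, smul_eq_mul]
      linarith
    · simp only [BoundedContinuousFunction.coe_smul, smul_eq_mul, integral_const_mul]
      ring
  have hom' : ∀ l : ℝ, 0 < l → ∀ u, sInf (dualValues μ ν c K (l • u)) =
      l * sInf (dualValues μ ν c K u) := by
    intro l hl u
    refine le_antisymm (hom l hl u) ?_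
    have := hom l⁻¹ (inv_pos.2 hl) (l • u)
    rw [smul_smul, inv_mul_cancel₀ hl.ne', one_smul] at this
    rw [← le_div_iff₀' hl, div_eq_inv_mul]
    exact this
  have hadd : ∀ u v, sInf (dualValues μ ν c K (u + v)) ≤
      sInf (dualValues μ ν c K u) + sInf (dualValues μ ν c K v) := by
    intro u v
    rw [← csInf_add (ne u) (bdd u) (ne v) (bdd v)]
    refine le_csInf ((ne u).add (ne v)) ?_
    rintro _ ⟨_, ⟨φ, ψ, m, hm, hle, rfl⟩, _, ⟨φ', ψ', m', hm', hle', rfl⟩, rfl⟩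
    refine csInf_le (bdd _) ⟨φ + φ', ψ + ψ', m + m', by positivity, fun x y => ?_, ?_⟩
    · have h1 := hle x y
      have h2 := hle' x y
      simp only [BoundedContinuousFunction.coe_add, Pi.add_apply]
      linarith
    · simp only [BoundedContinuousFunction.coe_add, Pi.add_apply]
      rw [integral_add (φ.integrable μ) (φ'.integrable μ),
        integral_add (ψ.integrable ν) (ψ'.integrable ν)]
      ring
  have hzero : ∀ u : (⊥ : (X × X →ᵇ ℝ) →ₗ.[ℝ] ℝ).domain,
      (⊥ : (X × X →ᵇ ℝ) →ₗ.[ℝ] ℝ) u ≤ sInf (dualValues μ ν c K u) := by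
    intro u
    have hu0 : u = 0 := Subtype.ext ((Submodule.mem_bot ℝ).1 u.2)
    rw [hu0, LinearPMap.map_zero]
    refine le_csInf (ne _) fun r hr => ?_
    simpa using neg_norm_le_of_mem_dualValues h hr
  obtain ⟨L, -, hL⟩ := exists_extension_of_le_sublinear (⊥ : (X × X →ᵇ ℝ) →ₗ.[ℝ] ℝ)
    (fun u => sInf (dualValues μ ν c K u)) hom' hadd hzero
  exact ⟨L, fun u r hr => (hL u).trans (csInf_le (bdd u) hr)⟩

end Sublinear

/-- A positive functional on bounded continuous functions of two variables whose marginals are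
probability measures is integration against a measure: no mass escapes to infinity. -/
lemma exists_measure_of_positive_functional [Nonempty X] {μ ν : Measure X}
    [IsProbabilityMeasure μ] [IsProbabilityMeasure ν] (L : (X × X →ᵇ ℝ) →ₗ[ℝ] ℝ)
    (hpos : ∀ u, (∀ p, 0 ≤ u p) → 0 ≤ L u)
    (hL : ∀ (u : X × X →ᵇ ℝ) (φ ψ : X →ᵇ ℝ), (∀ x y, u (x, y) ≤ φ x + ψ y) →
      L u ≤ ∫ x, φ x ∂μ + ∫ y, ψ y ∂ν) :
    ∃ γ : Measure (X × X), IsFiniteMeasure γ ∧ ∀ u : X × X →ᵇ ℝ, ∫ p, u p ∂γ = L u := by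
  classical
  obtain ⟨x₀⟩ := ‹Nonempty X›
  let toB : C_c(X × X, ℝ) → (X × X →ᵇ ℝ) := fun f =>
    BoundedContinuousFunction.ofNormedAddCommGroup f f.continuous
      (Classical.choose (f.hasCompactSupport.exists_bound_of_continuous f.continuous))
      (Classical.choose_spec (f.hasCompactSupport.exists_bound_of_continuous f.continuous))
  have htoB : ∀ f p, toB f p = f p := fun f p => rfl
  let Λ : C_c(X × X, ℝ) →ₚ[ℝ] ℝ := PositiveLinearMap.mk₀
    { toFun := fun f => L (toB f)
      map_add' := fun f g => by rw [← map_add]; congr 1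
      map_smul' := fun a f => by rw [RingHom.id_apply, ← map_smul]; congr 1 }
    (fun f hf => hpos _ fun p => hf p)
  have hΛ : ∀ f, Λ f = L (toB f) := fun f => rfl
  let γ := RealRMK.rieszMeasure Λ
  have hγ : ∀ f : C_c(X × X, ℝ), ∫ p, f p ∂γ = L (toB f) := fun f =>
    RealRMK.integral_rieszMeasure Λ f
  have mono : ∀ u v : X × X →ᵇ ℝ, (∀ p, u p ≤ v p) → L u ≤ L v := by
    intro u v huv
    have := hpos (v - u) (fun p => by simpa using huv p)
    rw [map_sub] at this
    linarith
  have hL1 : L (BoundedContinuousFunction.const _ 1) ≤ 1 := by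
    have := hL (BoundedContinuousFunction.const _ 1) (BoundedContinuousFunction.const _ 1) 0
      (fun x y => by simp)
    simpa using this
  -- cutoffs, `θ n = 1` on the ball of radius `n` and `θ n = 0` off the ball of radius `n + 1`
  let θ : ℕ → X → ℝ := fun n x => max 0 (min 1 (n + 1 - dist x x₀))
  have θc : ∀ n, Continuous (θ n) := fun n => by fun_prop
  have θ0 : ∀ n x, 0 ≤ θ n x := fun n x => le_max_left _ _
  have θ1 : ∀ n x, θ n x ≤ 1 := fun n x => max_le zero_le_one (min_le_left _ _)
  have θlim : ∀ x, Tendsto (fun n => θ n x) atTop (𝓝 1) := by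
    intro x
    refine tendsto_const_nhds.congr' ?_
    filter_upwards [eventually_ge_atTop ⌈dist x x₀⌉₊] with n hn
    have : dist x x₀ ≤ n := (Nat.le_ceil _).trans (by exact_mod_cast hn)
    have h1 : min 1 ((n : ℝ) + 1 - dist x x₀) = 1 := min_eq_left (by linarith)
    simp [θ, h1]
  have θsupp : ∀ (n : ℕ) x, x ∉ Metric.closedBall x₀ ((n : ℝ) + 1) → θ n x = 0 := by
    intro n x hx
    rw [Metric.mem_closedBall, not_le] at hx
    exact max_eq_left ((min_le_right _ _).trans (by linarith))
  let cut : ℕ → (X × X →ᵇ ℝ) → C_c(X × X, ℝ) := fun n u =>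
    ⟨⟨fun p => θ n p.1 * θ n p.2 * u p, by fun_prop⟩, by
      refine HasCompactSupport.of_support_subset_isCompact
        ((isCompact_closedBall x₀ ((n : ℝ) + 1)).prod (isCompact_closedBall x₀ ((n : ℝ) + 1))) ?_
      intro p hp
      by_contra hcon
      rw [mem_prod, not_and_or] at hcon
      apply hp
      rcases hcon with hh | hh <;> simp [θsupp n _ hh]⟩
  have hcut : ∀ n u p, cut n u p = θ n p.1 * θ n p.2 * u p := fun n u p => rfl
  have θθ0 : ∀ n (p : X × X), 0 ≤ θ n p.1 * θ n p.2 := fun n p => mul_nonneg (θ0 _ _) (θ0 _ _)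
  have θθ1 : ∀ n (p : X × X), θ n p.1 * θ n p.2 ≤ 1 := fun n p =>
    mul_le_one₀ (θ1 _ _) (θ0 _ _) (θ1 _ _)
  have lim_pt : ∀ u p, Tendsto (fun n => cut n u p) atTop (𝓝 (u p)) := by
    intro u p
    have := ((θlim p.1).mul (θlim p.2)).mul_const (u p)
    simpa [hcut] using this
  have fin : IsFiniteMeasure γ := by
    constructor
    have h1 : ∀ n, ∫⁻ p, ENNReal.ofReal (θ n p.1 * θ n p.2) ∂γ ≤ 1 := by
      intro n
      have e : (fun p : X × X => θ n p.1 * θ n p.2)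
          = fun p => cut n (BoundedContinuousFunction.const _ 1) p := by
        ext p; simp [hcut]
      have hi : Integrable (fun p : X × X => θ n p.1 * θ n p.2) γ := by
        rw [e]
        exact (cut n _).continuous.integrable_of_hasCompactSupport (cut n _).hasCompactSupport
      rw [← ofReal_integral_eq_lintegral_ofReal hi (Eventually.of_forall (θθ0 n)), e, hγ]
      refine ENNReal.ofReal_le_one.2 ((mono _ _ fun p => ?_).trans hL1)
      rw [htoB, hcut]
      simpa using θθ1 n p
    have h2 : ∫⁻ p : X × X, 1 ∂γ ≤ 1 := by
      have : ∀ p : X × X, (1 : ENNReal)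
          = liminf (fun n => ENNReal.ofReal (θ n p.1 * θ n p.2)) atTop := by
        intro p
        have := ENNReal.tendsto_ofReal ((θlim p.1).mul (θlim p.2))
        rw [mul_one, ENNReal.ofReal_one] at this
        exact this.liminf_eq.symm
      calc ∫⁻ p : X × X, 1 ∂γ
          = ∫⁻ p : X × X, liminf (fun n => ENNReal.ofReal (θ n p.1 * θ n p.2)) atTop ∂γ := by
            simp_rw [← this]
        _ ≤ liminf (fun n => ∫⁻ p : X × X, ENNReal.ofReal (θ n p.1 * θ n p.2) ∂γ) atTop := by
            refine lintegral_liminf_le fun n => ?_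
            have := θc n
            exact (ENNReal.continuous_ofReal.comp
              (by fun_prop : Continuous fun p : X × X => θ n p.1 * θ n p.2)).measurable
        _ ≤ 1 := liminf_le_of_le (by isBoundedDefault) fun b hb => by
            obtain ⟨n, hn⟩ := hb.exists
            exact hn.trans (h1 n)
    rw [lintegral_one] at h2
    exact h2.trans_lt ENNReal.one_lt_top
  refine ⟨γ, fin, fun u => ?_⟩
  have t1 : Tendsto (fun n => ∫ p, cut n u p ∂γ) atTop (𝓝 (∫ p, u p ∂γ)) := by
    refine tendsto_integral_of_dominated_convergence (fun _ => ‖u‖)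
      (fun n => (cut n u).continuous.aestronglyMeasurable) (integrable_const _)
      (fun n => Eventually.of_forall fun p => ?_) (Eventually.of_forall (lim_pt u))
    rw [hcut, norm_mul, Real.norm_of_nonneg (θθ0 n p)]
    calc _ ≤ 1 * ‖u‖ := mul_le_mul (θθ1 n p) (u.norm_coe_le_norm p) (norm_nonneg _) zero_le_one
      _ = ‖u‖ := one_mul _
  -- the mass of `L` off the cutoffs is controlled by the marginals
  let η : ℕ → X →ᵇ ℝ := fun n => BoundedContinuousFunction.ofNormedAddCommGroup
    (fun x => 1 - θ n x) (by have := θc n; fun_prop) 1 (fun x => by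
      rw [Real.norm_of_nonneg (by linarith [θ1 n x])]; linarith [θ0 n x])
  have hη : ∀ n x, η n x = 1 - θ n x := fun n x => rfl
  have ηlim : ∀ (m : Measure X) [IsProbabilityMeasure m],
      Tendsto (fun n => ∫ x, η n x ∂m) atTop (𝓝 0) := by
    intro m _
    rw [← integral_zero X ℝ (μ := m)]
    refine tendsto_integral_of_dominated_convergence (fun _ => 1)
      (fun n => (η n).continuous.aestronglyMeasurable) (integrable_const _)
      (fun n => Eventually.of_forall fun x => ?_) (Eventually.of_forall fun x => ?_)
    · rw [hη, Real.norm_of_nonneg (by linarith [θ1 n x])]; linarith [θ0 n x]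
    · simpa [hη] using (θlim x).const_sub 1
  have bound : ∀ n, |L u - L (toB (cut n u))| ≤ ‖u‖ * (∫ x, η n x ∂μ + ∫ x, η n x ∂ν) := by
    intro n
    have gen : ∀ v : X × X →ᵇ ℝ, (∀ p, v p ≤ ‖u‖ * (1 - θ n p.1 * θ n p.2)) →
        L v ≤ ‖u‖ * (∫ x, η n x ∂μ + ∫ x, η n x ∂ν) := by
      intro v hv
      have := hL v (‖u‖ • η n) (‖u‖ • η n) ?_
      · simp only [BoundedContinuousFunction.coe_smul, smul_eq_mul, integral_const_mul] at this
        linarith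
      · intro x y
        refine (hv (x, y)).trans ?_
        simp only [BoundedContinuousFunction.coe_smul, smul_eq_mul, hη]
        rw [← mul_add]
        refine mul_le_mul_of_nonneg_left ?_ (norm_nonneg _)
        nlinarith [mul_nonneg (sub_nonneg.2 (θ1 n x)) (sub_nonneg.2 (θ1 n y))]
    have hub : ∀ p, |u p - cut n u p| ≤ ‖u‖ * (1 - θ n p.1 * θ n p.2) := by
      intro p
      rw [hcut, ← one_sub_mul, abs_mul, abs_of_nonneg (by linarith [θθ1 n p]), mul_comm]
      exact mul_le_mul_of_nonneg_right (u.norm_coe_le_norm p) (by linarith [θθ1 n p])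
    rw [abs_le', ← map_sub, ← map_neg]
    refine ⟨gen _ fun p => ?_, gen _ fun p => ?_⟩
    · exact (le_abs_self _).trans (hub p)
    · exact (neg_le_abs _).trans (hub p)
  have t2 : Tendsto (fun n => L (toB (cut n u))) atTop (𝓝 (L u)) := by
    rw [tendsto_iff_norm_sub_tendsto_zero]
    have h0 := ((ηlim μ).add (ηlim ν)).const_mul ‖u‖
    rw [add_zero, mul_zero] at h0
    refine squeeze_zero (fun _ => norm_nonneg _) (fun n => ?_) h0
    rw [norm_sub_rev]
    exact bound n
  refine tendsto_nhds_unique t1 (t2.congr fun n => ?_)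
  rw [hγ]

/-- Kantorovich duality: if `∫ φ dμ + ∫ ψ dν ≤ K` for all bounded continuous potentials with
`φ ⊕ ψ ≤ c`, then some coupling of `μ` and `ν` has cost at most `K`. -/
theorem exists_coupling_of_dual_bound {μ ν : Measure X}
    [IsProbabilityMeasure μ] [IsProbabilityMeasure ν] {c : X × X → ℝ} (hc : Continuous c)
    (hc0 : ∀ p, 0 ≤ c p) {K : ℝ}
    (h : ∀ φ ψ : X →ᵇ ℝ, (∀ x y, φ x + ψ y ≤ c (x, y)) → ∫ x, φ x ∂μ + ∫ y, ψ y ∂ν ≤ K) :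
    ∃ γ : Measure (X × X), γ.map Prod.fst = μ ∧ γ.map Prod.snd = ν ∧
      ∫⁻ p, ENNReal.ofReal (c p) ∂γ ≤ ENNReal.ofReal K := by
  have : Nonempty X := nonempty_of_isProbabilityMeasure μ
  obtain ⟨L, hLr⟩ := exists_linear_le_dualValues (μ := μ) (ν := ν) hc0 h
  have hK : 0 ≤ K := by simpa using h 0 0 (fun x y => by simpa using hc0 (x, y))
  have hL : ∀ (u : X × X →ᵇ ℝ) (φ ψ : X →ᵇ ℝ), (∀ x y, u (x, y) ≤ φ x + ψ y) →
      L u ≤ ∫ x, φ x ∂μ + ∫ y, ψ y ∂ν := by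
    intro u φ ψ hu
    refine le_of_forall_pos_le_add fun ε hε => ?_
    have hl : 0 < ε / (K + 1) := by positivity
    refine (hLr u _ ⟨φ, ψ, ε / (K + 1), hl, fun x y => ?_, rfl⟩).trans ?_
    · have := mul_nonneg hl.le (hc0 (x, y))
      linarith [hu x y]
    · have : ε / (K + 1) * K ≤ ε := by
        rw [div_mul_eq_mul_div, div_le_iff₀ (by linarith)]
        nlinarith
      linarith
  have hpos : ∀ u, (∀ p, 0 ≤ u p) → 0 ≤ L u := by
    intro u hu
    have := hL (-u) 0 0 (fun x y => by simpa using hu (x, y))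
    simpa using this
  obtain ⟨γ, hfin, hγ⟩ := exists_measure_of_positive_functional (μ := μ) (ν := ν) L hpos hL
  have hmarg : ∀ (m : Measure X) [IsProbabilityMeasure m] (f : X × X → X) (hf : Continuous f),
      (∀ φ : X →ᵇ ℝ, L (φ.compContinuous ⟨f, hf⟩) ≤ ∫ x, φ x ∂m) → γ.map f = m := by
    intro m _ f hf hm
    have : IsFiniteMeasure (γ.map f) := inferInstance
    refine ext_of_forall_integral_eq_of_IsFiniteMeasure fun φ => ?_
    rw [integral_map hf.measurable.aemeasurable φ.continuous.aestronglyMeasurable]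
    have e := hγ (φ.compContinuous ⟨f, hf⟩)
    have e' : ∫ p, φ (f p) ∂γ = L (φ.compContinuous ⟨f, hf⟩) := e
    rw [e']
    refine le_antisymm (hm φ) ?_
    have h2 := hm (-φ)
    have h3 : (-φ).compContinuous ⟨f, hf⟩ = -(φ.compContinuous ⟨f, hf⟩) := rfl
    rw [h3, map_neg] at h2
    simp only [BoundedContinuousFunction.coe_neg, Pi.neg_apply, integral_neg] at h2
    linarith
  refine ⟨γ, hmarg μ Prod.fst continuous_fst fun φ => ?_,
    hmarg ν Prod.snd continuous_snd fun φ => ?_, ?_⟩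
  · simpa using hL (φ.compContinuous ⟨Prod.fst, continuous_fst⟩) φ 0 (fun x y => by simp)
  · simpa using hL (φ.compContinuous ⟨Prod.snd, continuous_snd⟩) 0 φ (fun x y => by simp)
  · let cm : ℕ → X × X →ᵇ ℝ := fun n => BoundedContinuousFunction.ofNormedAddCommGroup
      (fun p => min (c p) n) (by fun_prop) n (fun p => by
        rw [Real.norm_of_nonneg (le_min (hc0 p) (Nat.cast_nonneg n))]; exact min_le_right _ _)
    have hcm : ∀ n p, cm n p = min (c p) n := fun n p => rfl
    have h1 : ∀ n, ∫⁻ p, ENNReal.ofReal (cm n p) ∂γ ≤ ENNReal.ofReal K := by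
      intro n
      rw [← ofReal_integral_eq_lintegral_ofReal ((cm n).integrable γ)
        (Eventually.of_forall fun p => le_min (hc0 p) (Nat.cast_nonneg n)), hγ]
      refine ENNReal.ofReal_le_ofReal (hLr _ _ ⟨0, 0, 1, one_pos, fun x y => ?_, by simp⟩)
      simp [hcm]
    have h2 : ∀ p, ENNReal.ofReal (c p)
        = liminf (fun n => ENNReal.ofReal (cm n p)) atTop := by
      intro p
      have : Tendsto (fun n => ENNReal.ofReal (cm n p)) atTop (𝓝 (ENNReal.ofReal (c p))) := by
        refine tendsto_const_nhds.congr' ?_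
        filter_upwards [eventually_ge_atTop ⌈c p⌉₊] with n hn
        have : c p ≤ n := (Nat.le_ceil _).trans (by exact_mod_cast hn)
        rw [hcm, min_eq_left this]
      exact this.liminf_eq.symm
    simp_rw [h2]
    refine (lintegral_liminf_le fun n => ?_).trans
      (liminf_le_of_le (by isBoundedDefault) fun b hb => ?_)
    · exact (ENNReal.continuous_ofReal.comp (cm n).continuous).measurable
    · obtain ⟨n, hn⟩ := hb.exists
      exact hn.trans (h1 n)

end Duality

/-! ### Test functions, averages and mollification -/

section TestFunctions

variable {d : ℕ} {F : Type} [NormedAddCommGroup F] [NormedSpace ℝ F]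

/-- A smooth function all of whose derivatives are bounded. -/
structure IsTest (u : Sp d → F) : Prop where
  contDiff : ContDiff ℝ ∞ u
  bounded : ∀ k : ℕ, ∃ C, ∀ x, ‖iteratedFDeriv ℝ k u x‖ ≤ C

/-- `B` bounds the derivatives of `u` up to order three. -/
def DerivBound (B : ℝ) (u : Sp d → F) : Prop :=
  ∀ k ≤ 3, ∀ x, ‖iteratedFDeriv ℝ k u x‖ ≤ B

lemma IsTest.exists_derivBound {u : Sp d → F} (hu : IsTest u) : ∃ B, 0 ≤ B ∧ DerivBound B u := by
  choose C hC using hu.bounded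
  refine ⟨∑ k ∈ Finset.range 4, |C k|, Finset.sum_nonneg fun _ _ => abs_nonneg _,
    fun k hk x => (hC k x).trans ((le_abs_self _).trans ?_)⟩
  exact Finset.single_le_sum (f := fun k => |C k|) (fun _ _ => abs_nonneg _)
    (Finset.mem_range.2 (by omega))

lemma IsTest.of_hasCompactSupport {u : Sp d → F} (hu : ContDiff ℝ ∞ u)
    (hc : HasCompactSupport u) : IsTest u :=
  ⟨hu, fun k => (hc.iteratedFDeriv k).exists_bound_of_continuous
    (hu.continuous_iteratedFDeriv (by exact_mod_cast le_top))⟩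

lemma IsTest.fderiv {u : Sp d → F} (hu : IsTest u) : IsTest (fderiv ℝ u) :=
  ⟨hu.contDiff.fderiv_right (by simp), fun k => by
    simpa only [norm_iteratedFDeriv_fderiv] using hu.bounded (k + 1)⟩

lemma IsTest.differentiable {u : Sp d → F} (hu : IsTest u) : Differentiable ℝ u :=
  hu.contDiff.differentiable (by simp)

lemma IsTest.continuous {u : Sp d → F} (hu : IsTest u) : Continuous u := hu.contDiff.continuous

lemma IsTest.exists_norm_le {u : Sp d → F} (hu : IsTest u) : ∃ C, ∀ x, ‖u x‖ ≤ C := by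
  simpa using hu.bounded 0

lemma IsTest.integrable {u : Sp d → F} (hu : IsTest u) (m : Measure (Sp d)) [IsFiniteMeasure m] :
    Integrable u m := by
  obtain ⟨C, hC⟩ := hu.exists_norm_le
  exact Integrable.of_bound hu.continuous.aestronglyMeasurable C (Eventually.of_forall hC)

lemma IsTest.clm_comp {G : Type} [NormedAddCommGroup G] [NormedSpace ℝ G] {u : Sp d → F}
    (hu : IsTest u) (L : F →L[ℝ] G) : IsTest fun x => L (u x) := by
  refine ⟨L.contDiff.comp hu.contDiff, fun k => ?_⟩
  obtain ⟨C, hC⟩ := hu.bounded k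
  refine ⟨‖L‖ * C, fun x => ?_⟩
  exact (L.norm_iteratedFDeriv_comp_left hu.contDiff.contDiffAt
    (by exact_mod_cast le_top)).trans (mul_le_mul_of_nonneg_left (hC x) (norm_nonneg _))

section Average

/-- The average `x ↦ ∫ u (x + z) dm(z)` of the translates of `u`. -/
def average (m : Measure (Sp d)) (u : Sp d → F) (x : Sp d) : F := ∫ z, u (x + z) ∂m

variable {m : Measure (Sp d)} [IsProbabilityMeasure m]

lemma IsTest.comp_add_left {u : Sp d → F} (hu : IsTest u) (x : Sp d) :
    IsTest fun z => u (x + z) := by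
  refine ⟨hu.contDiff.comp (by fun_prop), fun k => ?_⟩
  obtain ⟨C, hC⟩ := hu.bounded k
  exact ⟨C, fun z => by rw [iteratedFDeriv_comp_add_left]; exact hC _⟩

lemma norm_average_le {u : Sp d → F} {C : ℝ} (hC : ∀ x, ‖u x‖ ≤ C) (x : Sp d) :
    ‖average m u x‖ ≤ C := by
  simpa [average] using norm_integral_le_of_norm_le_const (μ := m)
    (Eventually.of_forall fun z => hC (x + z))

lemma IsTest.hasFDerivAt_average {u : Sp d → F} (hu : IsTest u) (x : Sp d) :
    HasFDerivAt (average m u) (average m (_root_.fderiv ℝ u) x) x := by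
  obtain ⟨C, hC⟩ := hu.fderiv.exists_norm_le
  refine hasFDerivAt_integral_of_dominated_of_fderiv_le (F := fun x z => u (x + z))
    (F' := fun x z => _root_.fderiv ℝ u (x + z)) (bound := fun _ => C) univ_mem
    (Eventually.of_forall fun x => (hu.comp_add_left x).continuous.aestronglyMeasurable)
    ((hu.comp_add_left x).integrable m)
    (hu.fderiv.comp_add_left x).continuous.aestronglyMeasurable
    (Eventually.of_forall fun z y _ => hC _) (integrable_const _)
    (Eventually.of_forall fun z y _ => ?_)
  have := (hu.differentiable (y + z)).hasFDerivAt.comp y ((hasFDerivAt_id y).add_const z)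
  rwa [ContinuousLinearMap.comp_id] at this

lemma IsTest.fderiv_average {u : Sp d → F} (hu : IsTest u) :
    _root_.fderiv ℝ (average m u) = average m (_root_.fderiv ℝ u) :=
  funext fun x => (hu.hasFDerivAt_average x).fderiv

lemma IsTest.norm_iteratedFDeriv_average_le (k : ℕ) : ∀ {F : Type} [NormedAddCommGroup F]
    [NormedSpace ℝ F] [CompleteSpace F] {u : Sp d → F} (_ : IsTest u) {C : ℝ}
    (_ : ∀ x, ‖iteratedFDeriv ℝ k u x‖ ≤ C) (x : Sp d),
    ‖iteratedFDeriv ℝ k (average m u) x‖ ≤ C := by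
  induction k with
  | zero =>
    intro F _ _ _ u hu C hC x
    simp only [norm_iteratedFDeriv_zero] at hC ⊢
    exact norm_average_le hC x
  | succ k ih =>
    intro F _ _ _ u hu C hC x
    simp only [← norm_iteratedFDeriv_fderiv] at hC ⊢
    rw [hu.fderiv_average]
    exact ih hu.fderiv hC x

lemma IsTest.contDiff_average (n : ℕ) : ∀ {F : Type} [NormedAddCommGroup F]
    [NormedSpace ℝ F] [CompleteSpace F] {u : Sp d → F} (_ : IsTest u),
    ContDiff ℝ n (average m u) := by
  induction n with
  | zero =>
    intro F _ _ _ u hu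
    exact contDiff_zero.2 (continuous_iff_continuousAt.2 fun x =>
      (hu.hasFDerivAt_average x).continuousAt)
  | succ n ih =>
    intro F _ _ _ u hu
    push_cast
    refine contDiff_succ_iff_fderiv.2 ⟨fun x => (hu.hasFDerivAt_average x).differentiableAt,
      by simp, ?_⟩
    rw [hu.fderiv_average]
    exact ih hu.fderiv

variable [CompleteSpace F]

lemma IsTest.average {u : Sp d → F} (hu : IsTest u) : IsTest (average m u) :=
  ⟨contDiff_infty.2 fun n => hu.contDiff_average n, fun k => by
    obtain ⟨C, hC⟩ := hu.bounded k
    exact ⟨C, fun x => hu.norm_iteratedFDeriv_average_le k hC x⟩⟩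

lemma DerivBound.average {u : Sp d → F} (hu : IsTest u) {B : ℝ} (h : DerivBound B u) :
    DerivBound B (average m u) :=
  fun k hk => hu.norm_iteratedFDeriv_average_le k (h k hk)

lemma average_mono {u w : Sp d → ℝ} (hu : IsTest u) (hw : IsTest w) {x y : Sp d} {a : ℝ}
    (h : ∀ z, u (x + z) ≤ w (y + z) + a) : FokkerPlanck.average m u x ≤
      FokkerPlanck.average m w y + a := by
  have hi := (hw.comp_add_left y).integrable m
  have h1 : ∫ z, u (x + z) ∂m ≤ ∫ z, (w (y + z) + a) ∂m :=
    integral_mono ((hu.comp_add_left x).integrable m) (hi.add (integrable_const a)) h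
  rw [integral_add hi (integrable_const a)] at h1
  simpa [FokkerPlanck.average] using h1

end Average

section Mollify

/-- The convolution `x ↦ ∫ g (x - t) φ(t) dt` of a scalar function with a vector valued kernel. -/
def mollify (φ : Sp d → F) (g : Sp d → ℝ) (x : Sp d) : F := ∫ t, g (x - t) • φ t

variable {g : Sp d → ℝ} {M : ℝ}

lemma norm_mollify_le (hM : ∀ x, |g x| ≤ M) {φ : Sp d → F}
    (hφ : Integrable φ) (x : Sp d) : ‖mollify φ g x‖ ≤ M * ∫ t, ‖φ t‖ := by
  rw [← integral_const_mul]
  refine norm_integral_le_of_norm_le (hφ.norm.const_mul M) (Eventually.of_forall fun t => ?_)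
  rw [norm_smul]
  exact mul_le_mul_of_nonneg_right (hM _) (norm_nonneg _)

lemma locallyIntegrable_of_bound (hg : Measurable g) (hM : ∀ x, |g x| ≤ M) :
    LocallyIntegrable g (volume : Measure (Sp d)) := fun x =>
  ⟨Metric.ball x 1, Metric.ball_mem_nhds x one_pos,
    Measure.integrableOn_of_bounded measure_ball_lt_top.ne hg.aestronglyMeasurable
      (Eventually.of_forall hM)⟩

lemma hasFDerivAt_mollify (hg : LocallyIntegrable g)
    {φ : Sp d → F} (hφ : ContDiff ℝ ∞ φ) (hc : HasCompactSupport φ) (x : Sp d) :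
    HasFDerivAt (mollify φ g) (mollify (_root_.fderiv ℝ φ) g x) x :=
  hc.hasFDerivAt_convolution_left (ContinuousLinearMap.lsmul ℝ ℝ).flip
    (hφ.of_le (by simp)) hg x

lemma contDiff_mollify (hg : LocallyIntegrable g)
    {φ : Sp d → F} (hφ : ContDiff ℝ ∞ φ) (hc : HasCompactSupport φ) :
    ContDiff ℝ ∞ (mollify φ g) :=
  hc.contDiff_convolution_left (n := ⊤) (ContinuousLinearMap.lsmul ℝ ℝ).flip hφ hg

lemma norm_iteratedFDeriv_mollify_le (hg : LocallyIntegrable g) (hM : ∀ x, |g x| ≤ M) (k : ℕ) :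
    ∀ {F : Type} [NormedAddCommGroup F] [NormedSpace ℝ F] {φ : Sp d → F}
    (_ : ContDiff ℝ ∞ φ) (_ : HasCompactSupport φ) (x : Sp d),
    ‖iteratedFDeriv ℝ k (mollify φ g) x‖ ≤ M * ∫ t, ‖iteratedFDeriv ℝ k φ t‖ := by
  induction k with
  | zero =>
    intro F _ _ φ hφ hc x
    simp only [norm_iteratedFDeriv_zero]
    exact norm_mollify_le hM (hφ.continuous.integrable_of_hasCompactSupport hc) x
  | succ k ih =>
    intro F _ _ φ hφ hc x
    simp only [← norm_iteratedFDeriv_fderiv]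
    rw [show _root_.fderiv ℝ (mollify φ g) = mollify (_root_.fderiv ℝ φ) g from
      funext fun x => (hasFDerivAt_mollify hg hφ hc x).fderiv]
    exact ih (hφ.fderiv_right (by simp)) (hc.fderiv ℝ) x

lemma isTest_mollify (hg : Measurable g) (hM : ∀ x, |g x| ≤ M)
    {φ : Sp d → F} (hφ : ContDiff ℝ ∞ φ) (hc : HasCompactSupport φ) : IsTest (mollify φ g) :=
  ⟨contDiff_mollify (locallyIntegrable_of_bound hg hM) hφ hc, fun k =>
    ⟨_, norm_iteratedFDeriv_mollify_le (locallyIntegrable_of_bound hg hM) hM k hφ hc⟩⟩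

/-- The derivative bound of a mollification depends on the mollified function only through its
supremum. -/
lemma exists_derivBound_mollify {φ : Sp d → F} (hφ : ContDiff ℝ ∞ φ) (hc : HasCompactSupport φ)
    (M : ℝ) : ∃ B, 0 ≤ B ∧ ∀ g : Sp d → ℝ, Measurable g → (∀ x, |g x| ≤ M) →
      DerivBound B (mollify φ g) := by
  have h0 : ∀ k, 0 ≤ |M| * ∫ t, ‖iteratedFDeriv ℝ k φ t‖ := fun k =>
    mul_nonneg (abs_nonneg _) (integral_nonneg fun _ => norm_nonneg _)
  refine ⟨∑ k ∈ Finset.range 4, |M| * ∫ t, ‖iteratedFDeriv ℝ k φ t‖,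
    Finset.sum_nonneg fun _ _ => h0 _, fun g hg hM k hk x => ?_⟩
  refine (norm_iteratedFDeriv_mollify_le (locallyIntegrable_of_bound hg hM)
    (fun x => (hM x).trans (le_abs_self M)) k hφ hc x).trans ?_
  exact Finset.single_le_sum (f := fun k => |M| * ∫ t, ‖iteratedFDeriv ℝ k φ t‖)
    (fun _ _ => h0 _) (Finset.mem_range.2 (by omega))

end Mollify

/-! ### Taylor estimates -/

lemma DerivBound.norm_le {u : Sp d → F} {B : ℝ} (h : DerivBound B u) (x : Sp d) : ‖u x‖ ≤ B := by
  simpa using h 0 (by norm_num) x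

lemma DerivBound.norm_fderiv_le {u : Sp d → F} {B : ℝ} (h : DerivBound B u) (x : Sp d) :
    ‖fderiv ℝ u x‖ ≤ B := by
  simpa using h 1 (by norm_num) x

lemma DerivBound.norm_fderiv_fderiv_le {u : Sp d → F} {B : ℝ} (h : DerivBound B u) (x : Sp d) :
    ‖fderiv ℝ (fderiv ℝ u) x‖ ≤ B := by
  have := h 2 (by norm_num) x
  rwa [← norm_iteratedFDeriv_fderiv, norm_iteratedFDeriv_one] at this

lemma lipschitz_of_norm_fderiv_le {u : Sp d → F} (hu : Differentiable ℝ u) {B : ℝ}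
    (h : ∀ x, ‖fderiv ℝ u x‖ ≤ B) (x y : Sp d) : ‖u y - u x‖ ≤ B * ‖y - x‖ :=
  convex_univ.norm_image_sub_le_of_norm_fderiv_le (fun z _ => hu z) (fun z _ => h z)
    (mem_univ x) (mem_univ y)

lemma norm_taylor_one_le {u : Sp d → F} (hu : IsTest u) {B : ℝ}
    (h : ∀ x, ‖iteratedFDeriv ℝ 2 u x‖ ≤ B) (x v : Sp d) :
    ‖u (x + v) - u x - fderiv ℝ u x v‖ ≤ B * ‖v‖ ^ 2 := by
  have hB : 0 ≤ B := (norm_nonneg _).trans (h x)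
  replace h : ∀ x, ‖fderiv ℝ (fderiv ℝ u) x‖ ≤ B := fun x => by
    have := h x
    rwa [← norm_iteratedFDeriv_fderiv, norm_iteratedFDeriv_one] at this
  have := (convex_closedBall x ‖v‖).norm_image_sub_le_of_norm_fderiv_le' (f := u)
    (C := B * ‖v‖) (φ := fderiv ℝ u x) (x := x) (y := x + v)
    (fun z _ => hu.differentiable z) (fun z hz => ?_) (by simp) (by simp)
  · simpa [pow_two, mul_assoc] using this
  · refine (lipschitz_of_norm_fderiv_le hu.fderiv.differentiable h x z).trans ?_
    rw [mem_closedBall_iff_norm] at hz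
    gcongr

lemma norm_taylor_two_le {u : Sp d → F} (hu : IsTest u) {B : ℝ} (h : DerivBound B u)
    (x v : Sp d) :
    ‖u (x + v) - u x - fderiv ℝ u x v - (1 / 2 : ℝ) • fderiv ℝ (fderiv ℝ u) x v v‖
      ≤ B * ‖v‖ ^ 3 := by
  have hB : 0 ≤ B := (norm_nonneg _).trans (h.norm_le x)
  let f : ℝ → F := fun s => u (x + s • v) - s • fderiv ℝ u x v
    - (s ^ 2 / 2) • fderiv ℝ (fderiv ℝ u) x v v
  have hf : ∀ s, HasDerivAt f (fderiv ℝ u (x + s • v) v - fderiv ℝ u x v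
      - s • fderiv ℝ (fderiv ℝ u) x v v) s := by
    intro s
    have h1 : HasDerivAt (fun s : ℝ => x + s • v) v s := by
      simpa using ((hasDerivAt_id s).smul_const v).const_add x
    have h2 := (hu.differentiable (x + s • v)).hasFDerivAt.comp_hasDerivAt s h1
    have h3 : HasDerivAt (fun s : ℝ => s • fderiv ℝ u x v) (fderiv ℝ u x v) s := by
      simpa using (hasDerivAt_id s).smul_const (fderiv ℝ u x v)
    have h4 : HasDerivAt (fun s : ℝ => (s ^ 2 / 2) • fderiv ℝ (fderiv ℝ u) x v v)
        (s • fderiv ℝ (fderiv ℝ u) x v v) s := by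
      have : HasDerivAt (fun s : ℝ => s ^ 2 / 2) s s := by
        simpa using ((hasDerivAt_id s).pow 2).div_const 2
      exact this.smul_const _
    exact (h2.sub h3).sub h4
  have hb : ∀ s ∈ Icc (0 : ℝ) 1, ‖fderiv ℝ u (x + s • v) v - fderiv ℝ u x v
      - s • fderiv ℝ (fderiv ℝ u) x v v‖ ≤ B * ‖v‖ ^ 3 := by
    intro s hs
    have e : fderiv ℝ u (x + s • v) v - fderiv ℝ u x v - s • fderiv ℝ (fderiv ℝ u) x v v
        = (fderiv ℝ u (x + s • v) - fderiv ℝ u x - fderiv ℝ (fderiv ℝ u) x (s • v)) v := by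
      simp
    rw [e]
    refine (ContinuousLinearMap.le_opNorm _ _).trans ?_
    have h1 := norm_taylor_one_le hu.fderiv (B := B)
      (fun y => by rw [norm_iteratedFDeriv_fderiv]; exact h 3 le_rfl y) x (s • v)
    have h2 : ‖s • v‖ ≤ ‖v‖ := by
      rw [norm_smul, Real.norm_of_nonneg hs.1]
      exact mul_le_of_le_one_left (norm_nonneg _) hs.2
    calc _ ≤ B * ‖s • v‖ ^ 2 * ‖v‖ := by gcongr
      _ ≤ B * ‖v‖ ^ 2 * ‖v‖ := by gcongr
      _ = B * ‖v‖ ^ 3 := by ring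
  have := (convex_Icc (0 : ℝ) 1).norm_image_sub_le_of_norm_hasDerivWithin_le
    (fun s _ => (hf s).hasDerivWithinAt) hb (left_mem_Icc.2 zero_le_one)
    (right_mem_Icc.2 zero_le_one)
  convert this using 1
  · congr 1
    simp only [f, one_smul, zero_smul, add_zero]
    norm_num
    abel
  · simp

end TestFunctions

/-! ### The heat semigroup -/

section Heat

open ProbabilityTheory

variable {d : ℕ} {F : Type} [NormedAddCommGroup F] [NormedSpace ℝ F]

/-- The law of `√(2τ) Z` for a standard Gaussian vector `Z`: the heat kernel at time `τ`. -/
def heatMeasure (d : ℕ) (τ : ℝ) : Measure (Sp d) :=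
  (stdGaussian (Sp d)).map fun z => √(2 * τ) • z

instance (τ : ℝ) : IsProbabilityMeasure (heatMeasure d τ) :=
  Measure.isProbabilityMeasure_map (by fun_prop)

/-- The heat semigroup, with generator the Laplacian. -/
def heat (τ : ℝ) (u : Sp d → F) : Sp d → F := average (heatMeasure d τ) u

lemma heat_apply {u : Sp d → F} (hu : Continuous u) (τ : ℝ) (x : Sp d) :
    heat τ u x = ∫ z, u (x + √(2 * τ) • z) ∂(stdGaussian (Sp d)) := by
  rw [heat, average, heatMeasure, integral_map (by fun_prop)]
  exact (by fun_prop : Continuous fun z => u (x + z)).aestronglyMeasurable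

lemma IsTest.heat [CompleteSpace F] {u : Sp d → F} (hu : IsTest u) (τ : ℝ) : IsTest (heat τ u) :=
  hu.average

lemma DerivBound.heat [CompleteSpace F] {u : Sp d → F} (hu : IsTest u) {B : ℝ}
    (h : DerivBound B u) (τ : ℝ) : DerivBound B (heat τ u) :=
  h.average hu

lemma norm_heat_le {u : Sp d → F} {M : ℝ} (h : ∀ x, ‖u x‖ ≤ M) (τ : ℝ) (x : Sp d) :
    ‖heat τ u x‖ ≤ M :=
  norm_average_le h x

lemma IsTest.fderiv_heat [CompleteSpace F] {u : Sp d → F} (hu : IsTest u) (τ : ℝ) :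
    _root_.fderiv ℝ (FokkerPlanck.heat τ u) = FokkerPlanck.heat τ (_root_.fderiv ℝ u) :=
  hu.fderiv_average

/-- The heat measures form a convolution semigroup, by comparison of characteristic functions. -/
lemma heatMeasure_conv {s t : ℝ} (hs : 0 ≤ s) (ht : 0 ≤ t) :
    heatMeasure d s ∗ heatMeasure d t = heatMeasure d (s + t) := by
  apply Measure.ext_of_charFun
  ext ξ
  rw [charFun_conv]
  simp only [heatMeasure, charFun_map_smul, charFun_stdGaussian]
  rw [← Complex.exp_add]
  congr 1
  simp only [norm_smul, Real.norm_of_nonneg (Real.sqrt_nonneg _)]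
  have h1 : ∀ r : ℝ, 0 ≤ r → ((√(2 * r) * ‖ξ‖ : ℝ) : ℂ) ^ 2 = 2 * r * ‖ξ‖ ^ 2 := by
    intro r hr
    rw [← Complex.ofReal_pow, mul_pow, Real.sq_sqrt (by positivity)]
    push_cast
    ring
  rw [h1 s hs, h1 t ht, h1 _ (add_nonneg hs ht)]
  push_cast
  ring

lemma heat_heat {u : Sp d → F} (hu : IsTest u) {s t : ℝ} (hs : 0 ≤ s) (ht : 0 ≤ t) :
    heat s (heat t u) = heat (s + t) u := by
  ext x
  simp only [heat, average]
  rw [← heatMeasure_conv hs ht, integral_conv ((hu.comp_add_left x).integrable _)]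
  simp only [add_assoc]

lemma heat_zero (u : Sp d → F) (hu : Continuous u) [CompleteSpace F] : heat 0 u = u := by
  ext x
  rw [heat_apply hu]
  simp

/-! ### Moments of the Gaussian -/

lemma memLp_id_stdGaussian (p : ENNReal) (hp : p ≠ ⊤) :
    MemLp (fun z : Sp d => z) p (stdGaussian (Sp d)) :=
  IsGaussian.memLp_id _ p hp

lemma integrable_norm_pow_stdGaussian (k : ℕ) :
    Integrable (fun z : Sp d => ‖z‖ ^ k) (stdGaussian (Sp d)) :=
  (memLp_id_stdGaussian (d := d) k (by simp)).integrable_norm_pow'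

lemma integral_inner_mul_inner_stdGaussian (v w : Sp d) :
    ∫ z, ⟪z, v⟫_ℝ * ⟪z, w⟫_ℝ ∂(stdGaussian (Sp d)) = ⟪v, w⟫_ℝ := by
  have h := covarianceBilin_apply (μ := stdGaussian (Sp d)) (memLp_id_stdGaussian 2 (by simp)) v w
  rw [covarianceBilin_stdGaussian, innerSL_apply_apply] at h
  rw [h]
  simp [real_inner_comm]

lemma integrable_inner_mul_inner_stdGaussian (v w : Sp d) :
    Integrable (fun z => ⟪z, v⟫_ℝ * ⟪z, w⟫_ℝ) (stdGaussian (Sp d)) := by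
  refine ((integrable_norm_pow_stdGaussian (d := d) 2).mul_const (‖v‖ * ‖w‖)).mono'
    (by fun_prop) (Eventually.of_forall fun z => ?_)
  rw [norm_mul]
  calc _ ≤ (‖z‖ * ‖v‖) * (‖z‖ * ‖w‖) := by
        gcongr <;> exact norm_inner_le_norm _ _
    _ = _ := by ring

lemma integral_abs_inner_stdGaussian_le (v : Sp d) :
    ∫ z, |⟪z, v⟫_ℝ| ∂(stdGaussian (Sp d)) ≤ ‖v‖ := by
  have hi : MemLp (fun z : Sp d => |⟪z, v⟫_ℝ|) 2 (stdGaussian (Sp d)) := by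
    refine (memLp_two_iff_integrable_sq (by fun_prop)).2 ?_
    simpa [sq_abs, pow_two] using integrable_inner_mul_inner_stdGaussian v v
  have h := variance_nonneg (fun z : Sp d => |⟪z, v⟫_ℝ|) (stdGaussian (Sp d))
  rw [variance_eq_sub hi] at h
  have e : ∫ z : Sp d, (fun z => |⟪z, v⟫_ℝ|) z ^ 2 ∂(stdGaussian (Sp d)) = ‖v‖ ^ 2 := by
    rw [← real_inner_self_eq_norm_sq, ← integral_inner_mul_inner_stdGaussian]
    simp [pow_two]
  have e' : (∫ z, |⟪z, v⟫_ℝ| ∂(stdGaussian (Sp d))) ^ 2 ≤ ‖v‖ ^ 2 := by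
    rw [← e]
    simpa using h
  exact (le_abs_self _).trans (abs_le_of_sq_le_sq e' (norm_nonneg _))

/-! ### The Gaussian density and integration by parts -/

/-- The density of the standard Gaussian measure. -/
def gaussDensity (d : ℕ) (z : Sp d) : ℝ :=
  (2 * Real.pi) ^ (-(d / 2 : ℝ)) * Real.exp (-(1 / 2) * ‖z‖ ^ 2)

lemma gaussDensity_pos (z : Sp d) : 0 < gaussDensity d z := by
  unfold gaussDensity; positivity

lemma continuous_gaussDensity : Continuous (gaussDensity d) := by
  unfold gaussDensity; fun_prop

lemma gaussDensity_le (z : Sp d) : gaussDensity d z ≤ (2 * Real.pi) ^ (-(d / 2 : ℝ)) := by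
  refine mul_le_of_le_one_right (by positivity) (Real.exp_le_one_iff.2 ?_)
  nlinarith [sq_nonneg ‖z‖]

/-- The Fourier transform of the Gaussian density; it identifies `stdGaussian`, which is defined
without a density. -/
lemma integral_gaussDensity_cexp (w : Sp d) :
    ∫ z, (gaussDensity d z : ℂ) * Complex.exp (⟪z, w⟫_ℝ * Complex.I)
      = Complex.exp (-‖w‖ ^ 2 / 2) := by
  have h := GaussianFourier.integral_cexp_neg_mul_sq_norm_add (V := Sp d) (b := 1 / 2)
    (by norm_num) Complex.I w
  have e : ∀ z : Sp d, (gaussDensity d z : ℂ) * Complex.exp (⟪z, w⟫_ℝ * Complex.I)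
      = (((2 * Real.pi) ^ (-(d / 2 : ℝ)) : ℝ) : ℂ)
        * Complex.exp (-(1 / 2) * ‖z‖ ^ 2 + Complex.I * ⟪w, z⟫_ℝ) := by
    intro z
    rw [gaussDensity, Complex.exp_add, real_inner_comm]
    push_cast
    rw [mul_comm Complex.I]
    ring
  simp_rw [e]
  rw [integral_const_mul, h]
  have h2 : (Real.pi / (1 / 2) : ℂ) = ((2 * Real.pi : ℝ) : ℂ) := by push_cast; ring
  have h3 : ((Module.finrank ℝ (Sp d) / 2 : ℂ)) = ((d / 2 : ℝ) : ℂ) := by simp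
  rw [h2, h3, ← Complex.ofReal_cpow (by positivity), ← mul_assoc, ← Complex.ofReal_mul,
    ← Real.rpow_add (by positivity)]
  simp only [neg_add_cancel, Real.rpow_zero, Complex.ofReal_one, one_mul, Complex.I_sq]
  congr 1
  ring

lemma integral_gaussDensity : ∫ z, gaussDensity d z = 1 := by
  have h := integral_gaussDensity_cexp (0 : Sp d)
  simp only [inner_zero_right, Complex.ofReal_zero, zero_mul, Complex.exp_zero, mul_one,
    norm_zero] at h
  rw [integral_complex_ofReal] at h
  have : ((∫ z, gaussDensity d z : ℝ) : ℂ) = 1 := by rw [h]; simp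
  exact_mod_cast this

lemma integrable_gaussDensity : Integrable (gaussDensity d) := by
  by_contra h
  have := integral_gaussDensity (d := d)
  rw [integral_undef h] at this
  norm_num at this

lemma stdGaussian_eq_withDensity :
    stdGaussian (Sp d) = volume.withDensity fun z => ENNReal.ofReal (gaussDensity d z) := by
  have hfin : IsFiniteMeasure (volume.withDensity fun z => ENNReal.ofReal (gaussDensity d z)) :=
    isFiniteMeasure_withDensity_ofReal integrable_gaussDensity.2
  apply Measure.ext_of_charFun
  ext w
  rw [charFun_stdGaussian, charFun_apply, ← integral_gaussDensity_cexp,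
    integral_withDensity_eq_integral_toReal_smul
      (continuous_gaussDensity.measurable.ennreal_ofReal) (by simp)]
  congr 1
  ext z
  rw [ENNReal.toReal_ofReal (gaussDensity_pos z).le, Complex.real_smul]

lemma integral_stdGaussian (f : Sp d → ℝ) :
    ∫ z, f z ∂(stdGaussian (Sp d)) = ∫ z, f z * gaussDensity d z := by
  rw [stdGaussian_eq_withDensity, integral_withDensity_eq_integral_toReal_smul
      (continuous_gaussDensity.measurable.ennreal_ofReal) (by simp)]
  congr 1
  ext z
  rw [ENNReal.toReal_ofReal (gaussDensity_pos z).le, smul_eq_mul, mul_comm]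

lemma integrable_stdGaussian_iff {f : Sp d → ℝ} :
    Integrable f (stdGaussian (Sp d)) ↔ Integrable fun z => f z * gaussDensity d z := by
  rw [stdGaussian_eq_withDensity, integrable_withDensity_iff_integrable_smul'
      (continuous_gaussDensity.measurable.ennreal_ofReal) (by simp)]
  refine integrable_congr (Eventually.of_forall fun z => ?_)
  simp only [ENNReal.toReal_ofReal (gaussDensity_pos z).le, smul_eq_mul, mul_comm]

lemma hasFDerivAt_gaussDensity (z : Sp d) :
    HasFDerivAt (gaussDensity d) (-(gaussDensity d z) • innerSL ℝ z) z := by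
  have h1 : HasFDerivAt (fun z : Sp d => ‖z‖ ^ 2) (2 • innerSL ℝ z) z :=
    (hasStrictFDerivAt_norm_sq z).hasFDerivAt
  have h2 := ((h1.const_mul (-(1 / 2) : ℝ)).exp).const_mul ((2 * Real.pi) ^ (-(d / 2 : ℝ)))
  refine h2.congr_fderiv ?_
  ext v
  simp [gaussDensity]
  ring

/-- Gaussian integration by parts. -/
lemma integral_fderiv_stdGaussian {w : Sp d → ℝ} (hw : IsTest w) (v : Sp d) :
    ∫ z, fderiv ℝ w z v ∂(stdGaussian (Sp d)) = ∫ z, w z * ⟪z, v⟫_ℝ ∂(stdGaussian (Sp d)) := by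
  obtain ⟨C, hC⟩ := hw.exists_norm_le
  have i1 : Integrable (fun z => fderiv ℝ w z v) (stdGaussian (Sp d)) :=
    (hw.fderiv.clm_comp (ContinuousLinearMap.apply ℝ ℝ v)).integrable _
  have i2 : Integrable (fun z => w z * ⟪z, v⟫_ℝ) (stdGaussian (Sp d)) := by
    refine ((integrable_norm_pow_stdGaussian (d := d) 1).mul_const (C * ‖v‖)).mono'
      ((hw.continuous.mul (by fun_prop)).aestronglyMeasurable)
      (Eventually.of_forall fun z => ?_)
    rw [norm_mul]
    calc _ ≤ C * (‖z‖ * ‖v‖) := by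
          gcongr
          · exact (norm_nonneg _).trans (hC z)
          · exact hC z
          · exact norm_inner_le_norm _ _
      _ = _ := by ring
  have i3 := hw.integrable (stdGaussian (Sp d))
  rw [integrable_stdGaussian_iff] at i1 i2 i3
  have e : ∀ z, fderiv ℝ (gaussDensity d) z v = -(⟪z, v⟫_ℝ * gaussDensity d z) := by
    intro z
    rw [(hasFDerivAt_gaussDensity z).fderiv]
    simp [mul_comm]
  have h := integral_mul_fderiv_eq_neg_fderiv_mul_of_integrable (μ := volume) (f := w)
    (g := gaussDensity d) (v := v) i1
    (by
      refine i2.neg.congr (Eventually.of_forall fun z => ?_)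
      simp only [Pi.neg_apply, e]
      ring) i3 (fun z _ => hw.differentiable z)
    (fun z _ => (hasFDerivAt_gaussDensity z).differentiableAt)
  rw [integral_stdGaussian, integral_stdGaussian]
  simp_rw [e] at h
  rw [← neg_eq_iff_eq_neg, ← integral_neg] at h
  rw [← h]
  congr 1
  ext z
  ring

/-! ### Smoothing and short-time expansion of the heat semigroup -/

/-- The heat semigroup turns a supremum bound into a gradient bound. -/
lemma norm_fderiv_heat_le {u : Sp d → ℝ} (hu : IsTest u) {M : ℝ} (hM : ∀ x, |u x| ≤ M) {τ : ℝ}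
    (hτ : 0 < τ) (x : Sp d) : ‖fderiv ℝ (heat τ u) x‖ ≤ M / √(2 * τ) := by
  have hM0 : 0 ≤ M := (abs_nonneg _).trans (hM x)
  have hs : 0 < √(2 * τ) := Real.sqrt_pos.2 (by positivity)
  refine ContinuousLinearMap.opNorm_le_bound _ (by positivity) fun v => ?_
  let w : Sp d → ℝ := fun z => u (x + √(2 * τ) • z)
  have hwd : ∀ z, HasFDerivAt w (√(2 * τ) • fderiv ℝ u (x + √(2 * τ) • z)) z := by
    intro z
    have h1 : HasFDerivAt (fun z : Sp d => x + √(2 * τ) • z)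
        (√(2 * τ) • ContinuousLinearMap.id ℝ (Sp d)) z :=
      ((hasFDerivAt_id (𝕜 := ℝ) z).const_smul (√(2 * τ))).const_add x
    have h2 := (hu.differentiable (x + √(2 * τ) • z)).hasFDerivAt.comp z h1
    refine h2.congr_fderiv ?_
    ext v
    simp
  have hw : IsTest w := by
    refine ⟨hu.contDiff.comp (by fun_prop), fun k => ?_⟩
    obtain ⟨C, hC⟩ := hu.bounded k
    refine ⟨|√(2 * τ)| ^ k * C, fun z => ?_⟩
    have := iteratedFDeriv_comp_const_smul (𝕜 := ℝ) (i := k) (f := fun z => u (x + z))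
      (√(2 * τ)) ((hu.comp_add_left x).contDiff.of_le (by exact_mod_cast le_top))
    rw [show w = fun z => (fun z => u (x + z)) (√(2 * τ) • z) from rfl, this]
    rw [norm_smul, norm_pow, Real.norm_eq_abs, iteratedFDeriv_comp_add_left]
    gcongr
    exact hC _
  have h := integral_fderiv_stdGaussian hw v
  have e1 : ∫ z, fderiv ℝ w z v ∂(stdGaussian (Sp d)) = √(2 * τ) * fderiv ℝ (heat τ u) x v := by
    simp_rw [fun z => (hwd z).fderiv]
    rw [hu.fderiv_heat, heat_apply hu.fderiv.continuous,
      ContinuousLinearMap.integral_apply]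
    · rw [← integral_const_mul]
      simp
    · have := hu.fderiv.comp_add_left x
      have hi := this.integrable (heatMeasure d τ)
      rwa [heatMeasure, integrable_map_measure this.continuous.aestronglyMeasurable
        (by fun_prop)] at hi
  rw [e1] at h
  have h2 : |∫ z, w z * ⟪z, v⟫_ℝ ∂(stdGaussian (Sp d))| ≤ M * ‖v‖ := by
    calc _ ≤ ∫ z, M * |⟪z, v⟫_ℝ| ∂(stdGaussian (Sp d)) := by
          rw [← Real.norm_eq_abs]
          refine norm_integral_le_of_norm_le ?_ (Eventually.of_forall fun z => ?_)
          · refine Integrable.const_mul ?_ _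
            refine ((integrable_norm_pow_stdGaussian (d := d) 1).mul_const ‖v‖).mono'
              (by fun_prop) (Eventually.of_forall fun z => ?_)
            rw [Real.norm_eq_abs, abs_abs, pow_one]
            exact abs_real_inner_le_norm _ _
          · rw [norm_mul]
            exact mul_le_mul_of_nonneg_right (hM _) (abs_nonneg _)
      _ ≤ M * ‖v‖ := by
          rw [integral_const_mul]
          exact mul_le_mul_of_nonneg_left (integral_abs_inner_stdGaussian_le v) hM0
  rw [← h, abs_mul, abs_of_pos hs] at h2
  rw [Real.norm_eq_abs, div_mul_eq_mul_div, le_div_iff₀ hs]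
  linarith

/-- The heat semigroup is bounded from `L¹` to `L^∞`. -/
lemma exists_abs_heat_le (d : ℕ) {τ : ℝ} (hτ : 0 < τ) :
    ∃ K, 0 ≤ K ∧ ∀ u : Sp d → ℝ, Continuous u → Integrable u → ∀ x,
      |heat τ u x| ≤ K * ∫ y, |u y| := by
  have hs : 0 < √(2 * τ) := Real.sqrt_pos.2 (by positivity)
  refine ⟨(2 * Real.pi) ^ (-(d / 2 : ℝ)) * |(√(2 * τ) ^ d)⁻¹|, by positivity,
    fun u hu hi x => ?_⟩
  have hcov : ∫ z, |u (x + √(2 * τ) • z)| = |(√(2 * τ) ^ d)⁻¹| * ∫ y, |u y| := by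
    rw [Measure.integral_comp_smul (E := Sp d) (F := ℝ) volume (fun z => |u (x + z)|), smul_eq_mul,
      integral_add_left_eq_self fun z => |u z|]
    simp
  have hint : Integrable fun z => |u (x + √(2 * τ) • z)| :=
    (Integrable.comp_smul (hi.comp_add_left x) hs.ne').abs
  rw [heat_apply hu, integral_stdGaussian, mul_assoc, ← hcov, ← integral_const_mul,
    ← Real.norm_eq_abs]
  refine norm_integral_le_of_norm_le (hint.const_mul _) (Eventually.of_forall fun z => ?_)
  rw [norm_mul, Real.norm_of_nonneg (gaussDensity_pos z).le, mul_comm]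
  exact mul_le_mul_of_nonneg_right (gaussDensity_le z) (abs_nonneg _)

lemma laplacian_eq_sum (u : Sp d → ℝ) (x : Sp d) : Laplacian.laplacian u x
    = ∑ i, fderiv ℝ (fderiv ℝ u) x (EuclideanSpace.basisFun (Fin d) ℝ i)
        (EuclideanSpace.basisFun (Fin d) ℝ i) := by
  rw [InnerProductSpace.laplacian_eq_iteratedFDeriv_orthonormalBasis u
    (EuclideanSpace.basisFun (Fin d) ℝ)]
  simp [iteratedFDeriv_two_apply]

lemma integral_bilin_stdGaussian (A : Sp d →L[ℝ] Sp d →L[ℝ] ℝ) :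
    ∫ z, A z z ∂(stdGaussian (Sp d)) = ∑ i, A (EuclideanSpace.basisFun (Fin d) ℝ i)
        (EuclideanSpace.basisFun (Fin d) ℝ i) := by
  set e := EuclideanSpace.basisFun (Fin d) ℝ
  have h1 : ∀ z, A z z = ∑ i, ∑ j, ⟪z, e i⟫_ℝ * ⟪z, e j⟫_ℝ * A (e i) (e j) := by
    intro z
    conv_lhs => rw [← e.sum_repr' z]
    simp only [map_sum, map_smul, sum_apply, smul_apply,
      smul_eq_mul, Finset.mul_sum, real_inner_comm]
    rw [Finset.sum_comm]
    refine Finset.sum_congr rfl fun i _ => Finset.sum_congr rfl fun j _ => ?_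
    ring
  rw [integral_congr_ae (Eventually.of_forall h1),
    integral_finsetSum _ fun i _ => integrable_finsetSum _ fun j _ =>
      (integrable_inner_mul_inner_stdGaussian _ _).mul_const _]
  refine Finset.sum_congr rfl fun i _ => ?_
  rw [integral_finsetSum _ fun j _ => (integrable_inner_mul_inner_stdGaussian _ _).mul_const _]
  simp_rw [integral_mul_const, integral_inner_mul_inner_stdGaussian]
  rw [Finset.sum_eq_single i]
  · simp [e.orthonormal.1 i]
  · intro j _ hj
    rw [e.orthonormal.2 hj.symm, zero_mul]
  · simp

/-- Second order expansion of the heat semigroup, uniform over functions with derivatives bounded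
up to order three. -/
lemma exists_heat_sub_laplacian_le (d : ℕ) : ∃ C, 0 ≤ C ∧ ∀ (u : Sp d → ℝ) (B : ℝ), IsTest u →
    DerivBound B u → ∀ ε, 0 ≤ ε → ∀ x,
      |heat ε u x - u x - ε * Laplacian.laplacian u x| ≤ C * B * √ε ^ 3 := by
  set m := stdGaussian (Sp d)
  refine ⟨√2 ^ 3 * ∫ z, ‖z‖ ^ 3 ∂m, mul_nonneg (by positivity)
    (integral_nonneg fun z => by positivity), fun u B hu h ε hε x => ?_⟩
  set s := √(2 * ε) with hs
  have hs2 : s ^ 2 = 2 * ε := Real.sq_sqrt (by positivity)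
  have i0 : Integrable (fun z => u (x + s • z)) m := by
    have hi := (hu.comp_add_left x).integrable (heatMeasure d ε)
    rwa [heatMeasure, integrable_map_measure (hu.comp_add_left x).continuous.aestronglyMeasurable
        (by fun_prop)] at hi
  have i1 : Integrable (fun z => fderiv ℝ u x (s • z)) m := by
    refine ((integrable_norm_pow_stdGaussian (d := d) 1).const_mul
      (‖fderiv ℝ u x‖ * ‖s‖)).mono' (by fun_prop) (Eventually.of_forall fun z => ?_)
    refine (ContinuousLinearMap.le_opNorm _ _).trans (le_of_eq ?_)
    rw [norm_smul]; ring
  have i2 : Integrable (fun z => fderiv ℝ (fderiv ℝ u) x (s • z) (s • z)) m := by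
    refine ((integrable_norm_pow_stdGaussian (d := d) 2).const_mul
      (‖fderiv ℝ (fderiv ℝ u) x‖ * ‖s‖ ^ 2)).mono' (by fun_prop) (Eventually.of_forall fun z => ?_)
    refine (ContinuousLinearMap.le_opNorm₂ _ _ _).trans (le_of_eq ?_)
    rw [norm_smul]; ring
  have e1 : ∫ z, fderiv ℝ u x (s • z) ∂m = 0 := by
    have := integral_strongDual_stdGaussian (fderiv ℝ u x)
    simp only [map_smul, smul_eq_mul, integral_const_mul]
    rw [this, mul_zero]
  have e2 : ∫ z, fderiv ℝ (fderiv ℝ u) x (s • z) (s • z) ∂m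
      = 2 * ε * Laplacian.laplacian u x := by
    rw [laplacian_eq_sum, ← integral_bilin_stdGaussian, ← hs2, ← integral_const_mul]
    simp only [map_smul, smul_apply, smul_eq_mul]
    congr 1; ext z; ring
  have key : heat ε u x - u x - ε * Laplacian.laplacian u x
      = ∫ z, (u (x + s • z) - u x - fderiv ℝ u x (s • z)
        - (1 / 2 : ℝ) • fderiv ℝ (fderiv ℝ u) x (s • z) (s • z)) ∂m := by
    have j0 : Integrable (fun z => u (x + s • z) - u x) m := i0.sub (integrable_const _)
    have j1 : Integrable (fun z => u (x + s • z) - u x - fderiv ℝ u x (s • z)) m := j0.sub i1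
    have j2 : Integrable (fun z => (1 / 2 : ℝ) • fderiv ℝ (fderiv ℝ u) x (s • z) (s • z)) m :=
      i2.smul (1 / 2 : ℝ)
    rw [integral_sub j1 j2, integral_sub j0 i1, integral_sub i0 (integrable_const _),
      integral_smul, e1, e2, heat_apply hu.continuous]
    simp only [integral_const, probReal_univ, smul_eq_mul, m, ← hs]
    ring
  rw [key]
  have hfin : ∫ z, B * ‖s • z‖ ^ 3 ∂m = √2 ^ 3 * (∫ z, ‖z‖ ^ 3 ∂m) * B * √ε ^ 3 := by
    simp_rw [norm_smul, mul_pow]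
    rw [integral_const_mul, integral_const_mul, Real.norm_of_nonneg (Real.sqrt_nonneg _),
      Real.sqrt_mul (by norm_num)]
    ring
  rw [← hfin]
  refine norm_integral_le_of_norm_le ?_ (Eventually.of_forall fun z =>
    norm_taylor_two_le hu h x (s • z))
  simp_rw [norm_smul, mul_pow]
  exact ((integrable_norm_pow_stdGaussian 3).const_mul _).const_mul _

/-- The heat semigroup moves Lipschitz functions by `O(√ε)`. -/
lemma exists_norm_heat_sub_le (d : ℕ) : ∃ C, 0 ≤ C ∧ ∀ {F : Type} [NormedAddCommGroup F]
    [NormedSpace ℝ F] [CompleteSpace F] (u : Sp d → F) (B : ℝ), IsTest u →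
    (∀ x, ‖fderiv ℝ u x‖ ≤ B) → ∀ ε, 0 ≤ ε → ∀ x, ‖heat ε u x - u x‖ ≤ C * B * √ε := by
  set m := stdGaussian (Sp d)
  refine ⟨√2 * ∫ z, ‖z‖ ∂m, mul_nonneg (by positivity)
    (integral_nonneg fun z => by positivity), ?_⟩
  intro F _ _ _ u B hu h ε hε x
  set s := √(2 * ε) with hs
  have i0 : Integrable (fun z => u (x + s • z)) m := by
    have hi := (hu.comp_add_left x).integrable (heatMeasure d ε)
    rwa [heatMeasure, integrable_map_measure (hu.comp_add_left x).continuous.aestronglyMeasurable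
        (by fun_prop)] at hi
  have key : heat ε u x - u x = ∫ z, (u (x + s • z) - u x) ∂m := by
    rw [integral_sub i0 (integrable_const _), heat_apply hu.continuous]
    simp [m, hs]
  have hfin : ∫ z, B * ‖s • z‖ ∂m = √2 * (∫ z, ‖z‖ ∂m) * B * √ε := by
    simp_rw [norm_smul]
    rw [integral_const_mul, integral_const_mul, Real.norm_of_nonneg (Real.sqrt_nonneg _),
      Real.sqrt_mul (by norm_num)]
    ring
  rw [key, ← hfin]
  refine norm_integral_le_of_norm_le ?_ (Eventually.of_forall fun z => ?_)
  · have := integrable_norm_pow_stdGaussian (d := d) 1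
    simp only [pow_one] at this
    simp_rw [norm_smul]
    exact (this.const_mul _).const_mul _
  · simpa using lipschitz_of_norm_fderiv_le hu.differentiable h x (x + s • z)

end Heat

/-! ### Weak continuity of Wasserstein curves -/

section Curves

variable {d : ℕ}

lemma exists_coupling_of_d2_lt {μ ν : Measure (Sp d)} {η : ℝ}
    (h : d2 μ ν < ENNReal.ofReal η) :
    ∃ γ, IsCoupling μ ν γ ∧ ∫⁻ p, ‖p.1 - p.2‖ₑ ^ 2 ∂γ < ENNReal.ofReal η ^ 2 := by
  have h2 : (⨅ (γ : Measure (Sp d × Sp d)) (_ : IsCoupling μ ν γ),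
      ∫⁻ p, ‖p.1 - p.2‖ₑ ^ 2 ∂γ) < ENNReal.ofReal η ^ 2 := by
    by_contra hcon
    rw [not_lt] at hcon
    refine absurd h (not_lt.2 ?_)
    have := ENNReal.rpow_le_rpow hcon (by norm_num : (0 : ℝ) ≤ 1 / 2)
    rwa [← ENNReal.rpow_natCast, ← ENNReal.rpow_mul, Nat.cast_ofNat,
      mul_one_div_cancel two_ne_zero, ENNReal.rpow_one] at this
  simp only [iInf_lt_iff] at h2
  obtain ⟨γ, hγ, hlt⟩ := h2
  exact ⟨γ, hγ, hlt⟩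

/-- The Wasserstein distance controls integrals of Lipschitz functions. -/
lemma abs_integral_sub_le_of_d2_lt {μ ν : Measure (Sp d)} [IsProbabilityMeasure μ]
    {η : ℝ} (hη : 0 < η) (h : d2 μ ν < ENNReal.ofReal η)
    {φ : Sp d → ℝ} {C L : ℝ} (hL : 0 ≤ L) (hC : ∀ x, |φ x| ≤ C)
    (hφ : ∀ x y, |φ y - φ x| ≤ L * ‖y - x‖) :
    |∫ x, φ x ∂μ - ∫ x, φ x ∂ν| ≤ L * η := by
  have hcont : Continuous φ := by
    refine (LipschitzWith.of_dist_le_mul (K := L.toNNReal) fun x y => ?_).continuous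
    rw [Real.coe_toNNReal _ hL, dist_eq_norm, dist_eq_norm]
    exact hφ y x
  obtain ⟨γ, ⟨h1, h2⟩, hlt⟩ := exists_coupling_of_d2_lt h
  have hγ : IsProbabilityMeasure γ := by
    have : IsProbabilityMeasure (γ.map Prod.fst) := by rw [h1]; infer_instance
    exact Measure.isProbabilityMeasure_of_map (f := Prod.fst) (μ := γ)
  have e1 : ∫ x, φ x ∂μ = ∫ p, φ p.1 ∂γ := by
    rw [← h1, integral_map (by fun_prop) hcont.aestronglyMeasurable]
  have e2 : ∫ x, φ x ∂ν = ∫ p, φ p.2 ∂γ := by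
    rw [← h2, integral_map (by fun_prop) hcont.aestronglyMeasurable]
  have i1 : Integrable (fun p : Sp d × Sp d => φ p.1) γ :=
    Integrable.of_bound (by fun_prop) C (Eventually.of_forall fun p => hC _)
  have i2 : Integrable (fun p : Sp d × Sp d => φ p.2) γ :=
    Integrable.of_bound (by fun_prop) C (Eventually.of_forall fun p => hC _)
  have hm : MemLp (fun p : Sp d × Sp d => p.1 - p.2) 2 γ := by
    refine ⟨by fun_prop, ?_⟩
    rw [eLpNorm_lt_top_iff_lintegral_rpow_enorm_lt_top two_ne_zero (by simp)]
    simpa using hlt.trans (by finiteness)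
  have hm2 : eLpNorm (fun p : Sp d × Sp d => p.1 - p.2) 1 γ ≤ ENNReal.ofReal η := by
    refine (eLpNorm_le_eLpNorm_of_exponent_le (by norm_num : (1 : ENNReal) ≤ 2)
      hm.aestronglyMeasurable).trans ?_
    rw [eLpNorm_eq_lintegral_rpow_enorm_toReal two_ne_zero (by simp)]
    simp only [ENNReal.toReal_ofNat, ENNReal.rpow_ofNat]
    have := ENNReal.rpow_le_rpow hlt.le (by norm_num : (0 : ℝ) ≤ 1 / 2)
    rwa [← ENNReal.rpow_natCast (ENNReal.ofReal η), ← ENNReal.rpow_mul, Nat.cast_ofNat,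
      mul_one_div_cancel two_ne_zero, ENNReal.rpow_one] at this
  have hint : ∫ p, ‖p.1 - p.2‖ ∂γ ≤ η := by
    rw [eLpNorm_one_eq_lintegral_enorm] at hm2
    rw [integral_norm_eq_lintegral_enorm hm.aestronglyMeasurable]
    exact ENNReal.toReal_le_of_le_ofReal hη.le hm2
  rw [e1, e2, ← integral_sub i1 i2]
  calc |∫ p, (φ p.1 - φ p.2) ∂γ| ≤ ∫ p, L * ‖p.1 - p.2‖ ∂γ := by
        rw [← Real.norm_eq_abs]
        exact norm_integral_le_of_norm_le
          ((hm.integrable (by norm_num)).norm.const_mul L) (Eventually.of_forall fun p => hφ _ _)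
    _ ≤ L * η := by
        rw [integral_const_mul]
        exact mul_le_mul_of_nonneg_left hint hL

/-- A modulus of continuity of `t ↦ ∫ φ dμₜ`, uniform over Lipschitz functions. -/
lemma IsP2Curve.exists_modulus {t₀ T : ℝ} {μ : ℝ → Measure (Sp d)} (h : IsP2Curve t₀ T μ)
    {η : ℝ} (hη : 0 < η) : ∃ δ > 0, ∀ s ∈ Icc t₀ T, ∀ t ∈ Icc t₀ T, |s - t| < δ →
      ∀ (φ : Sp d → ℝ) (C L : ℝ), 0 ≤ L → (∀ x, |φ x| ≤ C) →
        (∀ x y, |φ y - φ x| ≤ L * ‖y - x‖) →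
        |∫ x, φ x ∂(μ s) - ∫ x, φ x ∂(μ t)| ≤ L * η := by
  obtain ⟨δ, hδ, H⟩ := lebesgue_number_lemma_of_emetric_nhdsWithin'
    (c := fun t _ => {s | s ∈ Icc t₀ T ∧ d2 (μ s) (μ t) < ENNReal.ofReal (η / 2)})
    (isCompact_Icc (a := t₀) (b := T)) (fun t ht => by
      filter_upwards [self_mem_nhdsWithin, (h.continuous t ht).eventually_lt_const
        (ENNReal.ofReal_pos.2 (half_pos hη))] with s hs1 hs2
      exact ⟨hs1, hs2⟩)
  obtain ⟨δ', hδ', hle⟩ : ∃ δ' : ℝ, 0 < δ' ∧ ENNReal.ofReal δ' ≤ δ := by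
    rcases eq_or_ne δ ⊤ with rfl | htop
    · exact ⟨1, one_pos, le_top⟩
    · exact ⟨δ.toReal, ENNReal.toReal_pos hδ.ne' htop, (ENNReal.ofReal_toReal htop).le⟩
  refine ⟨δ', hδ', fun s hs t ht hst φ C L hL hC hφ => ?_⟩
  obtain ⟨r, hr⟩ := H s hs
  have m1 := hr ⟨Metric.mem_eball_self hδ, hs⟩
  have m2 := hr (show t ∈ Metric.eball s δ ∩ Icc t₀ T from ⟨by
    rw [Metric.mem_eball, edist_dist, Real.dist_eq, abs_sub_comm]
    exact ((ENNReal.ofReal_lt_ofReal_iff hδ').2 hst).trans_le hle, ht⟩)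
  have := (h.isP2 s hs).isProbabilityMeasure
  have := (h.isP2 t ht).isProbabilityMeasure
  have a1 := abs_integral_sub_le_of_d2_lt (half_pos hη) m1.2 hL hC hφ
  have a2 := abs_integral_sub_le_of_d2_lt (half_pos hη) m2.2 hL hC hφ
  rw [abs_le] at a1 a2 ⊢
  constructor <;> linarith [a1.1, a1.2, a2.1, a2.2]

lemma IsP2Curve.continuousOn_integral {t₀ T : ℝ} {μ : ℝ → Measure (Sp d)} (h : IsP2Curve t₀ T μ)
    {φ : Sp d → ℝ} {C L : ℝ} (hL : 0 ≤ L) (hC : ∀ x, |φ x| ≤ C)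
    (hφ : ∀ x y, |φ y - φ x| ≤ L * ‖y - x‖) :
    ContinuousOn (fun t => ∫ x, φ x ∂(μ t)) (Icc t₀ T) := by
  rw [Metric.continuousOn_iff]
  intro t ht ε hε
  obtain ⟨δ, hδ, H⟩ := h.exists_modulus (η := ε / (2 * (L + 1))) (by positivity)
  refine ⟨δ, hδ, fun s hs hst => ?_⟩
  refine (H s hs t ht hst φ C L hL hC hφ).trans_lt ?_
  rw [mul_div_assoc', div_lt_iff₀ (by positivity)]
  nlinarith

lemma IsTest.abs_sub_le {u : Sp d → ℝ} (hu : IsTest u) {B : ℝ} (h : DerivBound B u) (x y : Sp d) :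
    |u y - u x| ≤ B * ‖y - x‖ :=
  lipschitz_of_norm_fderiv_le hu.differentiable h.norm_fderiv_le x y

lemma IsP2Curve.continuousOn_integral_test {t₀ T : ℝ} {μ : ℝ → Measure (Sp d)}
    (h : IsP2Curve t₀ T μ) {u : Sp d → ℝ} (hu : IsTest u) :
    ContinuousOn (fun t => ∫ x, u x ∂(μ t)) (Icc t₀ T) := by
  obtain ⟨B, hB, hb⟩ := hu.exists_derivBound
  exact h.continuousOn_integral hB hb.norm_le (hu.abs_sub_le hb)

/-- A Wasserstein curve is a Markov kernel from times to points. -/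
lemma IsP2Curve.exists_kernel {t₀ T : ℝ} (hT : t₀ ≤ T) {μ : ℝ → Measure (Sp d)}
    (h : IsP2Curve t₀ T μ) : ∃ κ : ProbabilityTheory.Kernel ℝ (Sp d),
      ProbabilityTheory.IsMarkovKernel κ ∧ ∀ t ∈ Icc t₀ T, κ t = μ t := by
  let p : ℝ → ℝ := fun t => projIcc t₀ T hT t
  have hp : ∀ t, p t ∈ Icc t₀ T := fun t => (projIcc t₀ T hT t).2
  have hpm : Continuous p := continuous_subtype_val.comp continuous_projIcc
  have hprob : ∀ t, IsProbabilityMeasure (μ (p t)) := fun t =>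
    (h.isP2 _ (hp t)).isProbabilityMeasure
  have hmeas : Measurable fun t => μ (p t) := by
    refine Measurable.measure_of_isPiSystem_of_isProbabilityMeasure
      (S := {F : Set (Sp d) | IsClosed F}) ?_ ?_ ?_
    · rw [BorelSpace.measurable_eq (α := Sp d), borel_eq_generateFrom_isClosed]
    · exact isPiSystem_isClosed
    · intro F hF
      have hF : IsClosed F := hF
      have hpos : ∀ n : ℕ, (0 : ℝ) < 1 / (n + 1) := fun n => by positivity
      have hlim : ∀ t, Tendsto (fun n : ℕ => ∫⁻ x, (thickenedIndicator (hpos n) F x : ENNReal)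
          ∂(μ (p t))) atTop (𝓝 (μ (p t) F)) := fun t =>
        tendsto_lintegral_thickenedIndicator_of_isClosed _ hF hpos
          tendsto_one_div_add_atTop_nhds_zero_nat
      refine measurable_of_tendsto_metrizable (f := fun (n : ℕ) t =>
        ∫⁻ x, (thickenedIndicator (hpos n) F x : ENNReal) ∂(μ (p t))) (fun n => ?_)
        (tendsto_pi_nhds.2 hlim)
      let φ : Sp d → ℝ := fun x => (thickenedIndicator (hpos n) F x : ℝ)
      have hc : Continuous φ := by
        have := (thickenedIndicator (hpos n) F).continuous
        fun_prop
      have hφ1 : ∀ x, |φ x| ≤ 1 := fun x => by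
        rw [abs_of_nonneg (NNReal.coe_nonneg _)]
        exact_mod_cast thickenedIndicator_le_one (hpos n) F x
      have e : (fun t => ∫⁻ x, (thickenedIndicator (hpos n) F x : ENNReal) ∂(μ (p t)))
          = fun t => ENNReal.ofReal (∫ x, φ x ∂(μ (p t))) := by
        ext t
        rw [ofReal_integral_eq_lintegral_ofReal
          (Integrable.of_bound hc.aestronglyMeasurable 1 (Eventually.of_forall hφ1))
          (Eventually.of_forall fun x => NNReal.coe_nonneg _)]
        simp [φ]
      have hlip := lipschitzWith_thickenedIndicator (hpos n) F
      have hcont : Continuous fun t => ∫ x, φ x ∂(μ (p t)) :=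
        ((h.continuousOn_integral (φ := φ) (NNReal.coe_nonneg (1 / (n + 1) : ℝ).toNNReal⁻¹) hφ1
          (fun x y => by
            have := hlip.dist_le_mul y x
            rwa [NNReal.dist_eq, dist_eq_norm] at this)).comp_continuous hpm hp)
      simp only [e]
      exact hcont.measurable.ennreal_ofReal
  exact ⟨⟨fun t => μ (p t), hmeas⟩, ⟨hprob⟩, fun t ht => by
    change μ (p t) = μ t
    simp [p, projIcc_of_mem hT ht]⟩

/-! ### Weak derivatives on an interval -/

/-- If `η' m + η n` has zero integral for all test functions `η`, then the increments of `m` are the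
integrals of `n`. -/
lemma sub_eq_integral_of_weak_deriv {t₀ T : ℝ} {m n : ℝ → ℝ}
    (hm : ContinuousOn m (Icc t₀ T)) (hn : IntegrableOn n (Icc t₀ T))
    (h : ∀ η : ℝ → ℝ, ContDiff ℝ ∞ η → HasCompactSupport η → tsupport η ⊆ Ioo t₀ T →
      ∫ t in t₀..T, (deriv η t * m t + η t * n t) = 0)
    {s s' : ℝ} (hs : t₀ ≤ s) (hss : s < s') (hs' : s' ≤ T) :
    m s' - m s = ∫ t in s..s', n t := by
  have hT : t₀ ≤ T := hs.trans (hss.le.trans hs')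
  let S := Real.smoothTransition
  have hS : ContDiff ℝ ∞ S := Real.smoothTransition.contDiff
  have hSd : ∀ y, HasDerivAt S (deriv S y) y := fun y =>
    (hS.differentiable (by simp) y).hasDerivAt
  have hS'c : Continuous (deriv S) := hS.continuous_deriv (by simp)
  have hS'0 : ∀ y, y ∉ Ioo (0 : ℝ) 1 → deriv S y = 0 := by
    intro y hy
    rw [mem_Ioo, not_and_or, not_lt, not_lt] at hy
    rcases hy with hy | hy
    · -- `S` attains its minimum `0` at `y`
      exact IsLocalMin.deriv_eq_zero (Eventually.of_forall fun z => by
        change S y ≤ S z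
        rw [show S y = 0 from Real.smoothTransition.zero_of_nonpos hy]
        exact Real.smoothTransition.nonneg z)
    · exact IsLocalMax.deriv_eq_zero (Eventually.of_forall fun z => by
        change S z ≤ S y
        rw [show S y = 1 from Real.smoothTransition.one_of_one_le hy]
        exact Real.smoothTransition.le_one z)
  have hS'supp : HasCompactSupport (deriv S) :=
    HasCompactSupport.of_support_subset_isCompact (isCompact_Icc (a := (0 : ℝ)) (b := 1))
      fun y hy => Ioo_subset_Icc_self (by by_contra hc; exact hy (hS'0 y hc))
  have hS'int : ∫ y, deriv S y = 1 := by
    have e : ∫ y, deriv S y = ∫ y in (0 : ℝ)..1, deriv S y := by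
      rw [intervalIntegral.integral_of_le zero_le_one,
        setIntegral_eq_integral_of_forall_compl_eq_zero]
      intro y hy
      exact hS'0 y fun hc => hy ⟨hc.1, hc.2.le⟩
    rw [e, intervalIntegral.integral_eq_sub_of_hasDerivAt (fun y _ => hSd y)
      (hS'c.intervalIntegrable _ _)]
    simp [S]
  -- a continuous extension of `m`
  let M : ℝ → ℝ := IccExtend hT (fun t : Icc t₀ T => m t)
  have hM : Continuous M := hm.domRestrict.Icc_extend'
  have hMm : ∀ t ∈ Icc t₀ T, M t = m t := fun t ht => by
    simp only [M, IccExtend_of_mem hT _ ht]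
  obtain ⟨CM, hCM⟩ : ∃ C, ∀ t, ‖M t‖ ≤ C := by
    obtain ⟨C, hC⟩ := isCompact_Icc.exists_bound_of_continuousOn hm
    exact ⟨C, fun t => hC _ (projIcc t₀ T hT t).2⟩
  -- the cutoff `η k` rises from `0` to `1` on `[s + 1/k, s + 2/k]`
  let η : ℕ → ℝ → ℝ := fun k r => S (k * (r - s) - 1) * S (k * (s' - r) - 1)
  have hη : ∀ k, ContDiff ℝ ∞ (η k) := fun k =>
    (hS.comp (by fun_prop)).mul (hS.comp (by fun_prop))
  have hηsupp : ∀ k : ℕ, 0 < k → ∀ r, r ∉ Icc (s + 1 / k) (s' - 1 / k) → η k r = 0 := by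
    intro k hk r hr
    have hk' : (0 : ℝ) < k := by exact_mod_cast hk
    rw [mem_Icc, not_and_or, not_le, not_le] at hr
    rcases hr with hr | hr
    · have : k * (r - s) - 1 ≤ 0 := by
        have : (r - s) < 1 / k := by linarith
        rw [lt_div_iff₀ hk'] at this
        linarith
      simp [η, S, Real.smoothTransition.zero_of_nonpos this]
    · have : k * (s' - r) - 1 ≤ 0 := by
        have : (s' - r) < 1 / k := by linarith
        rw [lt_div_iff₀ hk'] at this
        linarith
      simp [η, S, Real.smoothTransition.zero_of_nonpos this]
  have hη1 : ∀ k r, |η k r| ≤ 1 := by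
    intro k r
    rw [abs_of_nonneg
      (mul_nonneg (Real.smoothTransition.nonneg _) (Real.smoothTransition.nonneg _))]
    exact mul_le_one₀ (Real.smoothTransition.le_one _) (Real.smoothTransition.nonneg _)
      (Real.smoothTransition.le_one _)
  have hzero : ∀ k : ℕ, 0 < k →
      (∫ t in t₀..T, deriv (η k) t * m t) + ∫ t in t₀..T, η k t * n t = 0 := by
    intro k hk
    have hk' : (0 : ℝ) < k := by exact_mod_cast hk
    have hts : tsupport (η k) ⊆ Icc (s + 1 / k) (s' - 1 / k) :=
      closure_minimal (fun r hr => by by_contra hc; exact hr (hηsupp k hk r hc)) isClosed_Icc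
    have := h (η k) (hη k) (isCompact_Icc.of_isClosed_subset (isClosed_tsupport _) hts)
      (hts.trans fun r hr => ⟨by have : 0 < 1 / (k : ℝ) := by positivity
                                 linarith [hr.1],
        by have : 0 < 1 / (k : ℝ) := by positivity
           linarith [hr.2]⟩)
    rw [intervalIntegral.integral_add] at this
    · exact this
    · refine ContinuousOn.intervalIntegrable ?_
      rw [uIcc_of_le hT]
      exact ((hη k).continuous_deriv (by simp)).continuousOn.mul hm
    · rw [intervalIntegrable_iff_integrableOn_Icc_of_le hT]
      exact hn.bdd_mul (hη k).continuous.aestronglyMeasurable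
        (Eventually.of_forall fun t => hη1 k t)
  have lim2 : Tendsto (fun k : ℕ => ∫ t in t₀..T, η k t * n t) atTop (𝓝 (∫ t in s..s', n t)) := by
    have hsub : Ioo s s' ⊆ Ioc t₀ T := fun r hr => ⟨hs.trans_lt hr.1, hr.2.le.trans hs'⟩
    have e : ∫ t in s..s', n t = ∫ t in t₀..T, (Ioo s s').indicator n t := by
      rw [intervalIntegral.integral_of_le hT, intervalIntegral.integral_of_le hss.le,
        integral_Ioc_eq_integral_Ioo, setIntegral_indicator measurableSet_Ioo,
        inter_eq_right.2 hsub]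
    rw [e]
    refine intervalIntegral.tendsto_integral_filter_of_dominated_convergence (fun t => ‖n t‖)
      (Eventually.of_forall fun k => ?_) (Eventually.of_forall fun k =>
        Eventually.of_forall fun t _ => ?_) ?_ (Eventually.of_forall fun t _ => ?_)
    · rw [uIoc_of_le hT]
      exact ((hη k).continuous.aestronglyMeasurable).mul
        (hn.mono_set Ioc_subset_Icc_self).aestronglyMeasurable
    · rw [norm_mul]
      exact mul_le_of_le_one_left (norm_nonneg _) (hη1 k t)
    · rw [intervalIntegrable_iff_integrableOn_Icc_of_le hT]
      exact hn.norm
    · refine tendsto_const_nhds.congr' ?_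
      by_cases ht : t ∈ Ioo s s'
      · rw [indicator_of_mem ht]
        have l1 : ∀ᶠ k : ℕ in atTop, 2 ≤ k * (t - s) :=
          (tendsto_natCast_atTop_atTop.atTop_mul_const (sub_pos.2 ht.1)).eventually_ge_atTop 2
        have l2 : ∀ᶠ k : ℕ in atTop, 2 ≤ k * (s' - t) :=
          (tendsto_natCast_atTop_atTop.atTop_mul_const (sub_pos.2 ht.2)).eventually_ge_atTop 2
        filter_upwards [l1, l2] with k h1 h2
        simp only [η, S]
        rw [Real.smoothTransition.one_of_one_le (by linarith),
          Real.smoothTransition.one_of_one_le (by linarith)]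
        simp
      · rw [indicator_of_notMem ht]
        filter_upwards [eventually_gt_atTop 0] with k hk
        have hk' : 0 < 1 / (k : ℝ) := by positivity
        rw [hηsupp k hk t fun hc => ht ⟨by linarith [hc.1], by linarith [hc.2]⟩, zero_mul]
  -- the two boundary layers, rescaled
  have lay : ∀ (a b : ℝ), Tendsto (fun k : ℕ => ∫ y, deriv S y * M (a + b * (y + 1) / k)) atTop
      (𝓝 (M a)) := by
    intro a b
    have e : M a = ∫ y, deriv S y * M a := by rw [integral_mul_const, hS'int, one_mul]
    rw [e]
    refine tendsto_integral_of_dominated_convergence (fun y => ‖deriv S y‖ * CM)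
      (fun k => (hS'c.mul (hM.comp (by fun_prop))).aestronglyMeasurable)
      ((hS'c.integrable_of_hasCompactSupport hS'supp).norm.mul_const _)
      (fun k => Eventually.of_forall fun y => ?_) (Eventually.of_forall fun y => ?_)
    · rw [norm_mul]
      exact mul_le_mul_of_nonneg_left (hCM _) (norm_nonneg _)
    · refine ((hM.tendsto a).comp ?_).const_mul _
      have : Tendsto (fun k : ℕ => b * (y + 1) / (k : ℝ)) atTop (𝓝 0) :=
        tendsto_const_div_atTop_nhds_zero_nat _
      simpa using this.const_add a
  have lim1 : Tendsto (fun k : ℕ => ∫ t in t₀..T, deriv (η k) t * m t) atTop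
      (𝓝 (m s - m s')) := by
    have hl := (lay s 1).sub (lay s' (-1))
    rw [hMm s ⟨hs, hss.le.trans hs'⟩, hMm s' ⟨hs.trans hss.le, hs'⟩] at hl
    refine hl.congr' ?_
    have l1 : ∀ᶠ k : ℕ in atTop, 4 ≤ k * (s' - s) :=
      (tendsto_natCast_atTop_atTop.atTop_mul_const (sub_pos.2 hss)).eventually_ge_atTop 4
    filter_upwards [l1, eventually_gt_atTop 0] with k hk4 hk0
    have hk' : (0 : ℝ) < k := by exact_mod_cast hk0
    have hder : ∀ r, deriv (η k) r
        = k * deriv S (k * (r - s) - 1) - k * deriv S (k * (s' - r) - 1) := by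
      intro r
      have d1 : HasDerivAt (fun r => S (k * (r - s) - 1)) (deriv S (k * (r - s) - 1) * k) r := by
        refine (hSd _).comp r ?_
        simpa using (((hasDerivAt_id r).sub_const s).const_mul (k : ℝ)).sub_const 1
      have d2 : HasDerivAt (fun r => S (k * (s' - r) - 1)) (deriv S (k * (s' - r) - 1) * (-k)) r := by
        refine (hSd _).comp r ?_
        simpa using (((hasDerivAt_id r).const_sub s').const_mul (k : ℝ)).sub_const 1
      rw [show deriv (η k) r = _ from (d1.mul d2).deriv]
      -- the boundary layers are disjoint
      by_cases hr : k * (r - s) ≤ 2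
      · have : S (k * (s' - r) - 1) = 1 :=
          Real.smoothTransition.one_of_one_le (by nlinarith)
        have h0 : deriv S (k * (s' - r) - 1) = 0 := hS'0 _ fun hc => by nlinarith [hc.2]
        rw [this, h0]; ring
      · have : S (k * (r - s) - 1) = 1 := Real.smoothTransition.one_of_one_le (by linarith)
        have h0 : deriv S (k * (r - s) - 1) = 0 := hS'0 _ fun hc => by linarith [hc.2]
        rw [this, h0]; ring
    have hvan : ∀ r, r ∉ Ioc t₀ T → deriv (η k) r = 0 := by
      intro r hr
      rw [hder, hS'0, hS'0, mul_zero, sub_zero]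
      · intro hc
        apply hr
        have h1 : 0 < k * (s' - r) := by linarith [hc.1]
        have h2 := (pos_iff_pos_of_mul_pos h1).1 hk'
        exact ⟨by nlinarith [hc.2], by linarith⟩
      · intro hc
        apply hr
        have h1 : 0 < k * (r - s) := by linarith [hc.1]
        have h2 := (pos_iff_pos_of_mul_pos h1).1 hk'
        exact ⟨by linarith, by nlinarith [hc.2]⟩
    have e1 : ∫ t in t₀..T, deriv (η k) t * m t = ∫ t, deriv (η k) t * M t := by
      rw [intervalIntegral.integral_of_le hT,
        ← setIntegral_eq_integral_of_forall_compl_eq_zero (s := Ioc t₀ T)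
          (f := fun t => deriv (η k) t * M t)]
      · exact setIntegral_congr_fun measurableSet_Ioc fun t ht => by
          simp only [hMm t (Ioc_subset_Icc_self ht)]
      · intro t ht
        rw [hvan t ht, zero_mul]
    have cv1 : ∫ y, deriv S y * M (s + 1 * (y + 1) / k)
        = ∫ r, k * deriv S (k * (r - s) - 1) * M r := by
      have := integral_sub_right_eq_self (μ := volume)
        (fun y => deriv S y * M (s + 1 * (y + 1) / k)) (1 + k * s)
      rw [← this]
      have := Measure.integral_comp_mul_left
        (fun y => deriv S (y - (1 + k * s)) * M (s + 1 * (y - (1 + k * s) + 1) / k)) (k : ℝ)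
      rw [abs_of_pos (inv_pos.2 hk'), smul_eq_mul, eq_comm, inv_mul_eq_iff_eq_mul₀ hk'.ne'] at this
      rw [this, ← integral_const_mul]
      congr 1; ext r
      have a1 : k * r - (1 + k * s) = k * (r - s) - 1 := by ring
      have a2 : s + 1 * (k * (r - s) - 1 + 1) / k = r := by field_simp; ring
      rw [a1, a2]; ring
    have cv2 : ∫ y, deriv S y * M (s' + -1 * (y + 1) / k)
        = ∫ r, k * deriv S (k * (s' - r) - 1) * M r := by
      have := integral_sub_left_eq_self (μ := volume)
        (fun y => deriv S y * M (s' + -1 * (y + 1) / k)) (k * s' - 1)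
      rw [← this]
      have := Measure.integral_comp_mul_left
        (fun y => deriv S (k * s' - 1 - y) * M (s' + -1 * (k * s' - 1 - y + 1) / k)) (k : ℝ)
      rw [abs_of_pos (inv_pos.2 hk'), smul_eq_mul, eq_comm, inv_mul_eq_iff_eq_mul₀ hk'.ne'] at this
      rw [this, ← integral_const_mul]
      congr 1; ext r
      have a1 : k * s' - 1 - k * r = k * (s' - r) - 1 := by ring
      have a2 : s' + -1 * (k * (s' - r) - 1 + 1) / k = r := by field_simp; ring
      rw [a1, a2]; ring
    have hint : ∀ (f : ℝ → ℝ), Continuous f → (Function.Injective f) → Topology.IsClosedEmbedding f →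
        Integrable fun r => k * deriv S (f r) * M r := fun f hf _ hce =>
      (((hS'c.comp hf).const_mul _).mul hM |>.integrable_of_hasCompactSupport
        ((hS'supp.comp_isClosedEmbedding hce).mul_left.mul_right))
    rw [e1, cv1, cv2, ← integral_sub]
    · congr 1; ext r; rw [hder]; ring
    · refine hint (fun r => k * (r - s) - 1) (by fun_prop) ?_ ?_
      · intro a b hab; simpa [hk'.ne'] using hab
      · have : (fun r : ℝ => k * (r - s) - 1) = (Homeomorph.subRight 1) ∘
          (Homeomorph.mulLeft₀ (k : ℝ) hk'.ne') ∘ (Homeomorph.subRight s) := rfl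
        rw [this]; exact (Homeomorph.isClosedEmbedding _).comp
          ((Homeomorph.isClosedEmbedding _).comp (Homeomorph.isClosedEmbedding _))
    · refine hint (fun r => k * (s' - r) - 1) (by fun_prop) ?_ ?_
      · intro a b hab; simpa [hk'.ne'] using hab
      · have : (fun r : ℝ => k * (s' - r) - 1) = (Homeomorph.subRight 1) ∘
          (Homeomorph.mulLeft₀ (k : ℝ) hk'.ne') ∘ (Homeomorph.subLeft s') := rfl
        rw [this]; exact (Homeomorph.isClosedEmbedding _).comp
          ((Homeomorph.isClosedEmbedding _).comp (Homeomorph.isClosedEmbedding _))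
  have := tendsto_nhds_unique (tendsto_const_nhds.congr' (by
    filter_upwards [eventually_gt_atTop 0] with k hk
    exact (hzero k hk).symm)) (lim1.add lim2)
  linarith

end Curves

/-! ### Gradient and Laplacian of test functions -/

section GradientLaplacian

variable {d : ℕ}

lemma norm_gradient (u : Sp d → ℝ) (x : Sp d) : ‖gradient u x‖ = ‖fderiv ℝ u x‖ :=
  LinearIsometryEquiv.norm_map _ _

lemma norm_gradient_sub (u w : Sp d → ℝ) (x y : Sp d) :
    ‖gradient u x - gradient w y‖ = ‖fderiv ℝ u x - fderiv ℝ w y‖ := by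
  rw [gradient, gradient, ← map_sub, LinearIsometryEquiv.norm_map]

lemma IsTest.continuous_gradient {u : Sp d → ℝ} (hu : IsTest u) : Continuous (gradient u) :=
  (LinearIsometryEquiv.continuous _).comp hu.fderiv.continuous

lemma DerivBound.norm_gradient_le {u : Sp d → ℝ} {B : ℝ} (h : DerivBound B u) (x : Sp d) :
    ‖gradient u x‖ ≤ B :=
  (norm_gradient u x).le.trans (h.norm_fderiv_le x)

/-- The trace of a bilinear form, as a continuous linear map. -/
def traceCLM (d : ℕ) : (Sp d →L[ℝ] Sp d →L[ℝ] ℝ) →L[ℝ] ℝ :=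
  ∑ i, (ContinuousLinearMap.apply ℝ ℝ (EuclideanSpace.basisFun (Fin d) ℝ i)).comp
    (ContinuousLinearMap.apply ℝ (Sp d →L[ℝ] ℝ) (EuclideanSpace.basisFun (Fin d) ℝ i))

lemma abs_traceCLM_le (b : Sp d →L[ℝ] Sp d →L[ℝ] ℝ) : |traceCLM d b| ≤ d * ‖b‖ := by
  have e : traceCLM d b = ∑ i, b (EuclideanSpace.basisFun (Fin d) ℝ i)
      (EuclideanSpace.basisFun (Fin d) ℝ i) := by simp [traceCLM]
  rw [e]
  refine (Finset.abs_sum_le_sum_abs _ _).trans ((Finset.sum_le_card_nsmul _ _ ‖b‖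
    fun i _ => ?_).trans (by simp))
  have h1 := (b (EuclideanSpace.basisFun (Fin d) ℝ i)).le_opNorm
    (EuclideanSpace.basisFun (Fin d) ℝ i)
  have h2 := b.le_opNorm (EuclideanSpace.basisFun (Fin d) ℝ i)
  rw [OrthonormalBasis.norm_eq_one, mul_one] at h1 h2
  exact h1.trans h2

lemma laplacian_eq_traceCLM (u : Sp d → ℝ) (x : Sp d) :
    Laplacian.laplacian u x = traceCLM d (fderiv ℝ (fderiv ℝ u) x) := by
  rw [laplacian_eq_sum]
  simp [traceCLM]

lemma IsTest.laplacian {u : Sp d → ℝ} (hu : IsTest u) : IsTest (Laplacian.laplacian u) := by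
  have : Laplacian.laplacian u = fun x => traceCLM d (_root_.fderiv ℝ (_root_.fderiv ℝ u) x) :=
    funext fun x => laplacian_eq_traceCLM u x
  rw [this]
  exact hu.fderiv.fderiv.clm_comp _

lemma DerivBound.abs_laplacian_le {u : Sp d → ℝ} {B : ℝ} (h : DerivBound B u) (x : Sp d) :
    |Laplacian.laplacian u x| ≤ d * B := by
  rw [laplacian_eq_traceCLM]
  exact (abs_traceCLM_le _).trans
    (mul_le_mul_of_nonneg_left (h.norm_fderiv_fderiv_le x) (Nat.cast_nonneg _))

lemma lipschitz_of_norm_iteratedFDeriv_one_le {F : Type} [NormedAddCommGroup F] [NormedSpace ℝ F]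
    {u : Sp d → F} (hu : Differentiable ℝ u) {B : ℝ}
    (h : ∀ x, ‖iteratedFDeriv ℝ 1 u x‖ ≤ B) (x y : Sp d) : ‖u y - u x‖ ≤ B * ‖y - x‖ :=
  lipschitz_of_norm_fderiv_le hu (fun x => by simpa using h x) x y

lemma DerivBound.abs_laplacian_sub_le {u : Sp d → ℝ} (hu : IsTest u) {B : ℝ}
    (h : DerivBound B u) (x y : Sp d) :
    |Laplacian.laplacian u y - Laplacian.laplacian u x| ≤ d * B * ‖y - x‖ := by
  rw [laplacian_eq_traceCLM, laplacian_eq_traceCLM, ← map_sub, mul_assoc]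
  refine (abs_traceCLM_le _).trans (mul_le_mul_of_nonneg_left ?_ (Nat.cast_nonneg _))
  refine lipschitz_of_norm_iteratedFDeriv_one_le hu.fderiv.fderiv.differentiable (fun z => ?_) x y
  rw [norm_iteratedFDeriv_fderiv, norm_iteratedFDeriv_fderiv]
  exact h 3 le_rfl z

/-- Test functions are limits of compactly supported ones, with uniform derivative bounds. -/
lemma IsTest.exists_cutoff {u : Sp d → ℝ} (hu : IsTest u) :
    ∃ (φ : ℕ → Sp d → ℝ) (B : ℝ), (∀ k, ContDiff ℝ ∞ (φ k)) ∧ (∀ k, HasCompactSupport (φ k)) ∧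
      (∀ k, DerivBound B (φ k)) ∧ ∀ x, ∀ᶠ k in atTop, φ k =ᶠ[𝓝 x] u := by
  let χ : ContDiffBump (0 : Sp d) := ⟨1, 2, one_pos, one_lt_two⟩
  have hχ : IsTest (χ : Sp d → ℝ) := IsTest.of_hasCompactSupport χ.contDiff χ.hasCompactSupport
  let c : ℕ → ℝ := fun k => 1 / ((k : ℝ) + 1)
  have hc0 : ∀ k, 0 < c k := fun k => by positivity
  have hc1 : ∀ k, c k ≤ 1 := fun k => by
    rw [div_le_one (by positivity)]
    linarith [(Nat.cast_nonneg k : (0 : ℝ) ≤ k)]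
  let θ : ℕ → Sp d → ℝ := fun k x => χ (c k • x)
  have hθ : ∀ k, ContDiff ℝ ∞ (θ k) := fun k => χ.contDiff.comp (by fun_prop)
  obtain ⟨A, hA0, hA⟩ := hu.exists_derivBound
  obtain ⟨A', hA'0, hA'⟩ := hχ.exists_derivBound
  have hθb : ∀ k, DerivBound A' (θ k) := by
    intro k j hj x
    have := iteratedFDeriv_comp_const_smul (𝕜 := ℝ) (i := j) (f := (χ : Sp d → ℝ)) (c k)
      (hχ.contDiff.of_le (by exact_mod_cast le_top))
    rw [show θ k = fun z => χ (c k • z) from rfl, this, norm_smul, norm_pow,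
      Real.norm_of_nonneg (hc0 k).le]
    refine (mul_le_mul (pow_le_one₀ (hc0 k).le (hc1 k)) (hA' j hj _) (norm_nonneg _)
      zero_le_one).trans (one_mul _).le
  refine ⟨fun k x => u x * θ k x, 8 * (A * A'), fun k => hu.contDiff.mul (hθ k), fun k => ?_,
    fun k j hj x => ?_, fun x => ?_⟩
  · refine HasCompactSupport.mul_left (HasCompactSupport.of_support_subset_isCompact
      (isCompact_closedBall (0 : Sp d) (2 * (k + 1))) fun x hx => ?_)
    rw [mem_closedBall_zero_iff]
    by_contra hcon
    rw [not_le] at hcon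
    refine hx (χ.zero_of_le_dist ?_)
    rw [dist_zero_right, norm_smul, Real.norm_of_nonneg (hc0 k).le]
    change 2 ≤ 1 / ((k : ℝ) + 1) * ‖x‖
    rw [div_mul_eq_mul_div, one_mul, le_div_iff₀ (by positivity)]
    exact hcon.le
  · refine (norm_iteratedFDeriv_mul_le hu.contDiff (hθ k) x
      (n := j) (by exact_mod_cast le_top)).trans ?_
    calc _ ≤ ∑ i ∈ Finset.range (j + 1), (j.choose i : ℝ) * (A * A') := by
          refine Finset.sum_le_sum fun i hi => ?_
          rw [mul_assoc]
          have hi' : i ≤ j := by simpa [Nat.lt_succ_iff] using hi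
          gcongr
          · exact hA i (hi'.trans hj) x
          · exact hθb k _ ((Nat.sub_le _ _).trans hj) x
      _ = 2 ^ j * (A * A') := by
          rw [← Finset.sum_mul]
          congr 1
          exact_mod_cast Nat.sum_range_choose j
      _ ≤ 8 * (A * A') := by
          gcongr
          calc (2 : ℝ) ^ j ≤ 2 ^ 3 := pow_le_pow_right₀ (by norm_num) hj
            _ = 8 := by norm_num
  · filter_upwards [eventually_ge_atTop ⌈‖x‖ + 1⌉₊] with k hk
    have hk' : ‖x‖ + 1 ≤ k := (Nat.le_ceil _).trans (by exact_mod_cast hk)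
    filter_upwards [Metric.ball_mem_nhds x one_pos] with y hy
    have hy' : ‖y‖ ≤ k := by
      rw [mem_ball_iff_norm] at hy
      have := norm_add_le x (y - x)
      rw [add_sub_cancel] at this
      linarith
    have : θ k y = 1 := by
      refine χ.one_of_mem_closedBall ?_
      rw [mem_closedBall_zero_iff, norm_smul, Real.norm_of_nonneg (hc0 k).le]
      change 1 / ((k : ℝ) + 1) * ‖y‖ ≤ 1
      rw [div_mul_eq_mul_div, one_mul, div_le_one (by positivity)]
      linarith
    rw [this, mul_one]

end GradientLaplacian

/-! ### The equation in integrated form -/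

section Solutions

variable {d : ℕ} {t₀ T : ℝ} {μ₀ : Measure (Sp d)} {μ : ℝ → Measure (Sp d)}
  {α : ℝ → Sp d → Sp d}

lemma IsSolution.prob (h : IsSolution t₀ T μ₀ μ α) {t : ℝ} (ht : t ∈ Icc t₀ T) :
    IsProbabilityMeasure (μ t) := (h.curve.isP2 t ht).isProbabilityMeasure

/-- Disintegration of space-time integrals against `dt ⊗ μₜ`. -/
lemma IsSolution.integrableOn_integral (hT : t₀ ≤ T) (h : IsSolution t₀ T μ₀ μ α) :
    (∀ᵐ t ∂(volume.restrict (Icc t₀ T)), Integrable (α t) (μ t)) ∧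
    IntegrableOn (fun t => ∫ x, ‖α t x‖ ∂(μ t)) (Icc t₀ T) ∧
    ∀ G : Sp d → Sp d, Continuous G → (∃ C, ∀ x, ‖G x‖ ≤ C) →
      IntegrableOn (fun t => ∫ x, ⟪α t x, G x⟫_ℝ ∂(μ t)) (Icc t₀ T) := by
  obtain ⟨κ, hκ, hκμ⟩ := h.curve.exists_kernel hT
  set ν : Measure (ℝ × Sp d) := (volume.restrict (Icc t₀ T)).compProd κ
  have hκμ' : ∀ᵐ t ∂(volume.restrict (Icc t₀ T)), κ t = μ t := by
    filter_upwards [ae_restrict_mem measurableSet_Icc] with t ht using hκμ t ht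
  have h2 : ∫⁻ p, ‖Function.uncurry α p‖ₑ ^ 2 ∂ν < ⊤ := by
    rw [Measure.lintegral_compProd (h.measurable.enorm.pow_const 2)]
    refine lt_of_le_of_lt (le_of_eq ?_) h.square_integrable
    refine lintegral_congr_ae ?_
    filter_upwards [hκμ'] with t ht
    rw [ht]
    rfl
  have hL2 : MemLp (Function.uncurry α) 2 ν := by
    refine ⟨h.measurable.aestronglyMeasurable, ?_⟩
    rw [eLpNorm_lt_top_iff_lintegral_rpow_enorm_lt_top two_ne_zero (by simp)]
    simpa using h2
  have hI : Integrable (Function.uncurry α) ν := hL2.integrable (by norm_num)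
  have hfst : ∀ {f : ℝ × Sp d → ℝ}, Integrable f ν →
      IntegrableOn (fun t => ∫ x, f (t, x) ∂(μ t)) (Icc t₀ T) := by
    intro f hf
    have hf' : Integrable (fun t => ∫ x, f (t, x) ∂(κ t)) (volume.restrict (Icc t₀ T)) :=
      Integrable.integral_compProd (κ := ProbabilityTheory.Kernel.const Unit (volume.restrict (Icc t₀ T)))
        (η := ProbabilityTheory.Kernel.prodMkLeft Unit κ) (a := ()) hf
    refine hf'.congr ?_
    filter_upwards [hκμ'] with t ht
    rw [ht]
  refine ⟨?_, hfst hI.norm, fun G hG ⟨C, hC⟩ => ?_⟩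
  · have := ((Measure.integrable_compProd_iff hI.aestronglyMeasurable).1 hI).1
    filter_upwards [this, hκμ'] with t ht ht'
    rw [ht'] at ht
    exact ht
  · refine hfst (f := fun p => ⟪α p.1 p.2, G p.2⟫_ℝ) ?_
    refine (hI.norm.mul_const C).mono' ?_ (Eventually.of_forall fun p => ?_)
    · exact (h.measurable.inner (hG.measurable.comp measurable_snd)).aestronglyMeasurable
    · exact (norm_inner_le_norm _ _).trans (mul_le_mul_of_nonneg_left (hC _) (norm_nonneg _))

lemma integrable_inner_of_bound {m : Measure (Sp d)} {a G : Sp d → Sp d} (ha : Integrable a m)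
    (hG : Continuous G) {C : ℝ} (hC : ∀ x, ‖G x‖ ≤ C) : Integrable (fun x => ⟪a x, G x⟫_ℝ) m :=
  (ha.norm.mul_const C).mono' (ha.aestronglyMeasurable.inner hG.aestronglyMeasurable)
    (Eventually.of_forall fun _ =>
      (norm_inner_le_norm _ _).trans (mul_le_mul_of_nonneg_left (hC _) (norm_nonneg _)))

lemma IsSolution.intervalIntegrable (hT : t₀ ≤ T) (h : IsSolution t₀ T μ₀ μ α) {u : Sp d → ℝ}
    (hu : IsTest u) :
    IntegrableOn (fun t => ∫ x, ⟪α t x, gradient u x⟫_ℝ ∂(μ t)) (Icc t₀ T) ∧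
    IntegrableOn (fun t => ∫ x, Laplacian.laplacian u x ∂(μ t)) (Icc t₀ T) := by
  obtain ⟨B, -, hB⟩ := hu.exists_derivBound
  refine ⟨(h.integrableOn_integral hT).2.2 _ hu.continuous_gradient ⟨B, hB.norm_gradient_le⟩, ?_⟩
  exact (h.curve.continuousOn_integral_test hu.laplacian).integrableOn_Icc

lemma IsSolution.integral_add_eq (hT : t₀ ≤ T) (h : IsSolution t₀ T μ₀ μ α) {u : Sp d → ℝ}
    (hu : IsTest u) : ∀ᵐ t ∂(volume.restrict (Icc t₀ T)),
    ∫ x, (⟪α t x, gradient u x⟫_ℝ + Laplacian.laplacian u x) ∂(μ t)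
      = ∫ x, ⟪α t x, gradient u x⟫_ℝ ∂(μ t) + ∫ x, Laplacian.laplacian u x ∂(μ t) := by
  obtain ⟨B, -, hB⟩ := hu.exists_derivBound
  filter_upwards [(h.integrableOn_integral hT).1, ae_restrict_mem measurableSet_Icc] with t ht hm
  have := h.prob hm
  exact integral_add (integrable_inner_of_bound ht hu.continuous_gradient hB.norm_gradient_le)
    (hu.laplacian.integrable _)

lemma IsSolution.integrableOn_rhs (hT : t₀ ≤ T) (h : IsSolution t₀ T μ₀ μ α) {u : Sp d → ℝ}
    (hu : IsTest u) : IntegrableOn (fun t => ∫ x, (⟪α t x, gradient u x⟫_ℝ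
      + Laplacian.laplacian u x) ∂(μ t)) (Icc t₀ T) := by
  refine Integrable.congr ((h.intervalIntegrable hT hu).1.add (h.intervalIntegrable hT hu).2) ?_
  filter_upwards [h.integral_add_eq hT hu] with t ht using ht.symm

lemma IsSolution.integral_sub_of_hasCompactSupport (h : IsSolution t₀ T μ₀ μ α)
    {φ : Sp d → ℝ} (hφ : ContDiff ℝ ∞ φ) (hc : HasCompactSupport φ) {s s' : ℝ} (hs : t₀ ≤ s)
    (hss : s < s') (hs' : s' ≤ T) :
    ∫ x, φ x ∂(μ s') - ∫ x, φ x ∂(μ s) = ∫ t in s..s',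
      ∫ x, (⟪α t x, gradient φ x⟫_ℝ + Laplacian.laplacian φ x) ∂(μ t) := by
  have hT : t₀ ≤ T := hs.trans (hss.le.trans hs')
  have hφt := IsTest.of_hasCompactSupport hφ hc
  obtain ⟨B, -, hB⟩ := hφt.exists_derivBound
  refine sub_eq_integral_of_weak_deriv (m := fun t => ∫ x, φ x ∂(μ t))
    (h.curve.continuousOn_integral_test hφt) (h.integrableOn_rhs hT hφt)
    (fun η hη hηc hηs => ?_) hs hss hs'
  have hsupp : tsupport (fun p : ℝ × Sp d => η p.1 * φ p.2) ⊆ tsupport η ×ˢ tsupport φ := by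
    refine closure_minimal (fun p hp => ?_) ((isClosed_tsupport _).prod (isClosed_tsupport _))
    exact ⟨subset_closure (left_ne_zero_of_mul hp), subset_closure (right_ne_zero_of_mul hp)⟩
  have heq := h.equation (fun p => η p.1 * φ p.2)
    ((hη.comp contDiff_fst).mul (hφ.comp contDiff_snd))
    ((IsCompact.prod hηc hc).of_isClosed_subset (isClosed_tsupport _) hsupp)
    (hsupp.trans (prod_mono hηs (subset_univ _)))
  rw [← heq]
  refine intervalIntegral.integral_congr_ae ?_
  have hae := (h.integrableOn_integral hT).1
  rw [ae_restrict_iff' measurableSet_Icc] at hae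
  filter_upwards [hae] with t ht htm
  rw [uIoc_of_le hT] at htm
  have htm' := Ioc_subset_Icc_self htm
  have := h.prob htm'
  have hd : ∀ x, deriv (fun s => η s * φ x) t = deriv η t * φ x := fun x =>
    deriv_mul_const (hη.differentiable (by simp) t) _
  have hg : ∀ x, gradient (fun y => η t * φ y) x = η t • gradient φ x := by
    intro x
    rw [gradient, gradient, fderiv_const_mul (hφt.differentiable x), map_smul]
  have hl : ∀ x, Laplacian.laplacian (fun y => η t * φ y) x = η t * Laplacian.laplacian φ x := by
    intro x
    have := InnerProductSpace.laplacian_smul (η t)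
      (((contDiff_infty.1 hφ 2).contDiffAt : ContDiffAt ℝ 2 φ x))
    exact this
  simp only [hd, hg, hl, inner_smul_right]
  have i1 : Integrable (fun x => deriv η t * φ x) (μ t) := (hφt.integrable _).const_mul _
  have i2 : Integrable (fun x => ⟪α t x, gradient φ x⟫_ℝ + Laplacian.laplacian φ x) (μ t) :=
    (integrable_inner_of_bound (ht htm') hφt.continuous_gradient hB.norm_gradient_le).add
      (hφt.laplacian.integrable _)
  have e : ∀ x, deriv η t * φ x + η t * ⟪α t x, gradient φ x⟫_ℝ
      + η t * Laplacian.laplacian φ x = deriv η t * φ x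
        + η t * (⟪α t x, gradient φ x⟫_ℝ + Laplacian.laplacian φ x) := fun x => by ring
  simp only [e]
  rw [integral_add i1 (i2.const_mul _), integral_const_mul, integral_const_mul]

/-- The equation tested with a time-independent test function, between two times. -/
theorem IsSolution.integral_sub (h : IsSolution t₀ T μ₀ μ α)
    {u : Sp d → ℝ} (hu : IsTest u) {s s' : ℝ} (hs : t₀ ≤ s)
    (hss : s < s') (hs' : s' ≤ T) :
    ∫ x, u x ∂(μ s') - ∫ x, u x ∂(μ s) = ∫ t in s..s',
      ∫ x, (⟪α t x, gradient u x⟫_ℝ + Laplacian.laplacian u x) ∂(μ t) := by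
  have hT : t₀ ≤ T := hs.trans (hss.le.trans hs')
  obtain ⟨φ, B, hφ, hc, hB, hlim⟩ := hu.exists_cutoff
  have hφt := fun k => IsTest.of_hasCompactSupport (hφ k) (hc k)
  have hm : ∀ t ∈ Icc t₀ T, Tendsto (fun k => ∫ x, φ k x ∂(μ t)) atTop
      (𝓝 (∫ x, u x ∂(μ t))) := by
    intro t ht
    have := h.prob ht
    refine tendsto_integral_of_dominated_convergence (fun _ => B)
      (fun k => (hφt k).continuous.aestronglyMeasurable) (integrable_const _)
      (fun k => Eventually.of_forall (hB k).norm_le) (Eventually.of_forall fun x => ?_)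
    refine tendsto_const_nhds.congr' ?_
    filter_upwards [hlim x] with k hk using hk.eq_of_nhds.symm
  have hI := h.integrableOn_integral hT
  have hsub : Ioc s s' ⊆ Icc t₀ T := fun r hr => ⟨hs.trans hr.1.le, hr.2.trans hs'⟩
  have hae := hI.1
  rw [ae_restrict_iff' measurableSet_Icc] at hae
  have hb : ∀ k t x, ‖⟪α t x, gradient (φ k) x⟫_ℝ + Laplacian.laplacian (φ k) x‖
      ≤ ‖α t x‖ * B + d * B := fun k t x =>
    (norm_add_le _ _).trans (add_le_add ((norm_inner_le_norm _ _).trans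
      (mul_le_mul_of_nonneg_left ((hB k).norm_gradient_le x) (norm_nonneg _)))
      ((hB k).abs_laplacian_le x))
  have hr : Tendsto (fun k => ∫ t in s..s',
      ∫ x, (⟪α t x, gradient (φ k) x⟫_ℝ + Laplacian.laplacian (φ k) x) ∂(μ t)) atTop
      (𝓝 (∫ t in s..s',
      ∫ x, (⟪α t x, gradient u x⟫_ℝ + Laplacian.laplacian u x) ∂(μ t))) := by
    refine intervalIntegral.tendsto_integral_filter_of_dominated_convergence
      (fun t => (∫ x, ‖α t x‖ ∂(μ t)) * B + d * B) (Eventually.of_forall fun k => ?_)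
      (Eventually.of_forall fun k => ?_) ?_ ?_
    · rw [uIoc_of_le hss.le]
      exact ((h.integrableOn_rhs hT (hφt k)).mono_set hsub).aestronglyMeasurable
    · filter_upwards [hae] with t ht htm
      rw [uIoc_of_le hss.le] at htm
      have := h.prob (hsub htm)
      have hi := ((ht (hsub htm)).norm.mul_const B).add (integrable_const ((d : ℝ) * B))
      refine (norm_integral_le_of_norm_le hi (Eventually.of_forall fun x => hb k t x)).trans
        (le_of_eq ?_)
      have := integral_add ((ht (hsub htm)).norm.mul_const B)
        (integrable_const ((d : ℝ) * B))
      rw [integral_mul_const] at this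
      simpa using this
    · rw [intervalIntegrable_iff_integrableOn_Ioc_of_le hss.le]
      exact ((hI.2.1.mono_set hsub).mul_const B).add
        (integrableOn_const (by simp) (by finiteness))
    · filter_upwards [hae] with t ht htm
      rw [uIoc_of_le hss.le] at htm
      have := h.prob (hsub htm)
      refine tendsto_integral_of_dominated_convergence (fun x => ‖α t x‖ * B + d * B)
        (fun k => ((integrable_inner_of_bound (ht (hsub htm)) (hφt k).continuous_gradient
          (hB k).norm_gradient_le).add ((hφt k).laplacian.integrable _)).aestronglyMeasurable)
        (((ht (hsub htm)).norm.mul_const B).add (integrable_const _))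
        (fun k => Eventually.of_forall fun x => hb k t x) (Eventually.of_forall fun x => ?_)
      refine tendsto_const_nhds.congr' ?_
      filter_upwards [hlim x] with k hk
      have e1 : gradient (φ k) x = gradient u x := by
        rw [gradient, gradient, hk.fderiv_eq]
      have e2 : Laplacian.laplacian (φ k) x = Laplacian.laplacian u x :=
        (InnerProductSpace.laplacian_congr_nhds hk).eq_of_nhds
      rw [e1, e2]
  refine tendsto_nhds_unique ((hm s' ⟨hs.trans hss.le, hs'⟩).sub
    (hm s ⟨hs, hss.le.trans hs'⟩)) (hr.congr fun k => ?_)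
  exact (h.integral_sub_of_hasCompactSupport (hφ k) (hc k) hs hss hs').symm

/-- The same identity with the drift and diffusion terms separated. -/
lemma IsSolution.integral_sub' (h : IsSolution t₀ T μ₀ μ α)
    {u : Sp d → ℝ} (hu : IsTest u) {s s' : ℝ} (hs : t₀ ≤ s)
    (hss : s < s') (hs' : s' ≤ T) :
    ∫ x, u x ∂(μ s') - ∫ x, u x ∂(μ s) = (∫ t in s..s', ∫ x, ⟪α t x, gradient u x⟫_ℝ ∂(μ t))
      + ∫ t in s..s', ∫ x, Laplacian.laplacian u x ∂(μ t) := by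
  have hT : t₀ ≤ T := hs.trans (hss.le.trans hs')
  have hsub : Ioc s s' ⊆ Icc t₀ T := fun r hr => ⟨hs.trans hr.1.le, hr.2.trans hs'⟩
  obtain ⟨i1, i2⟩ := h.intervalIntegrable hT hu
  rw [h.integral_sub hu hs hss hs', ← intervalIntegral.integral_add
    ((intervalIntegrable_iff_integrableOn_Ioc_of_le hss.le).2 (i1.mono_set hsub))
    ((intervalIntegrable_iff_integrableOn_Ioc_of_le hss.le).2 (i2.mono_set hsub))]
  refine intervalIntegral.integral_congr_ae ?_
  have hae := h.integral_add_eq hT hu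
  rw [ae_restrict_iff' measurableSet_Icc] at hae
  filter_upwards [hae] with t ht htm
  rw [uIoc_of_le hss.le] at htm
  exact ht (hsub htm)

end Solutions

/-! ### Fisher information -/

section Fisher

variable {d : ℕ}

/-- Continuity of translations in `L²`, in weak form. -/
lemma continuous_integral_mul_translate {K H : Sp d → ℝ} (hK : MemLp K 2 volume)
    (hH : MemLp H 2 volume) : Continuous fun t : Sp d => ∫ x, K x * H (x - t) := by
  let τ : Sp d → C(Sp d, Sp d) := fun t => ⟨fun x => x - t, by fun_prop⟩
  have hτ : Continuous τ := ContinuousMap.continuous_of_continuous_uncurry _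
    (continuous_snd.sub continuous_fst)
  have hmp : ∀ t, MeasurePreserving (τ t) (volume : Measure (Sp d)) volume := fun t =>
    measurePreserving_sub_right volume t
  have h1 : Continuous fun t => Lp.compMeasurePreserving (τ t) (hmp t) (hH.toLp H) :=
    Continuous.compMeasurePreservingLp (f := fun _ : Sp d => hH.toLp H) continuous_const hτ hmp
      (by simp)
  have h2 : Continuous fun t =>
      ⟪Lp.compMeasurePreserving (τ t) (hmp t) (hH.toLp H), hK.toLp K⟫_ℝ :=
    h1.inner continuous_const
  convert h2 using 2 with t
  rw [L2.inner_def]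
  refine integral_congr_ae ?_
  have e1 := Lp.coeFn_compMeasurePreserving (hH.toLp H) (hmp t)
  have e2 := (hmp t).quasiMeasurePreserving.ae_eq_comp hH.coeFn_toLp
  filter_upwards [e1, e2, hK.coeFn_toLp] with x h1 h2 h3
  rw [h1, h2, h3]
  rfl

lemma integrable_mul_translate {K H : Sp d → ℝ} (hK : MemLp K 2 volume)
    (hH : MemLp H 2 volume) (t : Sp d) : Integrable fun x => K x * H (x - t) :=
  hK.integrable_mul (hH.comp_measurePreserving (measurePreserving_sub_right volume t))

lemma integral_mul_mollify {K H ρ : Sp d → ℝ} (hK : MemLp K 2 volume)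
    (hH : MemLp H 2 volume) (hρ : Continuous ρ) (hc : HasCompactSupport ρ) :
    ∫ x, K x * mollify ρ H x = ∫ t, (∫ x, K x * H (x - t)) * ρ t := by
  have hm : AEStronglyMeasurable (fun p : Sp d × Sp d => K p.1 * (H (p.1 - p.2) * ρ p.2))
      (volume.prod volume) :=
    hK.1.comp_fst.mul ((hH.1.comp_quasiMeasurePreserving
      (quasiMeasurePreserving_sub_of_right_invariant volume volume)).mul
      hρ.aestronglyMeasurable.comp_snd)
  have hi : Integrable (fun p : Sp d × Sp d => K p.1 * (H (p.1 - p.2) * ρ p.2))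
      (volume.prod volume) := by
    refine (integrable_prod_iff' hm).2 ⟨Eventually.of_forall fun t => ?_, ?_⟩
    · refine ((integrable_mul_translate hK hH t).mul_const (ρ t)).congr
        (Eventually.of_forall fun x => ?_)
      simp only [mul_assoc]
    · have : ∀ t, ∫ x, ‖K x * (H (x - t) * ρ t)‖ = (∫ x, ‖K x‖ * ‖H (x - t)‖) * ‖ρ t‖ := by
        intro t
        rw [← integral_mul_const]
        simp only [norm_mul, mul_assoc]
      simp only [this]
      refine Continuous.integrable_of_hasCompactSupport
        ((continuous_integral_mul_translate hK.norm hH.norm).mul hρ.norm) ?_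
      exact hc.norm.mul_left
  have := integral_integral_swap (f := fun x t => K x * (H (x - t) * ρ t)) hi
  simp only [mollify, smul_eq_mul, ← integral_const_mul]
  rw [this]
  refine integral_congr_ae (Eventually.of_forall fun t => ?_)
  simp only [← integral_mul_const, mul_assoc]

/-- Bump functions shrinking to the origin. -/
def shrinkingBump (d j : ℕ) : ContDiffBump (0 : Sp d) :=
  ⟨1 / (2 * ((j : ℝ) + 1)), 1 / ((j : ℝ) + 1), by positivity, by
    gcongr
    linarith [(Nat.cast_nonneg j : (0 : ℝ) ≤ j)]⟩

lemma tendsto_rOut_shrinkingBump (d : ℕ) :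
    Tendsto (fun j => (shrinkingBump d j).rOut) atTop (𝓝 0) :=
  tendsto_one_div_add_atTop_nhds_zero_nat

/-- Mollification converges weakly in `L²`. -/
lemma tendsto_integral_mul_mollify {K H : Sp d → ℝ} (hK : MemLp K 2 volume)
    (hH : MemLp H 2 volume) :
    Tendsto (fun j => ∫ x, K x * mollify ((shrinkingBump d j).normed volume) H x) atTop
      (𝓝 (∫ x, K x * H x)) := by
  have hcont := continuous_integral_mul_translate hK hH
  have := ContDiffBump.convolution_tendsto_right_of_continuous (μ := volume)
    (tendsto_rOut_shrinkingBump d) (hcont.comp continuous_neg) 0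
  simp only [Function.comp_apply, neg_zero, sub_zero] at this
  refine this.congr fun j => ?_
  rw [integral_mul_mollify hK hH (shrinkingBump d j).continuous_normed
    (shrinkingBump d j).hasCompactSupport_normed]
  refine integral_congr_ae (Eventually.of_forall fun t => ?_)
  simp [mul_comm]

lemma IsH1WithGradient.memLp_inner {f : Sp d → ℝ} {g : Sp d → Sp d} (h : IsH1WithGradient f g)
    (v : Sp d) : MemLp (fun x => ⟪g x, v⟫_ℝ) 2 volume := h.memLp_gradient.inner_const v

lemma memLp_two_locallyIntegrable {f : Sp d → ℝ} (h : MemLp f 2 volume) :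
    LocallyIntegrable f volume := h.locallyIntegrable (by norm_num)

/-- The derivative of a mollified Sobolev function is the mollified weak derivative. -/
lemma IsH1WithGradient.fderiv_mollify {f : Sp d → ℝ} {g : Sp d → Sp d}
    (h : IsH1WithGradient f g) {ρ : Sp d → ℝ} (hρ : ContDiff ℝ ∞ ρ) (hc : HasCompactSupport ρ)
    (x v : Sp d) : fderiv ℝ (mollify ρ f) x v = mollify ρ (fun y => ⟪g y, v⟫_ℝ) x := by
  have hloc := memLp_two_locallyIntegrable h.memLp
  rw [(hasFDerivAt_mollify hloc hρ hc x).fderiv, mollify, mollify]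
  have hloc' : LocallyIntegrable (fun t => f (x - t)) volume := by
    refine memLp_two_locallyIntegrable ?_
    exact h.memLp.comp_measurePreserving (Measure.measurePreserving_sub_left volume x)
  have hint : Integrable (fun t => f (x - t) • fderiv ℝ ρ t) volume :=
    hloc'.integrable_smul_right_of_hasCompactSupport
      (hρ.continuous_fderiv (by simp)) (hc.fderiv (𝕜 := ℝ))
  rw [ContinuousLinearMap.integral_apply hint]
  simp only [smul_apply, smul_eq_mul]
  have e1 := integral_sub_left_eq_self (fun t => f (x - t) * fderiv ℝ ρ t v) volume x
  have e2 := integral_sub_left_eq_self (fun t => ⟪g (x - t), v⟫_ℝ * ρ t) volume x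
  rw [← e1, ← e2]
  simp only [sub_sub_cancel]
  have hφ : ContDiff ℝ ∞ (fun y => ρ (x - y)) := hρ.comp (by fun_prop)
  have hφc : HasCompactSupport (fun y => ρ (x - y)) :=
    hc.comp_homeomorph (Homeomorph.subLeft x)
  have := h.integral_by_parts _ hφ hφc v
  have hd : ∀ y, fderiv ℝ (fun y => ρ (x - y)) y v = - fderiv ℝ ρ (x - y) v := by
    intro y
    have h1 := (hρ.differentiable (by simp) (x - y)).hasFDerivAt.comp y
      ((hasFDerivAt_const x y).sub (hasFDerivAt_id y))
    rw [show (fun y => ρ (x - y)) = ρ ∘ (fun y => x - y) from rfl]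
    erw [h1.fderiv]
    simp
  simp only [hd, mul_neg, integral_neg, neg_inj] at this
  exact this

lemma memLp_mul_of_bound {f w : Sp d → ℝ} (hf : MemLp f 2 volume) (hw : Continuous w) {C : ℝ}
    (hC : ∀ x, ‖w x‖ ≤ C) : MemLp (fun x => f x * w x) 2 volume := by
  refine MemLp.of_le_mul (c := C) hf (hf.1.mul hw.aestronglyMeasurable)
    (Eventually.of_forall fun x => ?_)
  rw [norm_mul, mul_comm]
  exact mul_le_mul_of_nonneg_right (hC x) (norm_nonneg _)

/-- The chain rule `∇(f²) = 2 f ∇f`, in weak form. -/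
lemma IsH1WithGradient.integral_sq_mul_fderiv {f : Sp d → ℝ} {g : Sp d → Sp d}
    (h : IsH1WithGradient f g) {ψ : Sp d → ℝ} (hψ : ContDiff ℝ ∞ ψ) (hc : HasCompactSupport ψ)
    (v : Sp d) : ∫ x, f x ^ 2 * fderiv ℝ ψ x v = -2 * ∫ x, f x * ⟪g x, v⟫_ℝ * ψ x := by
  set ρ : ℕ → Sp d → ℝ := fun j => (shrinkingBump d j).normed volume
  have hρ : ∀ j, ContDiff ℝ ∞ (ρ j) := fun j => (shrinkingBump d j).contDiff_normed
  have hρc : ∀ j, HasCompactSupport (ρ j) := fun j => (shrinkingBump d j).hasCompactSupport_normed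
  have hloc := memLp_two_locallyIntegrable h.memLp
  have hψ' : Continuous fun x => fderiv ℝ ψ x v :=
    (hψ.continuous_fderiv (by simp)).clm_apply continuous_const
  have hψc' : HasCompactSupport fun x => fderiv ℝ ψ x v := hc.fderiv_apply (𝕜 := ℝ) v
  obtain ⟨C₀, hC₀⟩ := hc.exists_bound_of_continuous hψ.continuous
  obtain ⟨C₁, hC₁⟩ := hψc'.exists_bound_of_continuous hψ'
  have m1 : MemLp (fun x => f x * fderiv ℝ ψ x v) 2 volume :=
    memLp_mul_of_bound h.memLp hψ' hC₁
  have m2 : MemLp (fun x => f x * ψ x) 2 volume :=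
    memLp_mul_of_bound h.memLp hψ.continuous hC₀
  have m3 : MemLp (fun x => ⟪g x, v⟫_ℝ * ψ x) 2 volume :=
    memLp_mul_of_bound (h.memLp_inner v) hψ.continuous hC₀
  have key : ∀ j, (∫ x, f x * fderiv ℝ ψ x v * mollify (ρ j) f x)
      + ∫ x, f x * ψ x * mollify (ρ j) (fun y => ⟪g y, v⟫_ℝ) x
      = -∫ x, ⟪g x, v⟫_ℝ * ψ x * mollify (ρ j) f x := by
    intro j
    have hs := contDiff_mollify hloc (hρ j) (hρc j)
    have hd : Differentiable ℝ (mollify (ρ j) f) := hs.differentiable (by simp)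
    have hibp := h.integral_by_parts (fun x => ψ x * mollify (ρ j) f x) (hψ.mul hs)
      hc.mul_right v
    have e : ∀ x, fderiv ℝ (fun x => ψ x * mollify (ρ j) f x) x v
        = fderiv ℝ ψ x v * mollify (ρ j) f x
          + ψ x * mollify (ρ j) (fun y => ⟪g y, v⟫_ℝ) x := by
      intro x
      rw [← h.fderiv_mollify (hρ j) (hρc j)]
      erw [fderiv_mul (hψ.differentiable (by simp) x) (hd x)]
      simp
      ring
    simp only [e] at hibp
    have hs' := contDiff_mollify (memLp_two_locallyIntegrable (h.memLp_inner v)) (hρ j) (hρc j)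
    have i1 : Integrable (fun x => f x * (fderiv ℝ ψ x v * mollify (ρ j) f x)) volume :=
      hloc.integrable_smul_right_of_hasCompactSupport (hψ'.mul hs.continuous) hψc'.mul_right
    have i2 : Integrable (fun x => f x * (ψ x * mollify (ρ j) (fun y => ⟪g y, v⟫_ℝ) x)) volume :=
      hloc.integrable_smul_right_of_hasCompactSupport (hψ.continuous.mul hs'.continuous)
        hc.mul_right
    simp only [mul_assoc]
    rw [← integral_add i1 i2, ← hibp]
    simp only [mul_add]
  have lim := ((tendsto_integral_mul_mollify m1 h.memLp).add
    (tendsto_integral_mul_mollify m2 (h.memLp_inner v)))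
  have lim2 := (tendsto_integral_mul_mollify m3 h.memLp).neg
  have := tendsto_nhds_unique (lim.congr key) lim2
  have e1 : ∀ x, f x * fderiv ℝ ψ x v * f x = f x ^ 2 * fderiv ℝ ψ x v := fun x => by ring
  have e2 : ∀ x, f x * ψ x * ⟪g x, v⟫_ℝ = f x * ⟪g x, v⟫_ℝ * ψ x := fun x => by ring
  have e3 : ∀ x, ⟪g x, v⟫_ℝ * ψ x * f x = f x * ⟪g x, v⟫_ℝ * ψ x := fun x => by ring
  simp only [e1, e2, e3] at this
  linarith

/-- Integration by parts against `μ₀` costs at most `J` in `L²(μ₀)`: formally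
`∫ Δu dμ₀ = -∫ ∇u · ∇ log μ₀ dμ₀` with `∫ |∇ log μ₀|² dμ₀ ≤ J²`. The bound is put in Young's form,
which involves no square root of the Dirichlet energy of `u`. -/
def FisherBound (J : ℝ) (μ₀ : Measure (Sp d)) : Prop :=
  ∀ u : Sp d → ℝ, IsTest u → ∀ r : ℝ, 0 < r →
    |∫ x, Laplacian.laplacian u x ∂μ₀| ≤ r * J ^ 2 + (4 * r)⁻¹ * ∫ x, ‖gradient u x‖ ^ 2 ∂μ₀

lemma sqrtDensity_sq (μ : Measure (Sp d)) (x : Sp d) :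
    sqrtDensity μ x ^ 2 = (μ.rnDeriv volume x).toReal :=
  Real.sq_sqrt ENNReal.toReal_nonneg

lemma integral_sqrtDensity_sq_mul {μ₀ : Measure (Sp d)} (h : IsP2ac μ₀) (w : Sp d → ℝ) :
    ∫ x, sqrtDensity μ₀ x ^ 2 * w x = ∫ x, w x ∂μ₀ := by
  have := h.isProbabilityMeasure
  rw [← integral_rnDeriv_smul h.absolutelyContinuous (f := w)]
  simp only [sqrtDensity_sq, smul_eq_mul]

lemma integrable_sqrtDensity_sq_mul {μ₀ : Measure (Sp d)} (h : IsP2ac μ₀) {w : Sp d → ℝ}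
    (hw : Integrable w μ₀) : Integrable (fun x => sqrtDensity μ₀ x ^ 2 * w x) volume := by
  have := h.isProbabilityMeasure
  have := (integrable_rnDeriv_smul_iff h.absolutelyContinuous (f := w)).2 hw
  simpa only [sqrtDensity_sq, smul_eq_mul] using this

/-- `∫ Δu dμ₀ = -2 ∫ √μ₀ ∇u · ∇√μ₀`, from `∇μ₀ = 2 √μ₀ ∇√μ₀`. -/
lemma integral_laplacian_eq {μ₀ : Measure (Sp d)} (h : IsP2ac μ₀) {g : Sp d → Sp d}
    (hg : IsH1WithGradient (sqrtDensity μ₀) g) {u : Sp d → ℝ} (hu : ContDiff ℝ ∞ u)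
    (hc : HasCompactSupport u) :
    ∫ x, Laplacian.laplacian u x ∂μ₀ = -2 * ∫ x, sqrtDensity μ₀ x * fderiv ℝ u x (g x) := by
  have hut := IsTest.of_hasCompactSupport hu hc
  rw [← integral_sqrtDensity_sq_mul h]
  set e := EuclideanSpace.basisFun (Fin d) ℝ
  have hψ : ∀ i, ContDiff ℝ ∞ (fun x => fderiv ℝ u x (e i)) := fun i =>
    (hut.fderiv.contDiff).clm_apply contDiff_const
  have hψc : ∀ i, HasCompactSupport (fun x => fderiv ℝ u x (e i)) := fun i =>
    hc.fderiv_apply (𝕜 := ℝ) _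
  have hd2 : ∀ i x, fderiv ℝ (fun x => fderiv ℝ u x (e i)) x (e i)
      = fderiv ℝ (fderiv ℝ u) x (e i) (e i) := by
    intro i x
    have := ((hut.fderiv.differentiable x).hasFDerivAt.clm_apply (hasFDerivAt_const (e i) x))
    rw [this.fderiv]
    simp
  have hcont : ∀ i, Continuous fun x => fderiv ℝ (fun x => fderiv ℝ u x (e i)) x (e i) :=
    fun i => ((hψ i).continuous_fderiv (by simp)).clm_apply continuous_const
  have hcs : ∀ i, HasCompactSupport fun x => fderiv ℝ (fun x => fderiv ℝ u x (e i)) x (e i) :=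
    fun i => (hψc i).fderiv_apply (𝕜 := ℝ) _
  have hprob := h.isProbabilityMeasure
  have i1 : ∀ i ∈ Finset.univ, Integrable (fun x => sqrtDensity μ₀ x ^ 2 *
      fderiv ℝ (fun x => fderiv ℝ u x (e i)) x (e i)) volume := fun i _ =>
    integrable_sqrtDensity_sq_mul h ((hcont i).integrable_of_hasCompactSupport (hcs i))
  have i2 : ∀ i ∈ Finset.univ, Integrable (fun x => sqrtDensity μ₀ x * ⟪g x, e i⟫_ℝ *
      fderiv ℝ u x (e i)) volume := fun i _ =>
    (hg.memLp.integrable_mul (hg.memLp_inner (e i))).locallyIntegrable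
      |>.integrable_smul_right_of_hasCompactSupport (hψ i).continuous (hψc i)
  have e1 : ∀ x, sqrtDensity μ₀ x ^ 2 * Laplacian.laplacian u x = ∑ i,
      sqrtDensity μ₀ x ^ 2 * fderiv ℝ (fun x => fderiv ℝ u x (e i)) x (e i) := by
    intro x
    simp only [hd2, ← Finset.mul_sum]
    rw [laplacian_eq_sum]
  have e2 : ∀ x, sqrtDensity μ₀ x * fderiv ℝ u x (g x) = ∑ i,
      sqrtDensity μ₀ x * ⟪g x, e i⟫_ℝ * fderiv ℝ u x (e i) := by
    intro x
    conv_lhs => rw [← e.sum_repr' (g x)]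
    simp only [map_sum, map_smul, smul_eq_mul, Finset.mul_sum, mul_assoc]
    refine Finset.sum_congr rfl fun i _ => ?_
    rw [real_inner_comm]
  simp only [e1, e2]
  rw [integral_finsetSum _ i1, integral_finsetSum _ i2, Finset.mul_sum]
  exact Finset.sum_congr rfl fun i _ => hg.integral_sq_mul_fderiv (hψ i) (hψc i) (e i)

lemma abs_integral_laplacian_le {μ₀ : Measure (Sp d)} (h : IsP2ac μ₀) {g : Sp d → Sp d}
    (hg : IsH1WithGradient (sqrtDensity μ₀) g) {u : Sp d → ℝ} (hu : ContDiff ℝ ∞ u)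
    (hc : HasCompactSupport u) {r : ℝ} (hr : 0 < r) :
    |∫ x, Laplacian.laplacian u x ∂μ₀|
      ≤ r * (4 * ∫ x, ‖g x‖ ^ 2) + (4 * r)⁻¹ * ∫ x, ‖gradient u x‖ ^ 2 ∂μ₀ := by
  have hut := IsTest.of_hasCompactSupport hu hc
  obtain ⟨B, -, hB⟩ := hut.exists_derivBound
  have hprob := h.isProbabilityMeasure
  have i1 : Integrable (fun x => ‖g x‖ ^ 2) volume :=
    hg.memLp_gradient.integrable_norm_pow (by simp)
  have i0 : Integrable (fun x => ‖gradient u x‖ ^ 2) μ₀ := by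
    refine Integrable.of_bound (hut.continuous_gradient.norm.pow 2).aestronglyMeasurable (B ^ 2)
      (Eventually.of_forall fun x => ?_)
    rw [Real.norm_of_nonneg (by positivity)]
    exact pow_le_pow_left₀ (norm_nonneg _) (hB.norm_gradient_le x) 2
  have i2 := integrable_sqrtDensity_sq_mul h i0
  rw [integral_laplacian_eq h hg hu hc, ← integral_const_mul, ← Real.norm_eq_abs,
    ← integral_sqrtDensity_sq_mul h]
  have hI := ((i1.const_mul 4).const_mul r).add (i2.const_mul (4 * r)⁻¹)
  refine (norm_integral_le_of_norm_le hI (Eventually.of_forall fun x => ?_)).trans (le_of_eq ?_)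
  · have h1 := (fderiv ℝ u x).le_opNorm (g x)
    rw [← norm_gradient] at h1
    have h0 : 0 ≤ sqrtDensity μ₀ x := Real.sqrt_nonneg _
    have h2 : 2 * (sqrtDensity μ₀ x * ‖gradient u x‖) * ‖g x‖
        ≤ r * (4 * ‖g x‖ ^ 2) + (4 * r)⁻¹ * (sqrtDensity μ₀ x * ‖gradient u x‖) ^ 2 := by
      rw [← sub_nonneg]
      have : r * (4 * ‖g x‖ ^ 2) + (4 * r)⁻¹ * (sqrtDensity μ₀ x * ‖gradient u x‖) ^ 2
          - 2 * (sqrtDensity μ₀ x * ‖gradient u x‖) * ‖g x‖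
          = (4 * r)⁻¹ * (4 * r * ‖g x‖ - sqrtDensity μ₀ x * ‖gradient u x‖) ^ 2 := by
        field_simp
        ring
      rw [this]
      positivity
    have e : ‖-2 * (sqrtDensity μ₀ x * fderiv ℝ u x (g x))‖
        = 2 * (sqrtDensity μ₀ x * ‖fderiv ℝ u x (g x)‖) := by
      simp [abs_of_nonneg h0]
    rw [e]
    simp only [Pi.add_apply]
    rw [mul_pow] at h2
    refine le_trans ?_ h2
    have := mul_le_mul_of_nonneg_left h1 h0
    nlinarith
  · simp only [Pi.add_apply]
    rw [integral_add ((i1.const_mul 4).const_mul r) (i2.const_mul _), integral_const_mul,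
      integral_const_mul, integral_const_mul]

lemma FisherBound.of_hasCompactSupport {μ₀ : Measure (Sp d)} [IsProbabilityMeasure μ₀] {J : ℝ}
    (h : ∀ u : Sp d → ℝ, ContDiff ℝ ∞ u → HasCompactSupport u → ∀ r : ℝ, 0 < r →
      |∫ x, Laplacian.laplacian u x ∂μ₀| ≤ r * J ^ 2 + (4 * r)⁻¹ * ∫ x, ‖gradient u x‖ ^ 2 ∂μ₀) :
    FisherBound J μ₀ := by
  intro u hu r hr
  obtain ⟨φ, B, hφ, hc, hB, hlim⟩ := hu.exists_cutoff
  have hφt := fun k => IsTest.of_hasCompactSupport (hφ k) (hc k)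
  have l1 : Tendsto (fun k => ∫ x, Laplacian.laplacian (φ k) x ∂μ₀) atTop
      (𝓝 (∫ x, Laplacian.laplacian u x ∂μ₀)) := by
    refine tendsto_integral_of_dominated_convergence (fun _ => d * B)
      (fun k => (hφt k).laplacian.continuous.aestronglyMeasurable) (integrable_const _)
      (fun k => Eventually.of_forall (hB k).abs_laplacian_le) (Eventually.of_forall fun x => ?_)
    refine tendsto_const_nhds.congr' ?_
    filter_upwards [hlim x] with k hk
    exact (InnerProductSpace.laplacian_congr_nhds hk).eq_of_nhds.symm
  have l2 : Tendsto (fun k => ∫ x, ‖gradient (φ k) x‖ ^ 2 ∂μ₀) atTop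
      (𝓝 (∫ x, ‖gradient u x‖ ^ 2 ∂μ₀)) := by
    refine tendsto_integral_of_dominated_convergence (fun _ => B ^ 2)
      (fun k => ((hφt k).continuous_gradient.norm.pow 2).aestronglyMeasurable)
      (integrable_const _) (fun k => Eventually.of_forall fun x => ?_)
      (Eventually.of_forall fun x => ?_)
    · rw [Real.norm_of_nonneg (by positivity)]
      exact pow_le_pow_left₀ (norm_nonneg _) ((hB k).norm_gradient_le x) 2
    · refine tendsto_const_nhds.congr' ?_
      filter_upwards [hlim x] with k hk
      rw [gradient, gradient, hk.fderiv_eq]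
  exact le_of_tendsto_of_tendsto' l1.abs ((l2.const_mul _).const_add _)
    fun k => h _ (hφ k) (hc k) r hr

/-- If the Fisher information is less than `J²`, then `FisherBound J μ₀` holds. -/
theorem fisherBound_of_fisher_lt {μ₀ : Measure (Sp d)} {J : ℝ}
    (hJ : fisher μ₀ < ENNReal.ofReal (J ^ 2)) : FisherBound J μ₀ := by
  simp only [fisher, iInf_lt_iff] at hJ
  obtain ⟨g, ⟨h, hg⟩, hlt⟩ := hJ
  have := h.isProbabilityMeasure
  refine FisherBound.of_hasCompactSupport fun u hu hc r hr => ?_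
  refine (abs_integral_laplacian_le h hg hu hc hr).trans ?_
  gcongr
  have i1 : Integrable (fun x => ‖g x‖ ^ 2) volume :=
    hg.memLp_gradient.integrable_norm_pow (by simp)
  have e : ENNReal.ofReal (4 * ∫ x, ‖g x‖ ^ 2) = 4 * ∫⁻ x, ‖g x‖ₑ ^ 2 := by
    rw [ENNReal.ofReal_mul (by norm_num), ofReal_integral_eq_lintegral_ofReal i1
      (Eventually.of_forall fun x => by positivity)]
    congr 1
    · simp
    · refine lintegral_congr fun x => ?_
      rw [ENNReal.ofReal_pow (norm_nonneg _), ofReal_norm]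
  rw [← e, ENNReal.ofReal_lt_ofReal_iff_of_nonneg (by positivity)] at hlt
  exact hlt.le

end Fisher

/-! ### Duhamel's formula -/

section Duhamel

variable {d : ℕ} {t₀ T : ℝ} {μ₀ : Measure (Sp d)} {μ : ℝ → Measure (Sp d)}
  {α : ℝ → Sp d → Sp d}

lemma exists_norm_fderiv_heat_sub_le (d : ℕ) : ∃ C, 0 ≤ C ∧ ∀ (u : Sp d → ℝ) (B : ℝ), IsTest u →
    DerivBound B u → ∀ ε, 0 ≤ ε → ∀ x,
      ‖fderiv ℝ (heat ε u) x - fderiv ℝ u x‖ ≤ C * B * √ε := by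
  obtain ⟨C, hC, h⟩ := exists_norm_heat_sub_le d
  refine ⟨C, hC, fun u B hu hB ε hε x => ?_⟩
  rw [hu.fderiv_heat]
  exact h _ B hu.fderiv hB.norm_fderiv_fderiv_le ε hε x

/-- Over a short time, the solution is the heat flow followed by the drift, with an error which is
uniform over test functions with given derivative bounds. -/
theorem IsSolution.exists_step (hT : t₀ ≤ T) (h : IsSolution t₀ T μ₀ μ α) {B η : ℝ} (hB : 0 ≤ B)
    (hη : 0 < η) : ∃ δ > 0, ∀ u : Sp d → ℝ, IsTest u → DerivBound B u → ∀ s ε : ℝ, t₀ ≤ s →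
      0 < ε → ε < δ → s + ε ≤ T →
      |∫ x, u x ∂(μ (s + ε)) - ∫ x, heat ε u x ∂(μ s)
        - ∫ r in s..(s + ε), ∫ x, ⟪α r x, gradient u x⟫_ℝ ∂(μ r)| ≤ η * ε := by
  obtain ⟨C, hC, hheat⟩ := exists_heat_sub_laplacian_le d
  obtain ⟨δ₁, hδ₁, hmod⟩ := h.curve.exists_modulus (η := η / (2 * (d * B + 1))) (by positivity)
  refine ⟨min δ₁ ((η / (2 * (C * B + 1))) ^ 2), lt_min hδ₁ (by positivity),
    fun u hu hBu s ε hs hε hεδ hsT => ?_⟩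
  have hsm : s ∈ Icc t₀ T := ⟨hs, by linarith⟩
  have := h.prob hsm
  have hsub : Icc s (s + ε) ⊆ Icc t₀ T := Icc_subset_Icc hs hsT
  set D := ∫ r in s..(s + ε), ∫ x, ⟪α r x, gradient u x⟫_ℝ ∂(μ r)
  have e1 := h.integral_sub' hu hs (by linarith : s < s + ε) hsT
  have e2 : |(∫ r in s..(s + ε), ∫ x, Laplacian.laplacian u x ∂(μ r))
      - ε * ∫ x, Laplacian.laplacian u x ∂(μ s)| ≤ η / 2 * ε := by
    have hII : IntervalIntegrable (fun r => ∫ x, Laplacian.laplacian u x ∂(μ r)) volume s (s + ε) :=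
      (intervalIntegrable_iff_integrableOn_Ioc_of_le (by linarith)).2
        ((h.intervalIntegrable hT hu).2.mono_set (Ioc_subset_Icc_self.trans hsub))
    have hc : ε * ∫ x, Laplacian.laplacian u x ∂(μ s)
        = ∫ r in s..(s + ε), ∫ x, Laplacian.laplacian u x ∂(μ s) := by
      rw [intervalIntegral.integral_const, add_sub_cancel_left, smul_eq_mul]
    rw [hc, ← intervalIntegral.integral_sub hII intervalIntegrable_const, ← Real.norm_eq_abs]
    refine (intervalIntegral.norm_integral_le_of_norm_le_const (C := η / 2) fun r hr => ?_).trans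
      (le_of_eq ?_)
    · rw [uIoc_of_le (by linarith)] at hr
      have hd : |r - s| < δ₁ := by
        rw [abs_of_pos (by linarith [hr.1])]
        exact lt_of_le_of_lt (by linarith [hr.2]) (hεδ.trans_le (min_le_left _ _))
      refine (hmod r (hsub ⟨hr.1.le, hr.2⟩) s hsm hd _ (d * B) (d * B) (by positivity)
        hBu.abs_laplacian_le (hBu.abs_laplacian_sub_le hu)).trans ?_
      rw [mul_div_assoc', div_le_div_iff₀ (by positivity) two_pos]
      have : 0 ≤ (d : ℝ) * B := by positivity
      nlinarith
    · rw [add_sub_cancel_left, abs_of_pos hε]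
  have e3 : |∫ x, heat ε u x ∂(μ s) - ∫ x, u x ∂(μ s) - ε * ∫ x, Laplacian.laplacian u x ∂(μ s)|
      ≤ η / 2 * ε := by
    have i1 := (hu.heat ε).integrable (μ s)
    have i2 := hu.integrable (μ s)
    have i3 : Integrable (fun x => ε * Laplacian.laplacian u x) (μ s) :=
      (hu.laplacian.integrable (μ s)).const_mul ε
    have i4 : Integrable (fun x => heat ε u x - u x) (μ s) := i1.sub i2
    rw [← integral_const_mul, ← MeasureTheory.integral_sub i1 i2,
      ← MeasureTheory.integral_sub i4 i3, ← Real.norm_eq_abs]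
    refine (norm_integral_le_of_norm_le_const (C := η / 2 * ε) (Eventually.of_forall fun x =>
      (hheat u B hu hBu ε hε.le x).trans ?_)).trans (by simp)
    have hsq : √ε ≤ η / (2 * (C * B + 1)) :=
      Real.sqrt_le_iff.2 ⟨by positivity, (hεδ.trans_le (min_le_right _ _)).le⟩
    have e : √ε ^ 3 = ε * √ε := by rw [pow_succ, Real.sq_sqrt hε.le]
    rw [e]
    have : C * B * √ε ≤ η / 2 := by
      refine (mul_le_mul_of_nonneg_left hsq (by positivity)).trans ?_
      rw [mul_div_assoc', div_le_div_iff₀ (by positivity) two_pos]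
      have : 0 ≤ C * B := by positivity
      nlinarith
    nlinarith
  rw [abs_le] at e2 e3 ⊢
  constructor <;> linarith [e2.1, e2.2, e3.1, e3.2]

/-- Telescoping over a uniform subdivision, with an error `η ε` per step of length `ε`. -/
lemma sub_le_integral_of_steps {a ε η : ℝ} (hε : 0 ≤ ε) {n : ℕ} {G : ℝ → ℝ} {x : ℕ → ℝ}
    (hG : IntervalIntegrable G volume a (a + n * ε))
    (h : ∀ k < n, x (k + 1) - x k ≤ (∫ r in (a + k * ε)..(a + (k + 1) * ε), G r) + η * ε) :
    x n - x 0 ≤ (∫ r in a..(a + n * ε), G r) + η * (n * ε) := by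
  rw [← Finset.sum_range_sub]
  refine (Finset.sum_le_sum fun k hk => h k (Finset.mem_range.1 hk)).trans (le_of_eq ?_)
  rw [Finset.sum_add_distrib]
  have := intervalIntegral.sum_integral_adjacent_intervals (f := G) (μ := volume)
    (a := fun k : ℕ => a + k * ε) (n := n) fun k hk => by
      refine hG.mono_set ?_
      rw [uIcc_of_le (by push_cast; nlinarith),
        uIcc_of_le (by nlinarith [(Nat.cast_nonneg n : (0:ℝ) ≤ n)])]
      refine Icc_subset_Icc (by nlinarith [(Nat.cast_nonneg k : (0:ℝ) ≤ k)]) ?_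
      have : ((k + 1 : ℕ) : ℝ) ≤ n := by exact_mod_cast hk
      nlinarith
  push_cast at this
  rw [this]
  simp
  ring

lemma exists_nat_step_lt {h δ : ℝ} (hδ : 0 < δ) : ∃ n : ℕ, 0 < n ∧ h / n < δ := by
  obtain ⟨n, hn⟩ := exists_nat_gt (max 0 (h / δ))
  have h0 : (0 : ℝ) < n := (le_max_left _ _).trans_lt hn
  refine ⟨n, by exact_mod_cast h0, ?_⟩
  rw [div_lt_iff₀ h0, mul_comm, ← div_lt_iff₀ hδ]
  exact (le_max_right _ _).trans_lt hn

lemma norm_fderiv_heat_le_of_le {u : Sp d → ℝ} (hu : IsTest u) {M : ℝ}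
    (hM : ∀ x, ‖fderiv ℝ u x‖ ≤ M) (τ : ℝ) (x : Sp d) : ‖fderiv ℝ (heat τ u) x‖ ≤ M := by
  rw [hu.fderiv_heat]
  exact norm_heat_le hM τ x

/-- Gradient bounds transfer from a continuous to a discretized heat flow. -/
lemma norm_fderiv_le_of_heat {u : Sp d → ℝ} {C B : ℝ}
    (hC : ∀ ε, 0 ≤ ε → ∀ x, ‖fderiv ℝ (heat ε u) x - fderiv ℝ u x‖ ≤ C * B * √ε)
    (hCB : 0 ≤ C * B) {σ ε b : ℝ} (hσ : 0 ≤ σ) (hσε : σ ≤ ε) {x : Sp d}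
    (hb : ‖fderiv ℝ (heat σ u) x‖ ≤ b) : ‖fderiv ℝ u x‖ ≤ b + C * B * √ε := by
  have h1 := hC σ hσ x
  have h2 : C * B * √σ ≤ C * B * √ε := mul_le_mul_of_nonneg_left (Real.sqrt_le_sqrt hσε) hCB
  have h3 := norm_sub_norm_le (fderiv ℝ u x) (fderiv ℝ (heat σ u) x)
  rw [norm_sub_rev] at h3
  linarith

/-- Duhamel's formula, as an inequality: the distance to the heat flow is controlled by the
drift. -/
theorem IsSolution.abs_integral_sub_heat_le (h : IsSolution t₀ T μ₀ μ α) {φ : Sp d → ℝ}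
    (hφ : IsTest φ) {t : ℝ} (ht : t ∈ Ioc t₀ T) {b : ℝ → ℝ}
    (hb : ∀ r ∈ Ioo t₀ t, ∀ x, ‖fderiv ℝ (heat (t - r) φ) x‖ ≤ b r)
    (hab : IntervalIntegrable (fun r => (∫ x, ‖α r x‖ ∂(μ r)) * b r) volume t₀ t) :
    |∫ x, φ x ∂(μ t) - ∫ x, heat (t - t₀) φ x ∂μ₀|
      ≤ ∫ r in t₀..t, (∫ x, ‖α r x‖ ∂(μ r)) * b r := by
  have hT : t₀ ≤ T := ht.1.le.trans ht.2
  obtain ⟨B, hB0, hB⟩ := hφ.exists_derivBound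
  obtain ⟨C, hC, hgrad⟩ := exists_norm_fderiv_heat_sub_le d
  set a : ℝ → ℝ := fun r => ∫ x, ‖α r x‖ ∂(μ r)
  have ha0 : ∀ r, 0 ≤ a r := fun r => integral_nonneg fun x => norm_nonneg _
  have hsub : Ioc t₀ t ⊆ Icc t₀ T := fun r hr => ⟨hr.1.le, hr.2.trans ht.2⟩
  have hI := h.integrableOn_integral hT
  have ha : IntervalIntegrable a volume t₀ t :=
    (intervalIntegrable_iff_integrableOn_Ioc_of_le ht.1.le).2 (hI.2.1.mono_set hsub)
  have hA0 : 0 ≤ ∫ r in t₀..t, a r :=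
    intervalIntegral.integral_nonneg ht.1.le fun r _ => ha0 r
  refine le_of_forall_pos_le_add fun e he => ?_
  -- the discretization below has total error `η (∫ a + (t - t₀)) ≤ e`
  set η := e / ((∫ r in t₀..t, a r) + (t - t₀) + 1) with hη
  have hden : 0 < (∫ r in t₀..t, a r) + (t - t₀) + 1 := by linarith [ht.1]
  have hη0 : 0 < η := by positivity
  obtain ⟨δ, hδ, hstep⟩ := h.exists_step hT hB0 hη0
  obtain ⟨n, hn, hnδ⟩ := exists_nat_step_lt (h := t - t₀)
    (lt_min hδ (by positivity : 0 < (η / (C * B + 1)) ^ 2))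
  set ε := (t - t₀) / n with hε
  have hn' : (0 : ℝ) < n := by exact_mod_cast hn
  have hε0 : 0 < ε := div_pos (by linarith [ht.1]) hn'
  have hnε : n * ε = t - t₀ := by rw [hε]; field_simp
  have hend : t₀ + n * ε = t := by rw [hnε]; ring
  have hCB : C * B * √ε ≤ η := by
    have hsq : √ε ≤ η / (C * B + 1) :=
      Real.sqrt_le_iff.2 ⟨by positivity, (hnδ.trans_le (min_le_right _ _)).le⟩
    refine (mul_le_mul_of_nonneg_left hsq (by positivity)).trans ?_
    rw [mul_div_assoc', div_le_iff₀ (by positivity)]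
    have : 0 ≤ C * B := by positivity
    nlinarith
  -- the backward heat flow of `φ` from time `t`, sampled at the times `t₀ + k ε`: `X k`
  -- interpolates between the two integrals to be compared
  let u : ℕ → Sp d → ℝ := fun k => heat ((n - k) * ε) φ
  let X : ℕ → ℝ := fun k => ∫ x, u k x ∂(μ (t₀ + k * ε))
  have hu : ∀ k, IsTest (u k) := fun k => hφ.heat _
  have hGint : IntervalIntegrable (fun r => a r * b r + η * a r) volume t₀ (t₀ + n * ε) := by
    rw [hend]
    exact hab.add (ha.const_mul η)
  have hstepk : ∀ k < n, |X (k + 1) - X k|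
      ≤ (∫ r in (t₀ + k * ε)..(t₀ + (k + 1) * ε), (a r * b r + η * a r)) + η * ε := by
    intro k hk
    have hk' : (k : ℝ) + 1 ≤ n := by exact_mod_cast hk
    have hk0 : (0 : ℝ) ≤ k := Nat.cast_nonneg k
    have hle : t₀ + (k : ℝ) * ε ≤ t₀ + (k + 1) * ε := by nlinarith
    have e1 : t₀ + ((k + 1 : ℕ) : ℝ) * ε = t₀ + k * ε + ε := by push_cast; ring
    have e1' : t₀ + ((k : ℝ) + 1) * ε = t₀ + k * ε + ε := by ring
    have hle2 : t₀ + k * ε + ε ≤ t := by rw [← hend]; nlinarith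
    have e2 : heat ε (u (k + 1)) = u k := by
      change heat ε (heat (((n : ℝ) - (k + 1 : ℕ)) * ε) φ) = heat ((n - k) * ε) φ
      rw [heat_heat hφ hε0.le (mul_nonneg (by push_cast; linarith) hε0.le)]
      congr 1
      push_cast
      ring
    have hs := hstep (u (k + 1)) (hu _) (hB.heat hφ _) (t₀ + k * ε) ε (by nlinarith) hε0
      (hnδ.trans_le (min_le_left _ _)) (hle2.trans ht.2)
    rw [e2] at hs
    have hsub' : Ioc (t₀ + k * ε) (t₀ + k * ε + ε) ⊆ Ioc t₀ t := fun r hr =>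
      ⟨lt_of_le_of_lt (by nlinarith) hr.1, hr.2.trans hle2⟩
    have hd : |∫ r in (t₀ + k * ε)..(t₀ + k * ε + ε),
        ∫ x, ⟪α r x, gradient (u (k + 1)) x⟫_ℝ ∂(μ r)|
        ≤ ∫ r in (t₀ + k * ε)..(t₀ + k * ε + ε), (a r * b r + η * a r) := by
      rw [← Real.norm_eq_abs]
      have hGk : IntervalIntegrable (fun r => a r * b r + η * a r) volume
          (t₀ + k * ε) (t₀ + k * ε + ε) := by
        rw [intervalIntegrable_iff_integrableOn_Ioc_of_le (by linarith)]
        rw [hend, intervalIntegrable_iff_integrableOn_Ioc_of_le ht.1.le] at hGint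
        exact hGint.mono_set hsub'
      refine intervalIntegral.norm_integral_le_of_norm_le (by linarith) ?_ hGk
      have hae := hI.1
      rw [ae_restrict_iff' measurableSet_Icc] at hae
      have hne : ∀ᵐ r : ℝ, r ≠ t₀ + k * ε + ε := by
        simp [ae_iff, measure_singleton]
      filter_upwards [hae, hne] with r hr hrne hrm
      have hrI := hr (hsub (hsub' hrm))
      have := h.prob (hsub (hsub' hrm))
      have hrlt : r < t₀ + k * ε + ε := lt_of_le_of_ne hrm.2 hrne
      have hgb : ∀ x, ‖gradient (u (k + 1)) x‖ ≤ b r + η := by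
        intro x
        rw [norm_gradient]
        have hσ0 : 0 ≤ t₀ + k * ε + ε - r := by linarith
        refine (norm_fderiv_le_of_heat (fun ε' hε' x =>
          hgrad (u (k + 1)) B (hu _) (hB.heat hφ _) ε' hε' x) (by positivity) hσ0
          (by linarith [hrm.1] : t₀ + k * ε + ε - r ≤ ε) (b := b r) ?_).trans
          (by linarith)
        have e3 : heat (t₀ + k * ε + ε - r) (u (k + 1)) = heat (t - r) φ := by
          change heat _ (heat (((n : ℝ) - (k + 1 : ℕ)) * ε) φ) = _
          rw [heat_heat hφ hσ0 (mul_nonneg (by push_cast; linarith) hε0.le)]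
          congr 1
          rw [← hend]
          push_cast
          ring
        rw [e3]
        exact hb r ⟨(hsub' hrm).1, hrlt.trans_le hle2⟩ x
      have hi : Integrable (fun x => ‖α r x‖ * (b r + η)) (μ r) := hrI.norm.mul_const _
      refine (norm_integral_le_of_norm_le hi (Eventually.of_forall fun x =>
        (norm_inner_le_norm _ _).trans (mul_le_mul_of_nonneg_left (hgb x) (norm_nonneg _)))).trans
        (le_of_eq ?_)
      rw [integral_mul_const]
      change a r * (b r + η) = _
      ring
    change |∫ x, u (k + 1) x ∂(μ (t₀ + (k + 1 : ℕ) * ε)) - ∫ x, u k x ∂(μ (t₀ + k * ε))| ≤ _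
    rw [e1, e1']
    rw [abs_le] at hs hd ⊢
    constructor <;> linarith [hs.1, hs.2, hd.1, hd.2]
  have hup := sub_le_integral_of_steps hε0.le (x := X) (η := η) hGint
    fun k hk => (le_abs_self _).trans (hstepk k hk)
  have hdown := sub_le_integral_of_steps hε0.le (x := fun k => -X k) (η := η) hGint
    fun k hk => (by linarith [neg_abs_le (X (k + 1) - X k), hstepk k hk])
  have hX0 : X 0 = ∫ x, heat (t - t₀) φ x ∂μ₀ := by
    simp only [X, u, Nat.cast_zero, sub_zero, zero_mul, add_zero, hnε, h.initial]
  have hXn : X n = ∫ x, φ x ∂(μ t) := by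
    simp only [X, u, sub_self, zero_mul, hend, heat_zero φ hφ.continuous]
  have hsplit : ∫ r in t₀..t, (a r * b r + η * a r)
      = (∫ r in t₀..t, a r * b r) + η * ∫ r in t₀..t, a r := by
    rw [intervalIntegral.integral_add hab (ha.const_mul η), intervalIntegral.integral_const_mul]
  rw [hend, hX0, hXn, hnε, hsplit] at hup hdown
  have hfin : η * (∫ r in t₀..t, a r) + η * (t - t₀) ≤ e := by
    rw [← mul_add, hη, div_mul_eq_mul_div, div_le_iff₀ hden]
    nlinarith
  rw [abs_le]
  constructor <;> linarith

end Duhamel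

/-! ### Absolute continuity of the solution and the pointwise bound on the drift -/

section AbsolutelyContinuous

variable {d : ℕ} {t₀ T : ℝ} {μ₀ : Measure (Sp d)} {μ : ℝ → Measure (Sp d)}
  {α : ℝ → Sp d → Sp d}

/-- The rate `1 / √(2 τ)` of the gradient bound for the heat flow at time `τ`. -/
def heatRate (τ : ℝ) : ℝ := 1 / √(2 * τ)

lemma heatRate_nonneg (τ : ℝ) : 0 ≤ heatRate τ := by unfold heatRate; positivity

lemma measurable_heatRate : Measurable heatRate := by unfold heatRate; fun_prop

lemma heatRate_eq {τ : ℝ} (hτ : 0 ≤ τ) : heatRate τ = (√2)⁻¹ * τ ^ (-(1 / 2) : ℝ) := by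
  rw [heatRate, Real.sqrt_mul (by norm_num), Real.sqrt_eq_rpow τ, Real.rpow_neg hτ]
  simp [mul_comm]

lemma intervalIntegrable_heatRate {h : ℝ} (hh : 0 ≤ h) :
    IntervalIntegrable heatRate volume 0 h := by
  have := (intervalIntegral.intervalIntegrable_rpow' (a := 0) (b := h)
    (r := (-(1 / 2) : ℝ)) (by norm_num)).const_mul (√2)⁻¹
  refine this.congr fun τ hτ => ?_
  rw [uIoc_of_le hh] at hτ
  exact (heatRate_eq hτ.1.le).symm

lemma integral_heatRate {h : ℝ} (hh : 0 ≤ h) : ∫ τ in (0 : ℝ)..h, heatRate τ = √(2 * h) := by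
  have : ∫ τ in (0 : ℝ)..h, heatRate τ = ∫ τ in (0 : ℝ)..h, (√2)⁻¹ * τ ^ (-(1 / 2) : ℝ) := by
    refine intervalIntegral.integral_congr fun τ hτ => ?_
    rw [uIcc_of_le hh] at hτ
    exact heatRate_eq hτ.1
  rw [this, intervalIntegral.integral_const_mul, integral_rpow (Or.inl (by norm_num)),
    Real.sqrt_mul (by norm_num), Real.sqrt_eq_rpow h]
  norm_num
  have h2 : √2 * √2 = 2 := Real.mul_self_sqrt (by norm_num)
  field_simp
  linear_combination (-(h ^ (1 / 2 : ℝ))) * h2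

lemma norm_fderiv_heat_le_heatRate {u : Sp d → ℝ} (hu : IsTest u) {M : ℝ} (hM : ∀ x, |u x| ≤ M)
    {τ : ℝ} (hτ : 0 < τ) (x : Sp d) : ‖fderiv ℝ (heat τ u) x‖ ≤ M * heatRate τ :=
  (norm_fderiv_heat_le hu hM hτ x).trans (by rw [heatRate, mul_one_div])

lemma intervalIntegrable_heatRate_sub {t : ℝ} (ht : t₀ ≤ t) :
    IntervalIntegrable (fun r => heatRate (t - r)) volume t₀ t := by
  have := (intervalIntegrable_heatRate (sub_nonneg.2 ht)).comp_sub_left t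
  simpa using this.symm

lemma integral_heatRate_sub {t : ℝ} (ht : t₀ ≤ t) :
    ∫ r in t₀..t, heatRate (t - r) = √(2 * (t - t₀)) := by
  rw [intervalIntegral.integral_comp_sub_left, sub_self, integral_heatRate (sub_nonneg.2 ht)]

/-- Smooth bumps of small integral around a compact null set. -/
lemma exists_bump_of_null {K : Set (Sp d)} (hK : IsCompact K) (h0 : volume K = 0) {e : ℝ}
    (he : 0 < e) : ∃ φ : Sp d → ℝ, ContDiff ℝ ∞ φ ∧ HasCompactSupport φ ∧
      (∀ x, 0 ≤ φ x ∧ φ x ≤ 1) ∧ (∀ x ∈ K, φ x = 1) ∧ ∫ x, |φ x| ≤ e := by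
  obtain ⟨U, hKU, hU, hUe⟩ := K.exists_isOpen_lt_of_lt (μ := volume) (ENNReal.ofReal e)
    (by rw [h0]; exact ENNReal.ofReal_pos.2 he)
  obtain ⟨R, hR⟩ := hK.isBounded.subset_ball (0 : Sp d)
  set V := U ∩ Metric.ball (0 : Sp d) R
  have hV : IsOpen V := hU.inter Metric.isOpen_ball
  have hVe : volume V < ENNReal.ofReal e := (measure_mono inter_subset_left).trans_lt hUe
  obtain ⟨f, hf0, hf1, hf⟩ := exists_contMDiffMap_zero_one_of_isClosed (n := (⊤ : ℕ∞))
    (modelWithCornersSelf ℝ (Sp d)) hV.isClosed_compl hK.isClosed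
    (disjoint_left.2 fun x hx hxK => hx ⟨hKU hxK, hR hxK⟩)
  have hcont : ContDiff ℝ ∞ f := f.contMDiff.contDiff
  have hsupp : ∀ x, x ∉ V → f x = 0 := fun x hx => hf0 hx
  refine ⟨f, hcont, ?_, fun x => hf x, fun x hx => hf1 hx, ?_⟩
  · refine HasCompactSupport.of_support_subset_isCompact (isCompact_closedBall (0 : Sp d) R)
      fun x hx => ?_
    by_contra hcon
    exact hx (hsupp x fun hV' => hcon (Metric.ball_subset_closedBall hV'.2))
  · have hle : ∀ x, |f x| ≤ V.indicator (fun _ => (1 : ℝ)) x := by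
      intro x
      by_cases hx : x ∈ V
      · rw [indicator_of_mem hx, abs_of_nonneg (hf x).1]
        exact (hf x).2
      · rw [indicator_of_notMem hx, hsupp x hx, abs_zero]
    have hi : Integrable (V.indicator (fun _ => (1 : ℝ))) (volume : Measure (Sp d)) :=
      (integrable_indicator_iff hV.measurableSet).2
        (integrableOn_const hVe.ne_top (by simp))
    refine (integral_mono_of_nonneg (Eventually.of_forall fun x => abs_nonneg _) hi
      (Eventually.of_forall hle)).trans ?_
    rw [integral_indicator hV.measurableSet]
    simp only [integral_const, smul_eq_mul, mul_one, measureReal_restrict_apply_univ]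
    exact (ENNReal.toReal_lt_of_lt_ofReal hVe).le

/-- The gradient of the heat flow at times `τ ≥ σ` is controlled by the `L¹` norm. -/
lemma exists_norm_fderiv_heat_le_integral (d : ℕ) {σ : ℝ} (hσ : 0 < σ) :
    ∃ K, 0 ≤ K ∧ ∀ u : Sp d → ℝ, IsTest u → Integrable u → ∀ τ, σ ≤ τ → ∀ x,
      ‖fderiv ℝ (heat τ u) x‖ ≤ K * ∫ y, |u y| := by
  obtain ⟨K, hK, h⟩ := exists_abs_heat_le d (half_pos hσ)
  refine ⟨K * heatRate (σ / 2), mul_nonneg hK (heatRate_nonneg _), fun u hu hi τ hτ x => ?_⟩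
  have e : heat τ u = heat (τ - σ) (heat (σ / 2) (heat (σ / 2) u)) := by
    rw [heat_heat hu (by linarith) (by linarith), heat_heat hu (by linarith) (by linarith)]
    congr 1
    ring
  rw [e]
  refine norm_fderiv_heat_le_of_le ((hu.heat _).heat _) (fun y => ?_) _ x
  refine (norm_fderiv_heat_le_heatRate (hu.heat _) (h u hu.continuous hi) (half_pos hσ) y).trans
    (le_of_eq (by ring))

/-- If the drift is integrable against the heat rate at time `t`, then the solution at time `t`
has a density: the heat flow of bumps around a null set is small. -/
lemma IsSolution.absolutelyContinuous_of_intervalIntegrable (h : IsSolution t₀ T μ₀ μ α) {t : ℝ}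
    (ht : t ∈ Ioc t₀ T)
    (hi : IntervalIntegrable (fun r => (∫ x, ‖α r x‖ ∂(μ r)) * heatRate (t - r)) volume t₀ t) :
    μ t ≪ volume := by
  have hprob := h.prob ⟨ht.1.le, ht.2⟩
  have hp0 : IsProbabilityMeasure μ₀ := by
    rw [← h.initial]
    exact h.prob ⟨le_rfl, ht.1.le.trans ht.2⟩
  have hT : t₀ ≤ T := ht.1.le.trans ht.2
  set a : ℝ → ℝ := fun r => ∫ x, ‖α r x‖ ∂(μ r)
  have ha0 : ∀ r, 0 ≤ a r := fun r => integral_nonneg fun x => norm_nonneg _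
  have ham : AEStronglyMeasurable a (volume.restrict (uIoc t₀ t)) := by
    rw [uIoc_of_le ht.1.le]
    exact ((h.integrableOn_integral hT).2.1.mono_set
      (fun r hr => ⟨hr.1.le, hr.2.trans ht.2⟩)).aestronglyMeasurable
  refine Measure.AbsolutelyContinuous.mk fun N hN hN0 => ?_
  rw [hN.measure_eq_iSup_isCompact]
  simp only [ENNReal.iSup_eq_zero]
  intro K hKN hK
  have hK0 : volume K = 0 := measure_mono_null hKN hN0
  let σ : ℕ → ℝ := fun j => 1 / ((j : ℝ) + 1)
  have hσ : ∀ j, 0 < σ j := fun j => by positivity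
  have hσ0 : Tendsto σ atTop (𝓝 0) := tendsto_one_div_add_atTop_nhds_zero_nat
  have hφ : ∀ j, ∃ φ : Sp d → ℝ, IsTest φ ∧ (∀ x, 0 ≤ φ x ∧ φ x ≤ 1) ∧ (∀ x ∈ K, φ x = 1) ∧
      (∀ x, |heat (t - t₀) φ x| ≤ σ j) ∧
      ∀ τ, σ j ≤ τ → ∀ x, ‖fderiv ℝ (heat τ φ) x‖ ≤ σ j := by
    intro j
    obtain ⟨C₁, hC₁, h1⟩ := exists_norm_fderiv_heat_le_integral d (hσ j)
    obtain ⟨C₂, hC₂, h2⟩ := exists_abs_heat_le d (sub_pos.2 ht.1)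
    obtain ⟨φ, hφ, hc, hφ01, hφK, hφi⟩ := exists_bump_of_null hK hK0
      (div_pos (hσ j) (by positivity : 0 < C₁ + C₂ + 1))
    have hφt := IsTest.of_hasCompactSupport hφ hc
    have hint := hφ.continuous.integrable_of_hasCompactSupport (μ := volume) hc
    rw [le_div_iff₀ (by positivity)] at hφi
    have hφ0 : 0 ≤ ∫ x, |φ x| := integral_nonneg fun x => abs_nonneg _
    refine ⟨φ, hφt, hφ01, hφK, fun x => (h2 φ hφ.continuous hint x).trans ?_,
      fun τ hτ x => (h1 φ hφt hint τ hτ x).trans ?_⟩ <;> nlinarith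
  choose φ hφt hφ01 hφK hφh hφg using hφ
  -- a gradient bound for the backward flow of `φ j`: of size `σ j` away from `t`, and dominated by
  -- the heat rate since `0 ≤ φ j ≤ 1`
  let b : ℕ → ℝ → ℝ := fun j r =>
    if r ≤ t - σ j then min (heatRate (t - r)) (σ j) else heatRate (t - r)
  have hb0 : ∀ j r, 0 ≤ b j r := by
    intro j r
    simp only [b]
    split_ifs
    · exact le_min (heatRate_nonneg _) (hσ j).le
    · exact heatRate_nonneg _
  have hble : ∀ j r, b j r ≤ heatRate (t - r) := by
    intro j r
    simp only [b]
    split_ifs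
    · exact min_le_left _ _
    · exact le_rfl
  have hbm : ∀ j, Measurable (b j) := by
    intro j
    have hm : Measurable fun r => heatRate (t - r) :=
      measurable_heatRate.comp (measurable_const.sub measurable_id)
    exact Measurable.ite measurableSet_Iic (hm.min measurable_const) hm
  have hbound : ∀ j r, ‖a r * b j r‖ ≤ a r * heatRate (t - r) := by
    intro j r
    rw [Real.norm_of_nonneg (mul_nonneg (ha0 r) (hb0 j r))]
    exact mul_le_mul_of_nonneg_left (hble j r) (ha0 r)
  have hab : ∀ j, IntervalIntegrable (fun r => a r * b j r) volume t₀ t := by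
    intro j
    refine hi.mono_fun (ham.mul (hbm j).aestronglyMeasurable) (Eventually.of_forall fun r => ?_)
    exact (hbound j r).trans (le_abs_self _)
  have hlim : Tendsto (fun j => σ j + ∫ r in t₀..t, a r * b j r) atTop (𝓝 (0 + 0)) := by
    refine hσ0.add ?_
    have := intervalIntegral.tendsto_integral_filter_of_dominated_convergence
      (F := fun j r => a r * b j r) (f := fun _ => 0) (l := atTop) (μ := volume) (a := t₀) (b := t)
      (fun r => a r * heatRate (t - r))
      (Eventually.of_forall fun j => ham.mul (hbm j).aestronglyMeasurable)
      (Eventually.of_forall fun j => Eventually.of_forall fun r _ => hbound j r) hi ?_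
    · simpa using this
    · have hne : ∀ᵐ r : ℝ, r ≠ t := by simp [ae_iff, measure_singleton]
      filter_upwards [hne] with r hr hrm
      rw [uIoc_of_le ht.1.le] at hrm
      have hrt : 0 < t - r := sub_pos.2 (lt_of_le_of_ne hrm.2 hr)
      have : Tendsto (fun j => b j r) atTop (𝓝 0) := by
        refine tendsto_of_tendsto_of_tendsto_of_le_of_le' tendsto_const_nhds hσ0
          (Eventually.of_forall fun j => hb0 j r) ?_
        filter_upwards [hσ0.eventually_lt_const hrt] with j hj
        simp only [b]
        rw [if_pos (by linarith)]
        exact min_le_right _ _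
      simpa using this.const_mul (a r)
  rw [add_zero] at hlim
  have hle : ∀ j, (μ t).real K ≤ σ j + ∫ r in t₀..t, a r * b j r := by
    intro j
    have h1 : (μ t).real K ≤ ∫ x, φ j x ∂(μ t) := by
      rw [← integral_indicator_one hK.measurableSet]
      refine integral_mono ((integrable_const (1 : ℝ)).indicator hK.measurableSet)
        ((hφt j).integrable _) fun x => ?_
      by_cases hx : x ∈ K
      · simp [hx, hφK j x hx]
      · simp [hx, (hφ01 j x).1]
    have h2 := h.abs_integral_sub_heat_le (hφt j) ht (b := b j) (fun r hr x => ?_) (hab j)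
    · have h3 : |∫ x, heat (t - t₀) (φ j) x ∂μ₀| ≤ σ j := by
        rw [← Real.norm_eq_abs]
        exact (norm_integral_le_of_norm_le_const (Eventually.of_forall (hφh j))).trans (by simp)
      linarith [(abs_le.1 h2).2, (abs_le.1 h3).2]
    · have hg : ‖fderiv ℝ (heat (t - r) (φ j)) x‖ ≤ heatRate (t - r) :=
        (norm_fderiv_heat_le_heatRate (hφt j) (M := 1) (fun y => by
          rw [abs_of_nonneg (hφ01 j y).1]; exact (hφ01 j y).2) (sub_pos.2 hr.2) x).trans
          (one_mul _).le
      simp only [b]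
      split_ifs with hc
      · exact le_min hg (hφg j _ (by linarith) x)
      · exact hg
  have := ge_of_tendsto' hlim hle
  rw [← measureReal_eq_zero_iff]
  exact le_antisymm this measureReal_nonneg

/-- At almost every time the solution has a density. -/
theorem IsSolution.ae_absolutelyContinuous (hT : t₀ ≤ T) (h : IsSolution t₀ T μ₀ μ α) :
    ∀ᵐ t : ℝ, t ∈ Ioc t₀ T → μ t ≪ volume := by
  set a : ℝ → ℝ := fun r => ∫ x, ‖α r x‖ ∂(μ r)
  have ha : Integrable ((Ioc t₀ T).indicator a) := by
    rw [integrable_indicator_iff measurableSet_Ioc]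
    exact (h.integrableOn_integral hT).2.1.mono_set Ioc_subset_Icc_self
  have hk : Integrable ((Ioc 0 (T - t₀)).indicator heatRate) := by
    rw [integrable_indicator_iff measurableSet_Ioc,
      ← intervalIntegrable_iff_integrableOn_Ioc_of_le (sub_nonneg.2 hT)]
    exact intervalIntegrable_heatRate (sub_nonneg.2 hT)
  -- the convolution of two integrable functions is finite almost everywhere
  filter_upwards [ha.ae_convolution_exists (ContinuousLinearMap.mul ℝ ℝ) hk] with t ht htm
  refine h.absolutelyContinuous_of_intervalIntegrable htm ?_
  rw [intervalIntegrable_iff_integrableOn_Ioo_of_le htm.1.le]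
  refine (Integrable.integrableOn (s := Ioo t₀ t) ht).congr_fun (fun r hr => ?_) measurableSet_Ioo
  have h1 : r ∈ Ioc t₀ T := ⟨hr.1, hr.2.le.trans htm.2⟩
  have h2 : t - r ∈ Ioc 0 (T - t₀) := ⟨by linarith [hr.2], by linarith [hr.1, htm.2]⟩
  simp [h1, h2, a]

/-- The Lebesgue essential bound on the drift holds almost everywhere for the solution. -/
theorem IsSolution.ae_norm_le (hT : t₀ ≤ T) (h : IsSolution t₀ T μ₀ μ α)
    (hA : supNorm t₀ T α < ⊤) : ∀ᵐ t : ℝ, t ∈ Ioc t₀ T →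
      (∀ᵐ x, ‖α t x‖ ≤ (supNorm t₀ T α).toReal) ∧
      (∀ᵐ x ∂(μ t), ‖α t x‖ ≤ (supNorm t₀ T α).toReal) := by
  have h1 : ∀ᵐ p ∂((volume : Measure (ℝ × Sp d)).restrict (Icc t₀ T ×ˢ univ)),
      ‖Function.uncurry α p‖ ≤ (supNorm t₀ T α).toReal := by
    have := ae_le_eLpNormEssSup (f := Function.uncurry α)
      (μ := (volume : Measure (ℝ × Sp d)).restrict (Icc t₀ T ×ˢ univ))
    filter_upwards [this] with p hp
    rw [← eLpNorm_exponent_top] at hp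
    have h2 := ENNReal.toReal_mono hA.ne hp
    simpa using h2
  rw [Measure.volume_eq_prod, ← Measure.prod_restrict] at h1
  have h2 := Measure.ae_ae_of_ae_prod h1
  rw [Measure.restrict_univ, ae_restrict_iff' measurableSet_Icc] at h2
  filter_upwards [h2, h.ae_absolutelyContinuous hT] with t h3 h4 ht
  have := h3 (Ioc_subset_Icc_self ht)
  exact ⟨this, (h4 ht).ae_le this⟩

lemma IsSolution.ae_integral_norm_le (hT : t₀ ≤ T) (h : IsSolution t₀ T μ₀ μ α)
    (hA : supNorm t₀ T α < ⊤) : ∀ᵐ t : ℝ, t ∈ Ioc t₀ T →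
      ∫ x, ‖α t x‖ ∂(μ t) ≤ (supNorm t₀ T α).toReal := by
  filter_upwards [h.ae_norm_le hT hA] with t ht htm
  have := h.prob (Ioc_subset_Icc_self htm)
  refine (integral_mono_of_nonneg (Eventually.of_forall fun x => norm_nonneg _)
    (integrable_const _) (ht htm).2).trans (by simp)

end AbsolutelyContinuous

/-! ### Continuity in total variation at the initial time -/

section TotalVariation

variable {d : ℕ} {t₀ T : ℝ} {μ₀ : Measure (Sp d)} {μ : ℝ → Measure (Sp d)}
  {α : ℝ → Sp d → Sp d}

/-- `FisherBound` with the optimal Young parameter for a gradient bounded by `m`. -/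
lemma FisherBound.abs_integral_laplacian_le {J : ℝ} (hJ : 0 < J) [IsProbabilityMeasure μ₀]
    (h : FisherBound J μ₀) {u : Sp d → ℝ} (hu : IsTest u) {m : ℝ} (hm : 0 < m)
    (hgrad : ∀ x, ‖fderiv ℝ u x‖ ≤ m) : |∫ x, Laplacian.laplacian u x ∂μ₀| ≤ J * m := by
  refine (h u hu (m / (2 * J)) (by positivity)).trans ?_
  have : ∫ x, ‖gradient u x‖ ^ 2 ∂μ₀ ≤ m ^ 2 := by
    refine (integral_mono_of_nonneg (Eventually.of_forall fun x => by positivity)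
      (integrable_const (m ^ 2)) (Eventually.of_forall fun x => ?_)).trans (by simp)
    exact pow_le_pow_left₀ (norm_nonneg _) ((norm_gradient u x).le.trans (hgrad x)) 2
  refine (add_le_add_right (mul_le_mul_of_nonneg_left this (by positivity)) _).trans (le_of_eq ?_)
  field_simp
  ring

/-- A measure with finite Fisher information moves slowly in total variation along the heat
flow. -/
lemma FisherBound.abs_integral_heat_sub_le {J : ℝ} (hJ : 0 < J) [IsProbabilityMeasure μ₀]
    (h : FisherBound J μ₀) {φ : Sp d → ℝ} (hφ : IsTest φ) {M : ℝ} (hM : ∀ x, |φ x| ≤ M)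
    {τ : ℝ} (hτ : 0 < τ) :
    |∫ x, heat τ φ x ∂μ₀ - ∫ x, φ x ∂μ₀| ≤ J * M * √(2 * τ) := by
  have hM0 : 0 ≤ M := (abs_nonneg _).trans (hM 0)
  obtain ⟨B, hB0, hB⟩ := hφ.exists_derivBound
  obtain ⟨C, hC, hgrad⟩ := exists_norm_fderiv_heat_sub_le d
  obtain ⟨C', hC', hheat⟩ := exists_heat_sub_laplacian_le d
  refine le_of_forall_pos_le_add fun e he => ?_
  set η := e / (2 * τ * (J + 1)) with hη
  have hη0 : 0 < η := by positivity
  obtain ⟨n, hn, hnδ⟩ := exists_nat_step_lt (h := τ)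
    (by positivity : 0 < (η / (2 * (C * B + C' * B + 1))) ^ 2)
  set ε := τ / n with hε
  have hn' : (0 : ℝ) < n := by exact_mod_cast hn
  have hε0 : 0 < ε := div_pos hτ hn'
  have hnε : n * ε = τ := by rw [hε]; field_simp
  have hsq : √ε ≤ η / (2 * (C * B + C' * B + 1)) :=
    Real.sqrt_le_iff.2 ⟨by positivity, hnδ.le⟩
  have hCB0 : 0 ≤ C * B := by positivity
  have hCB0' : 0 ≤ C' * B := by positivity
  have hη2 : (C * B + C' * B + 1) * √ε ≤ η / 2 := by
    refine (mul_le_mul_of_nonneg_left hsq (by positivity)).trans (le_of_eq ?_)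
    field_simp
  have hs0 : 0 ≤ √ε := Real.sqrt_nonneg _
  let u : ℕ → Sp d → ℝ := fun k => heat (k * ε) φ
  let X : ℕ → ℝ := fun k => ∫ x, u k x ∂μ₀
  have hu : ∀ k, IsTest (u k) := fun k => hφ.heat _
  have hb : IntervalIntegrable heatRate volume 0 τ := intervalIntegrable_heatRate hτ.le
  have hGint : IntervalIntegrable (fun r => J * (M * heatRate r + η)) volume 0 (0 + n * ε) := by
    rw [hnε, zero_add]
    exact ((hb.const_mul M).add intervalIntegrable_const).const_mul J
  have hstep : ∀ k < n, |X (k + 1) - X k|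
      ≤ (∫ r in (0 + k * ε)..(0 + (k + 1) * ε), J * (M * heatRate r + η)) + η * ε := by
    intro k hk
    have hk' : (k : ℝ) + 1 ≤ n := by exact_mod_cast hk
    have hk0 : (0 : ℝ) ≤ k := Nat.cast_nonneg k
    have hle : 0 + (k : ℝ) * ε ≤ 0 + (k + 1) * ε := by nlinarith
    have hGk : IntervalIntegrable (fun r => J * (M * heatRate r + η)) volume
        (0 + k * ε) (0 + (k + 1) * ε) := by
      refine hGint.mono_set ?_
      rw [uIcc_of_le hle, uIcc_of_le (by nlinarith)]
      exact Icc_subset_Icc (by nlinarith) (by nlinarith)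
    have e2 : heat ε (u k) = u (k + 1) := by
      change heat ε (heat (k * ε) φ) = heat ((k + 1 : ℕ) * ε) φ
      rw [heat_heat hφ hε0.le (by positivity)]
      congr 1
      push_cast
      ring
    have h1 : ε * |∫ x, Laplacian.laplacian (u k) x ∂μ₀|
        ≤ ∫ r in (0 + k * ε)..(0 + (k + 1) * ε), J * (M * heatRate r + η) := by
      have : ε * |∫ x, Laplacian.laplacian (u k) x ∂μ₀|
          = ∫ r in (0 + k * ε)..(0 + (k + 1) * ε), |∫ x, Laplacian.laplacian (u k) x ∂μ₀| := by
        rw [intervalIntegral.integral_const, smul_eq_mul]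
        ring
      rw [this]
      refine intervalIntegral.integral_mono_on_of_le_Ioo hle intervalIntegrable_const hGk
        fun r hr => ?_
      have hr0 : 0 < r := lt_of_le_of_lt (by positivity) hr.1
      refine h.abs_integral_laplacian_le hJ (hu k)
        (by have := mul_nonneg hM0 (heatRate_nonneg r); linarith) fun x => ?_
      refine (norm_fderiv_le_of_heat (fun ε' hε' x =>
          hgrad (u k) B (hu _) (hB.heat hφ _) ε' hε' x) hCB0
          (by linarith [hr.1] : 0 ≤ r - k * ε) (by linarith [hr.2] : r - k * ε ≤ ε)
          (b := M * heatRate r) ?_).trans (by nlinarith)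
      have e3 : heat (r - k * ε) (u k) = heat r φ := by
        change heat _ (heat (k * ε) φ) = _
        rw [heat_heat hφ (by linarith [hr.1]) (by positivity)]
        congr 1
        ring
      rw [e3]
      exact norm_fderiv_heat_le_heatRate hφ hM hr0 x
    have h2 : |∫ x, heat ε (u k) x ∂μ₀ - ∫ x, u k x ∂μ₀
        - ε * ∫ x, Laplacian.laplacian (u k) x ∂μ₀| ≤ η * ε := by
      have i1 := ((hu k).heat ε).integrable μ₀
      have i2 := (hu k).integrable μ₀
      have i3 : Integrable (fun x => ε * Laplacian.laplacian (u k) x) μ₀ :=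
        ((hu k).laplacian.integrable μ₀).const_mul ε
      have i4 : Integrable (fun x => heat ε (u k) x - u k x) μ₀ := i1.sub i2
      rw [← integral_const_mul, ← integral_sub i1 i2, ← integral_sub i4 i3, ← Real.norm_eq_abs]
      refine (norm_integral_le_of_norm_le_const (C := η * ε) (Eventually.of_forall fun x =>
        (hheat _ B (hu k) (hB.heat hφ _) ε hε0.le x).trans ?_)).trans (by simp)
      have e : √ε ^ 3 = ε * √ε := by rw [pow_succ, Real.sq_sqrt hε0.le]
      rw [e]
      have : C' * B * √ε ≤ η := by nlinarith
      nlinarith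
    rw [e2] at h2
    change |∫ x, u (k + 1) x ∂μ₀ - ∫ x, u k x ∂μ₀| ≤ _
    have h3 : |ε * ∫ x, Laplacian.laplacian (u k) x ∂μ₀|
        ≤ ∫ r in (0 + k * ε)..(0 + (k + 1) * ε), J * (M * heatRate r + η) := by
      rwa [abs_mul, abs_of_pos hε0]
    rw [abs_le] at h2 h3 ⊢
    constructor <;> linarith [h2.1, h2.2, h3.1, h3.2]
  have hup := sub_le_integral_of_steps hε0.le (x := X) (η := η) hGint
    fun k hk => (le_abs_self _).trans (hstep k hk)
  have hdown := sub_le_integral_of_steps hε0.le (x := fun k => -X k) (η := η) hGint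
    fun k hk => (by linarith [neg_abs_le (X (k + 1) - X k), hstep k hk])
  have hX0 : X 0 = ∫ x, φ x ∂μ₀ := by
    simp only [X, u, Nat.cast_zero, zero_mul, heat_zero φ hφ.continuous]
  have hXn : X n = ∫ x, heat τ φ x ∂μ₀ := by simp only [X, u, hnε]
  have hint : ∫ r in (0 : ℝ)..τ, J * (M * heatRate r + η) = J * M * √(2 * τ) + J * η * τ := by
    rw [intervalIntegral.integral_const_mul, intervalIntegral.integral_add (hb.const_mul M)
      intervalIntegrable_const, intervalIntegral.integral_const_mul, integral_heatRate hτ.le,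
      intervalIntegral.integral_const]
    simp
    ring
  rw [hnε, zero_add, hX0, hXn, hint] at hup hdown
  have hfin : J * η * τ + η * τ = e / 2 := by
    rw [hη]
    field_simp
  rw [abs_le]
  constructor <;> linarith

lemma IsSolution.abs_integral_sub_heat_le_of_bound (h : IsSolution t₀ T μ₀ μ α)
    (hA : supNorm t₀ T α < ⊤) {φ : Sp d → ℝ} (hφ : IsTest φ) {M : ℝ} (hM : ∀ x, |φ x| ≤ M)
    {t : ℝ} (ht : t ∈ Ioc t₀ T) :
    |∫ x, φ x ∂(μ t) - ∫ x, heat (t - t₀) φ x ∂μ₀|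
      ≤ (supNorm t₀ T α).toReal * M * √(2 * (t - t₀)) := by
  have hT : t₀ ≤ T := ht.1.le.trans ht.2
  have hM0 : 0 ≤ M := (abs_nonneg _).trans (hM 0)
  set A := (supNorm t₀ T α).toReal
  have hb := intervalIntegrable_heatRate_sub (t₀ := t₀) ht.1.le
  have hbM : IntervalIntegrable (fun r => A * (M * heatRate (t - r))) volume t₀ t :=
    (hb.const_mul M).const_mul A
  have hae : ∀ᵐ r : ℝ, r ∈ Ioc t₀ t → (∫ x, ‖α r x‖ ∂(μ r)) * (M * heatRate (t - r))
      ≤ A * (M * heatRate (t - r)) := by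
    filter_upwards [h.ae_integral_norm_le hT hA] with r hr hrm
    exact mul_le_mul_of_nonneg_right (hr ⟨hrm.1, hrm.2.trans ht.2⟩)
      (mul_nonneg hM0 (heatRate_nonneg _))
  have hnn : ∀ r, 0 ≤ (∫ x, ‖α r x‖ ∂(μ r)) * (M * heatRate (t - r)) := fun r =>
    mul_nonneg (integral_nonneg fun x => norm_nonneg _) (mul_nonneg hM0 (heatRate_nonneg _))
  have hab : IntervalIntegrable (fun r => (∫ x, ‖α r x‖ ∂(μ r)) * (M * heatRate (t - r)))
      volume t₀ t := by
    refine hbM.mono_fun ?_ ?_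
    · rw [uIoc_of_le ht.1.le]
      refine ((h.integrableOn_integral hT).2.1.mono_set
        (fun r hr => ⟨hr.1.le, hr.2.trans ht.2⟩)).aestronglyMeasurable.mul ?_
      exact (measurable_const.mul (measurable_heatRate.comp
        (measurable_const.sub measurable_id))).aestronglyMeasurable
    · rw [uIoc_of_le ht.1.le]
      refine (ae_restrict_iff' measurableSet_Ioc).2 ?_
      filter_upwards [hae] with r hr hrm
      rw [Real.norm_of_nonneg (hnn r)]
      exact (hr hrm).trans (le_abs_self _)
  refine (h.abs_integral_sub_heat_le hφ ht (b := fun r => M * heatRate (t - r))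
    (fun r hr x => norm_fderiv_heat_le_heatRate hφ hM (sub_pos.2 hr.2) x) hab).trans ?_
  have : ∫ r in t₀..t, A * (M * heatRate (t - r)) = A * M * √(2 * (t - t₀)) := by
    rw [intervalIntegral.integral_const_mul, intervalIntegral.integral_const_mul,
      integral_heatRate_sub ht.1.le, mul_assoc]
  rw [← this]
  refine intervalIntegral.integral_mono_ae_restrict ht.1.le hab hbM ?_
  rw [Measure.restrict_congr_set Ioc_ae_eq_Icc.symm]
  exact (ae_restrict_iff' measurableSet_Ioc).2 hae

/-- Continuity at the initial time, uniformly over test functions with a given supremum bound: the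
drift contributes through Duhamel's formula, the diffusion through the Fisher information. -/
lemma IsSolution.abs_integral_sub_initial_le (h : IsSolution t₀ T μ₀ μ α)
    (hA : supNorm t₀ T α < ⊤) {J : ℝ} (hJ : 0 < J) (hF : FisherBound J μ₀) {φ : Sp d → ℝ}
    (hφ : IsTest φ) {M : ℝ} (hM : ∀ x, |φ x| ≤ M) {t : ℝ} (ht : t ∈ Ioc t₀ T) :
    |∫ x, φ x ∂(μ t) - ∫ x, φ x ∂μ₀|
      ≤ ((supNorm t₀ T α).toReal + J) * M * √(2 * (t - t₀)) := by
  have hp0 : IsProbabilityMeasure μ₀ := by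
    rw [← h.initial]
    exact h.prob ⟨le_rfl, ht.1.le.trans ht.2⟩
  have h1 := h.abs_integral_sub_heat_le_of_bound hA hφ hM ht
  have h2 := hF.abs_integral_heat_sub_le hJ hφ hM (sub_pos.2 ht.1)
  rw [abs_le] at h1 h2 ⊢
  constructor <;> nlinarith [h1.1, h1.2, h2.1, h2.2]

lemma abs_mollify_normed_le (b : ContDiffBump (0 : Sp d)) {g : Sp d → ℝ} {M : ℝ}
    (hM : ∀ x, |g x| ≤ M) (x : Sp d) : |mollify (b.normed volume) g x| ≤ M := by
  refine (norm_mollify_le hM b.integrable_normed x).trans ?_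
  have : ∫ t, ‖b.normed volume t‖ = 1 := by
    rw [← b.integral_normed (μ := volume)]
    exact integral_congr_ae (Eventually.of_forall fun t =>
      Real.norm_of_nonneg (b.nonneg_normed t))
  rw [this, mul_one]

lemma tendsto_mollify_shrinkingBump {g : Sp d → ℝ} (hg : Continuous g) (x : Sp d) :
    Tendsto (fun j => mollify ((shrinkingBump d j).normed volume) g x) atTop (𝓝 (g x)) := by
  refine (ContDiffBump.convolution_tendsto_right_of_continuous (μ := volume)
    (tendsto_rOut_shrinkingBump d) hg x).congr fun j => ?_
  change ∫ t, _ = ∫ t, _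
  refine integral_congr_ae (Eventually.of_forall fun t => ?_)
  simp [mul_comm]

lemma tendsto_integral_mollify_shrinkingBump {g : Sp d → ℝ} (hg : Continuous g) {M : ℝ}
    (hM : ∀ x, |g x| ≤ M) (m : Measure (Sp d)) [IsFiniteMeasure m] :
    Tendsto (fun j => ∫ x, mollify ((shrinkingBump d j).normed volume) g x ∂m) atTop
      (𝓝 (∫ x, g x ∂m)) :=
  tendsto_integral_of_dominated_convergence (fun _ => M)
    (fun j => (isTest_mollify hg.measurable hM (shrinkingBump d j).contDiff_normed
      (shrinkingBump d j).hasCompactSupport_normed).continuous.aestronglyMeasurable)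
    (integrable_const _) (fun _ => Eventually.of_forall (abs_mollify_normed_le _ hM))
    (Eventually.of_forall (tendsto_mollify_shrinkingBump hg))

/-- Test functions approximate bounded measurable ones in `L¹`, keeping the bound. -/
lemma exists_test_integral_sub_le {m : Measure (Sp d)} [IsFiniteMeasure m] {θ : Sp d → ℝ}
    (hθ : Measurable θ) {M : ℝ} (hM : ∀ x, |θ x| ≤ M) {e : ℝ} (he : 0 < e) :
    ∃ φ : Sp d → ℝ, IsTest φ ∧ (∀ x, |φ x| ≤ M) ∧ ∫ x, |θ x - φ x| ∂m ≤ e := by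
  have hM0 : 0 ≤ M := (abs_nonneg _).trans (hM 0)
  have hθi : Integrable θ m := Integrable.of_bound hθ.aestronglyMeasurable M
    (Eventually.of_forall hM)
  obtain ⟨g, hgc, hg, hgcont, hgi⟩ := hθi.exists_hasCompactSupport_integral_sub_le
    (half_pos he)
  let G : Sp d → ℝ := fun x => max (-M) (min M (g x))
  have hG : Continuous G := by fun_prop
  have hGM : ∀ x, |G x| ≤ M := fun x =>
    abs_le.2 ⟨le_max_left _ _, max_le (by linarith) (min_le_left _ _)⟩
  have hθG : ∀ x, |θ x - G x| ≤ ‖θ x - g x‖ := by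
    intro x
    have h1 := abs_le.1 (hM x)
    have e1 : θ x = max (-M) (min M (θ x)) := by rw [min_eq_right h1.2, max_eq_right h1.1]
    have h2 := abs_max_sub_max_le_max (-M) (min M (θ x)) (-M) (min M (g x))
    have h3 := abs_min_sub_min_le_max M (θ x) M (g x)
    rw [sub_self, abs_zero, max_eq_right (abs_nonneg (min M (θ x) - min M (g x)))] at h2
    rw [sub_self, abs_zero, max_eq_right (abs_nonneg (θ x - g x))] at h3
    rw [← e1] at h2
    exact h2.trans h3
  let φ : ℕ → Sp d → ℝ := fun j => mollify ((shrinkingBump d j).normed volume) G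
  have hφM : ∀ j x, |φ j x| ≤ M := fun j => abs_mollify_normed_le _ hGM
  have hφt : ∀ j, IsTest (φ j) := fun j => isTest_mollify hG.measurable hGM
    (shrinkingBump d j).contDiff_normed (shrinkingBump d j).hasCompactSupport_normed
  have hlim : ∀ x, Tendsto (fun j => φ j x) atTop (𝓝 (G x)) := tendsto_mollify_shrinkingBump hG
  have hint : Tendsto (fun j => ∫ x, |θ x - φ j x| ∂m) atTop (𝓝 (∫ x, |θ x - G x| ∂m)) := by
    refine tendsto_integral_of_dominated_convergence (fun _ => M + M)
      (fun j => (hθ.sub (hφt j).continuous.measurable).abs.aestronglyMeasurable)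
      (integrable_const _) (fun j => Eventually.of_forall fun x => ?_)
      (Eventually.of_forall fun x => ((hlim x).const_sub _).abs)
    rw [Real.norm_eq_abs, abs_abs]
    exact (abs_sub _ _).trans (add_le_add (hM x) (hφM j x))
  have hlt : ∫ x, |θ x - G x| ∂m < e := by
    refine lt_of_le_of_lt ?_ (half_lt_self he)
    refine le_trans ?_ hg
    exact integral_mono_of_nonneg (Eventually.of_forall fun x => abs_nonneg _)
      (hθi.sub hgi).norm (Eventually.of_forall hθG)
  obtain ⟨j, hj⟩ := (hint.eventually_lt_const hlt).exists
  exact ⟨φ j, hφt j, hφM j, hj.le⟩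

/-- The solution is continuous at the initial time in total variation. -/
theorem IsSolution.abs_integral_sub_initial_le_of_measurable (h : IsSolution t₀ T μ₀ μ α)
    (hA : supNorm t₀ T α < ⊤) {J : ℝ} (hJ : 0 < J) (hF : FisherBound J μ₀) {θ : Sp d → ℝ}
    (hθ : Measurable θ) {M : ℝ} (hM : ∀ x, |θ x| ≤ M) {t : ℝ} (ht : t ∈ Ioc t₀ T) :
    |∫ x, θ x ∂(μ t) - ∫ x, θ x ∂μ₀|
      ≤ ((supNorm t₀ T α).toReal + J) * M * √(2 * (t - t₀)) := by
  have hp0 : IsProbabilityMeasure μ₀ := by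
    rw [← h.initial]
    exact h.prob ⟨le_rfl, ht.1.le.trans ht.2⟩
  have hpt := h.prob (Ioc_subset_Icc_self ht)
  refine le_of_forall_pos_le_add fun e he => ?_
  obtain ⟨φ, hφ, hφM, hφe⟩ := exists_test_integral_sub_le (m := μ t + μ₀) hθ hM he
  have hi : ∀ m : Measure (Sp d), IsFiniteMeasure m → Integrable (fun x => θ x) m := fun m _ =>
    Integrable.of_bound hθ.aestronglyMeasurable M (Eventually.of_forall hM)
  have hd : ∀ m : Measure (Sp d), IsFiniteMeasure m →
      |∫ x, θ x ∂m - ∫ x, φ x ∂m| ≤ ∫ x, |θ x - φ x| ∂m := by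
    intro m hm
    rw [← MeasureTheory.integral_sub (hi m hm) (hφ.integrable m)]
    exact abs_integral_le_integral_abs
  have hd' : ∀ m : Measure (Sp d), IsFiniteMeasure m → Integrable (fun x => |θ x - φ x|) m :=
    fun m hm => ((hi m hm).sub (hφ.integrable m)).abs
  rw [integral_add_measure (hd' _ inferInstance) (hd' _ inferInstance)] at hφe
  have h1 := hd (μ t) inferInstance
  have h2 := hd μ₀ inferInstance
  have h3 := h.abs_integral_sub_initial_le hA hJ hF hφ hφM ht
  rw [abs_le] at h1 h2 h3 ⊢
  constructor <;> linarith [h1.1, h1.2, h2.1, h2.2, h3.1, h3.2]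

end TotalVariation

/-! ### Hopf-Lax regularization -/

section HopfLax

variable {d : ℕ}

/-- The Hopf-Lax (inf-convolution) operator `x ↦ inf_y g(y) + |x - y|² / δ`. -/
def hopfLax (δ : ℝ) (g : Sp d → ℝ) (x : Sp d) : ℝ := ⨅ y, (g y + ‖x - y‖ ^ 2 / δ)

variable {δ : ℝ} {g : Sp d → ℝ} {M : ℝ}

lemma bddBelow_hopfLax (hδ : 0 ≤ δ) (hM : ∀ x, |g x| ≤ M) (x : Sp d) :
    BddBelow (range fun y => g y + ‖x - y‖ ^ 2 / δ) := by
  refine ⟨-M, ?_⟩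
  rintro _ ⟨y, rfl⟩
  have := (abs_le.1 (hM y)).1
  have h2 : 0 ≤ ‖x - y‖ ^ 2 / δ := by positivity
  simp only
  linarith

lemma hopfLax_le (hδ : 0 ≤ δ) (hM : ∀ x, |g x| ≤ M) (x y : Sp d) :
    hopfLax δ g x ≤ g y + ‖x - y‖ ^ 2 / δ :=
  ciInf_le (bddBelow_hopfLax hδ hM x) y

lemma abs_hopfLax_le (hδ : 0 ≤ δ) (hM : ∀ x, |g x| ≤ M) (x : Sp d) : |hopfLax δ g x| ≤ M := by
  refine abs_le.2 ⟨le_ciInf fun y => ?_, ?_⟩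
  · have := (abs_le.1 (hM y)).1
    have h2 : 0 ≤ ‖x - y‖ ^ 2 / δ := by positivity
    linarith
  · have := hopfLax_le hδ hM x x
    rw [sub_self, norm_zero] at this
    have h2 := (abs_le.1 (hM x)).2
    simp at this
    linarith

lemma measurable_hopfLax (hδ : 0 ≤ δ) (hM : ∀ x, |g x| ≤ M) : Measurable (hopfLax δ g) :=
  (upperSemicontinuous_ciInf (bddBelow_hopfLax hδ hM) fun y =>
    (by fun_prop : Continuous fun x => g y + ‖x - y‖ ^ 2 / δ).upperSemicontinuous).measurable

lemma abs_iterate_hopfLax_le (hδ : 0 ≤ δ) (hM : ∀ x, |g x| ≤ M) (n : ℕ) (x : Sp d) :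
    |(hopfLax δ)^[n] g x| ≤ M := by
  induction n generalizing x with
  | zero => exact hM x
  | succ n ih =>
    rw [Function.iterate_succ_apply']
    exact abs_hopfLax_le hδ ih x

lemma measurable_iterate_hopfLax (hδ : 0 ≤ δ) (hM : ∀ x, |g x| ≤ M) (hg : Measurable g) (n : ℕ) :
    Measurable ((hopfLax δ)^[n] g) := by
  cases n with
  | zero => exact hg
  | succ n =>
    rw [Function.iterate_succ_apply']
    exact measurable_hopfLax hδ (abs_iterate_hopfLax_le hδ hM n)

/-- The semigroup property of the quadratic cost, as an inequality for Hopf-Lax bounds. -/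
lemma le_hopfLax_add {ψ f : Sp d → ℝ} {a : ℝ} (hδ : 0 < δ) (ha : 0 < a)
    (h : ∀ x y, ψ y ≤ f x + ‖x - y‖ ^ 2 / (a + δ)) (x y : Sp d) :
    ψ y ≤ hopfLax δ f x + ‖x - y‖ ^ 2 / a := by
  rw [← sub_le_iff_le_add]
  refine le_ciInf fun z => ?_
  have h1 := h z y
  have h2 : ‖z - y‖ ≤ ‖x - z‖ + ‖x - y‖ := by
    have := norm_sub_le_norm_sub_add_norm_sub z x y
    rwa [norm_sub_rev z x] at this
  have h3 : ‖z - y‖ ^ 2 / (a + δ) ≤ (‖x - z‖ + ‖x - y‖) ^ 2 / (a + δ) := by gcongr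
  have h4 : (‖x - z‖ + ‖x - y‖) ^ 2 / (a + δ) ≤ ‖x - z‖ ^ 2 / δ + ‖x - y‖ ^ 2 / a := by
    rw [← sub_nonneg]
    have : ‖x - z‖ ^ 2 / δ + ‖x - y‖ ^ 2 / a - (‖x - z‖ + ‖x - y‖) ^ 2 / (a + δ)
        = (a * ‖x - z‖ - δ * ‖x - y‖) ^ 2 / (a * δ * (a + δ)) := by
      field_simp
      ring
    rw [this]
    positivity
  linarith

/-- Along `n` Hopf-Lax steps of length `δ`, the quadratic cost with time parameter `a + n δ` is
reduced to the cost with parameter `a`. -/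
lemma le_iterate_hopfLax_add {ψ f : Sp d → ℝ} {a : ℝ} (hδ : 0 < δ) (ha : 0 < a) (n : ℕ)
    (h : ∀ x y, ψ y ≤ f x + ‖x - y‖ ^ 2 / (a + n * δ)) (x y : Sp d) :
    ψ y ≤ (hopfLax δ)^[n] f x + ‖x - y‖ ^ 2 / a := by
  induction n generalizing a x y with
  | zero => simpa using h x y
  | succ n ih =>
    rw [Function.iterate_succ_apply']
    refine le_hopfLax_add hδ ha (fun x y => ih (a := a + δ) (by positivity) (fun x y => ?_) x y) x y
    have := h x y
    rwa [show a + ((n + 1 : ℕ) : ℝ) * δ = a + δ + n * δ by push_cast; ring] at this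

/-- The relation `u(x + v) ≤ w(x) + |v|² / δ`, which holds between `hopfLax δ w` and `w` and, unlike
the identity `u = hopfLax δ w`, is preserved by averaging. -/
def HopfLaxBelow (δ : ℝ) (u w : Sp d → ℝ) : Prop := ∀ x v, u (x + v) ≤ w x + ‖v‖ ^ 2 / δ

lemma hopfLaxBelow_hopfLax (hδ : 0 ≤ δ) (hM : ∀ x, |g x| ≤ M) :
    HopfLaxBelow δ (hopfLax δ g) g := fun x v => by
  simpa using hopfLax_le hδ hM (x + v) x

lemma HopfLaxBelow.heat {u w : Sp d → ℝ} (h : HopfLaxBelow δ u w) (hu : IsTest u) (hw : IsTest w)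
    (τ : ℝ) : HopfLaxBelow δ (heat τ u) (heat τ w) := fun x v =>
  average_mono hu hw fun z => by
    have := h (x + z) v
    rwa [add_right_comm] at this

lemma HopfLaxBelow.mollify {u w : Sp d → ℝ} (h : HopfLaxBelow δ u w) (hu : Measurable u)
    (hw : Measurable w) (hMu : ∀ x, |u x| ≤ M) (hMw : ∀ x, |w x| ≤ M) {ρ : Sp d → ℝ}
    (hρ : Integrable ρ) (hρ0 : ∀ x, 0 ≤ ρ x) (hρ1 : ∫ x, ρ x = 1) :
    HopfLaxBelow δ (mollify ρ u) (mollify ρ w) := by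
  intro x v
  have hi : ∀ {f : Sp d → ℝ} (z : Sp d), Measurable f → (∀ x, |f x| ≤ M) →
      Integrable (fun t => f (z - t) • ρ t) volume := fun z hf hM =>
    hρ.bdd_smul M (hf.comp (measurable_const.sub measurable_id)).aestronglyMeasurable
      (Eventually.of_forall fun t => hM _)
  have e : FokkerPlanck.mollify ρ w x + ‖v‖ ^ 2 / δ
      = ∫ t, (w (x - t) • ρ t + ‖v‖ ^ 2 / δ * ρ t) := by
    rw [integral_add (hi x hw hMw) (hρ.const_mul _), integral_const_mul, hρ1, mul_one]
    rfl
  rw [e]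
  refine integral_mono (hi (x + v) hu hMu) ((hi x hw hMw).add (hρ.const_mul _)) fun t => ?_
  have := h (x - t) v
  rw [sub_add_eq_add_sub] at this
  simp only [smul_eq_mul, ← add_mul]
  exact mul_le_mul_of_nonneg_right this (hρ0 t)

/-- The quantitative gap in the Hopf-Lax relation, from the choice `v = (δ/2) ∇u(x)`. -/
lemma HopfLaxBelow.sq_gradient_le {u w : Sp d → ℝ} (h : HopfLaxBelow δ u w) (hδ : 0 < δ)
    (hu : IsTest u) {B : ℝ} (hB : DerivBound B u) (x : Sp d) :
    δ / 4 * ‖gradient u x‖ ^ 2 ≤ w x - u x + B ^ 3 * δ ^ 2 / 4 := by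
  have hB0 : 0 ≤ B := (norm_nonneg _).trans (hB.norm_gradient_le x)
  have h1 := h x ((δ / 2) • gradient u x)
  have h2 := norm_taylor_one_le hu (fun z => hB 2 (by norm_num) z) x ((δ / 2) • gradient u x)
  have h3 : fderiv ℝ u x ((δ / 2) • gradient u x) = δ / 2 * ‖gradient u x‖ ^ 2 := by
    rw [map_smul, smul_eq_mul]
    congr 1
    rw [← real_inner_self_eq_norm_sq]
    exact (InnerProductSpace.toDual_symm_apply (𝕜 := ℝ)).symm
  rw [norm_smul, Real.norm_of_nonneg (by positivity : 0 ≤ δ / 2), mul_pow] at h1 h2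
  rw [h3, Real.norm_eq_abs] at h2
  have h4 := (abs_le.1 h2).1
  have h5 : B * ((δ / 2) ^ 2 * ‖gradient u x‖ ^ 2) ≤ B ^ 3 * δ ^ 2 / 4 := by
    have : ‖gradient u x‖ ^ 2 ≤ B ^ 2 :=
      pow_le_pow_left₀ (norm_nonneg _) (hB.norm_gradient_le x) 2
    calc _ = B * δ ^ 2 / 4 * ‖gradient u x‖ ^ 2 := by ring
      _ ≤ B * δ ^ 2 / 4 * B ^ 2 := by gcongr
      _ = _ := by ring
  have h6 : (δ / 2) ^ 2 * ‖gradient u x‖ ^ 2 / δ = δ / 4 * ‖gradient u x‖ ^ 2 := by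
    field_simp
    ring
  linarith

lemma HopfLaxBelow.integral_sq_gradient_le {u w : Sp d → ℝ} (h : HopfLaxBelow δ u w) (hδ : 0 < δ)
    (hu : IsTest u) (hw : IsTest w) {B : ℝ} (hB : DerivBound B u) (m : Measure (Sp d))
    [IsProbabilityMeasure m] :
    δ / 4 * ∫ x, ‖gradient u x‖ ^ 2 ∂m ≤ ∫ x, w x ∂m - ∫ x, u x ∂m + B ^ 3 * δ ^ 2 / 4 := by
  have i1 := hu.integrable m
  have i2 := hw.integrable m
  have i3 : Integrable (fun x => w x - u x) m := i2.sub i1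
  have e : ∫ x, w x ∂m - ∫ x, u x ∂m + B ^ 3 * δ ^ 2 / 4
      = ∫ x, (w x - u x + B ^ 3 * δ ^ 2 / 4) ∂m := by
    rw [integral_add i3 (integrable_const _), integral_sub i2 i1]
    simp
  rw [e, ← integral_const_mul]
  exact integral_mono_of_nonneg (Eventually.of_forall fun x => by positivity)
    (i3.add (integrable_const _)) (Eventually.of_forall fun x => h.sq_gradient_le hδ hu hB x)

lemma DerivBound.abs_sq_gradient_sub_le {u : Sp d → ℝ} (hu : IsTest u) {B : ℝ}
    (hB : DerivBound B u) (x y : Sp d) :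
    |‖gradient u y‖ ^ 2 - ‖gradient u x‖ ^ 2| ≤ 2 * B ^ 2 * ‖y - x‖ := by
  have h1 := lipschitz_of_norm_fderiv_le hu.fderiv.differentiable hB.norm_fderiv_fderiv_le x y
  rw [← norm_gradient_sub] at h1
  have h2 := abs_norm_sub_norm_le (gradient u y) (gradient u x)
  have hx := hB.norm_gradient_le x
  have hy := hB.norm_gradient_le y
  have hB0 : 0 ≤ B := (norm_nonneg _).trans hx
  rw [sq_sub_sq, abs_mul, abs_of_nonneg (by positivity)]
  calc _ ≤ (B + B) * (B * ‖y - x‖) := by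
        gcongr
        exact h2.trans h1
    _ = _ := by ring

lemma DerivBound.sq_gradient_le {u : Sp d → ℝ} {B : ℝ} (hB : DerivBound B u) (x : Sp d) :
    |‖gradient u x‖ ^ 2| ≤ B ^ 2 := by
  rw [abs_of_nonneg (by positivity)]
  exact pow_le_pow_left₀ (norm_nonneg _) (hB.norm_gradient_le x) 2

lemma IsTest.integrable_sq_gradient {u : Sp d → ℝ} (hu : IsTest u) (m : Measure (Sp d))
    [IsFiniteMeasure m] : Integrable (fun x => ‖gradient u x‖ ^ 2) m := by
  obtain ⟨B, -, hB⟩ := hu.exists_derivBound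
  exact Integrable.of_bound (hu.continuous_gradient.norm.pow 2).aestronglyMeasurable (B ^ 2)
    (Eventually.of_forall hB.sq_gradient_le)

end HopfLax

/-! ### The Lipschitz estimate -/

section Lipschitz

variable {d : ℕ} {t₀ T : ℝ} {μ₀ : Measure (Sp d)} {μ : ℝ → Measure (Sp d)}
  {α : ℝ → Sp d → Sp d}

/-- A short step of the solution, dual to a Hopf-Lax step of length `c ε`: the kinetic cost of the
drift is absorbed by the gap in the Hopf-Lax relation. -/
lemma IsSolution.exists_drift_step (hT : t₀ ≤ T) (h : IsSolution t₀ T μ₀ μ α)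
    (hA : supNorm t₀ T α < ⊤) {B c e A : ℝ} (hAA : (supNorm t₀ T α).toReal ≤ A) (hB : 0 ≤ B)
    (hc : 0 < c) (he : 0 < e) :
    ∃ δ > 0, ∀ u w : Sp d → ℝ, IsTest u → IsTest w → DerivBound B u → ∀ s ε : ℝ, t₀ ≤ s → 0 < ε →
      ε < δ → s + ε ≤ T → HopfLaxBelow (c * ε) u w →
      ∫ x, u x ∂(μ (s + ε)) ≤ ∫ x, heat ε w x ∂(μ s) + (A ^ 2 / c + e) * ε := by
  have hA0 : 0 ≤ A := ENNReal.toReal_nonneg.trans hAA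
  obtain ⟨C, hC, hgrad⟩ := exists_norm_fderiv_heat_sub_le d
  obtain ⟨δ₁, hδ₁, hstep⟩ := h.exists_step hT hB (by positivity : 0 < e / 4)
  obtain ⟨δ₂, hδ₂, hmod⟩ := h.curve.exists_modulus (η := e / (4 * (c * B ^ 2 + 1)))
    (by positivity)
  refine ⟨min (min δ₁ δ₂) (min ((e / (4 * (A * (C * B) + 1))) ^ 2) (e / (B ^ 3 * c ^ 2 + 1))),
    by positivity, fun u w hu hw hBu s ε hs hε hεδ hsT hbelow => ?_⟩
  simp only [lt_min_iff] at hεδ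
  obtain ⟨⟨hε1, hε2⟩, hε3, hε4⟩ := hεδ
  have hsm : s ∈ Icc t₀ T := ⟨hs, by linarith⟩
  have hps := h.prob hsm
  set U := heat ε u with hU
  have hUt : IsTest U := hu.heat ε
  have hUB : DerivBound B U := hBu.heat hu ε
  set I := ∫ x, ‖gradient U x‖ ^ 2 ∂(μ s)
  -- the three small errors
  have err1 : A * (C * B * √ε) ≤ e / 4 := by
    have hsq : √ε ≤ e / (4 * (A * (C * B) + 1)) := Real.sqrt_le_iff.2 ⟨by positivity, hε3.le⟩
    have h0 : 0 ≤ A * (C * B) := by positivity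
    calc A * (C * B * √ε) = A * (C * B) * √ε := by ring
      _ ≤ (A * (C * B) + 1) * (e / (4 * (A * (C * B) + 1))) := by gcongr; linarith
      _ = e / 4 := by field_simp
  have err2 : c / 4 * (2 * B ^ 2 * (e / (4 * (c * B ^ 2 + 1)))) ≤ e / 4 := by
    have h0 : 0 ≤ c * B ^ 2 := by positivity
    have h1 : c * B ^ 2 / (c * B ^ 2 + 1) ≤ 1 := by
      rw [div_le_one (by positivity)]
      linarith
    calc c / 4 * (2 * B ^ 2 * (e / (4 * (c * B ^ 2 + 1))))
        = (c * B ^ 2 / (c * B ^ 2 + 1)) * (e / 8) := by field_simp; ring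
      _ ≤ 1 * (e / 8) := by gcongr
      _ ≤ e / 4 := by linarith
  have err3 : B ^ 3 * (c * ε) ^ 2 / 4 ≤ e / 4 * ε := by
    have h0 : 0 ≤ B ^ 3 * c ^ 2 := by positivity
    rw [lt_div_iff₀ (by positivity)] at hε4
    have h1 : B ^ 3 * c ^ 2 * ε ≤ e := by nlinarith
    calc B ^ 3 * (c * ε) ^ 2 / 4 = B ^ 3 * c ^ 2 * ε * ε / 4 := by ring
      _ ≤ e * ε / 4 := by gcongr
      _ = _ := by ring
  have hgap := (hbelow.heat hu hw ε).integral_sq_gradient_le (by positivity) hUt (hw.heat ε)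
    hUB (μ s)
  have hst := (abs_le.1 (hstep u hu hBu s ε hs hε hε1 hsT)).2
  have hdrift : ∫ r in s..(s + ε), ∫ x, ⟪α r x, gradient u x⟫_ℝ ∂(μ r)
      ≤ ∫ r in s..(s + ε), (A ^ 2 / c + c / 4 * I + e / 2) := by
    have hint : IntervalIntegrable (fun r => ∫ x, ⟪α r x, gradient u x⟫_ℝ ∂(μ r)) volume
        s (s + ε) :=
      (intervalIntegrable_iff_integrableOn_Ioc_of_le (by linarith)).2
        ((h.intervalIntegrable hT hu).1.mono_set
          (Ioc_subset_Icc_self.trans (Icc_subset_Icc hs hsT)))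
    refine intervalIntegral.integral_mono_ae_restrict (by linarith) hint
      intervalIntegrable_const ?_
    rw [Measure.restrict_congr_set Ioc_ae_eq_Icc.symm]
    refine (ae_restrict_iff' measurableSet_Ioc).2 ?_
    filter_upwards [h.ae_norm_le hT hA] with r hr hrm
    have hrT : r ∈ Ioc t₀ T := ⟨lt_of_le_of_lt hs hrm.1, hrm.2.trans hsT⟩
    have hpr := h.prob (Ioc_subset_Icc_self hrT)
    have hae := (hr hrT).2
    have hd : |r - s| < δ₂ := by
      rw [abs_of_pos (by linarith [hrm.1])]
      linarith [hrm.2]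
    have hm := (abs_le.1 (hmod r (Ioc_subset_Icc_self hrT) s hsm hd _ (B ^ 2) (2 * B ^ 2)
      (by positivity) hUB.sq_gradient_le (hUB.abs_sq_gradient_sub_le hUt))).2
    have hi := hUt.integrable_sq_gradient (μ r)
    have hpt : ∀ᵐ x ∂(μ r), ⟪α r x, gradient u x⟫_ℝ
        ≤ c / 4 * ‖gradient U x‖ ^ 2 + (A ^ 2 / c + e / 4) := by
      filter_upwards [hae] with x hx
      have hx' := hx.trans hAA
      have h1 : ‖gradient u x‖ ≤ ‖gradient U x‖ + C * B * √ε := by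
        have h2 := norm_sub_norm_le (gradient u x) (gradient U x)
        rw [norm_gradient_sub, norm_sub_rev] at h2
        linarith [hgrad u B hu hBu ε hε.le x]
      -- the weights of Young's inequality make the energy term cancel against `hgap`
      have h2 : A * ‖gradient U x‖ ≤ A ^ 2 / c + c / 4 * ‖gradient U x‖ ^ 2 := by
        rw [← sub_nonneg]
        have : A ^ 2 / c + c / 4 * ‖gradient U x‖ ^ 2 - A * ‖gradient U x‖
            = (A - c / 2 * ‖gradient U x‖) ^ 2 / c := by
          field_simp
          ring
        rw [this]
        positivity
      calc ⟪α r x, gradient u x⟫_ℝ ≤ ‖α r x‖ * ‖gradient u x‖ := real_inner_le_norm _ _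
        _ ≤ A * (‖gradient U x‖ + C * B * √ε) := by gcongr
        _ ≤ _ := by linarith
    have hbound := integral_mono_ae (integrable_inner_of_bound
      (Integrable.of_bound (h.measurable.comp measurable_prodMk_left).aestronglyMeasurable _ hae)
      hu.continuous_gradient hBu.norm_gradient_le)
      ((hi.const_mul (c / 4)).add (integrable_const (A ^ 2 / c + e / 4))) hpt
    refine hbound.trans ?_
    simp only [Pi.add_apply]
    rw [integral_add (hi.const_mul (c / 4)) (integrable_const _), integral_const_mul]
    simp only [integral_const, probReal_univ, one_smul]
    have h3 : c / 4 * ∫ x, ‖gradient U x‖ ^ 2 ∂(μ r)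
        ≤ c / 4 * (I + 2 * B ^ 2 * (e / (4 * (c * B ^ 2 + 1)))) :=
      mul_le_mul_of_nonneg_left (by linarith) (by positivity)
    rw [mul_add] at h3
    linarith
  rw [intervalIntegral.integral_const, add_sub_cancel_left, smul_eq_mul] at hdrift
  have e5 : c * ε / 4 * I = ε * (c / 4 * I) := by ring
  rw [e5] at hgap
  linarith

/-- A short step of the heat flow started from a measure of finite Fisher information, dual to a
Hopf-Lax step: here the gap absorbs the Dirichlet energy in `FisherBound`. -/
lemma FisherBound.exists_heat_step [IsProbabilityMeasure μ₀] {J : ℝ} (h : FisherBound J μ₀)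
    {B c e : ℝ} (hB : 0 ≤ B) (hc : 0 < c) (he : 0 < e) :
    ∃ δ > 0, ∀ u w : Sp d → ℝ, IsTest u → IsTest w → DerivBound B u → ∀ ε : ℝ, 0 < ε →
      ε < δ → HopfLaxBelow (c * ε) u w →
      ∫ x, heat ε u x ∂μ₀ ≤ ∫ x, w x ∂μ₀ + (J ^ 2 / c + e) * ε := by
  obtain ⟨C, hC, hheat⟩ := exists_heat_sub_laplacian_le d
  refine ⟨min ((e / (2 * (C * B + 1))) ^ 2) (e / (B ^ 3 * c ^ 2 + 1)), by positivity,
    fun u w hu hw hBu ε hε hεδ hbelow => ?_⟩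
  simp only [lt_min_iff] at hεδ
  obtain ⟨hε3, hε4⟩ := hεδ
  set I := ∫ x, ‖gradient u x‖ ^ 2 ∂μ₀
  have err1 : C * B * √ε ^ 3 ≤ e / 2 * ε := by
    have hsq : √ε ≤ e / (2 * (C * B + 1)) := Real.sqrt_le_iff.2 ⟨by positivity, hε3.le⟩
    have h0 : 0 ≤ C * B := by positivity
    have h1 : C * B * √ε ≤ e / 2 := by
      calc C * B * √ε ≤ (C * B + 1) * (e / (2 * (C * B + 1))) := by gcongr; linarith
        _ = e / 2 := by field_simp
    rw [pow_succ, Real.sq_sqrt hε.le]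
    calc C * B * (ε * √ε) = C * B * √ε * ε := by ring
      _ ≤ e / 2 * ε := by gcongr
  have err3 : B ^ 3 * (c * ε) ^ 2 / 4 ≤ e / 4 * ε := by
    have h0 : 0 ≤ B ^ 3 * c ^ 2 := by positivity
    rw [lt_div_iff₀ (by positivity)] at hε4
    have h1 : B ^ 3 * c ^ 2 * ε ≤ e := by nlinarith
    calc B ^ 3 * (c * ε) ^ 2 / 4 = B ^ 3 * c ^ 2 * ε * ε / 4 := by ring
      _ ≤ e * ε / 4 := by gcongr
      _ = _ := by ring
  have hgap := hbelow.integral_sq_gradient_le (by positivity) hu hw hBu μ₀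
  -- with `r = 1 / c` the energy term has the coefficient `c / 4` of the gap
  have hlap := (le_abs_self _).trans (h u hu (1 / c) (by positivity))
  have hstep : ∫ x, heat ε u x ∂μ₀
      ≤ ∫ x, u x ∂μ₀ + ε * ∫ x, Laplacian.laplacian u x ∂μ₀ + C * B * √ε ^ 3 := by
    have i2 := hu.integrable μ₀
    have i3 : Integrable (fun x => ε * Laplacian.laplacian u x) μ₀ :=
      (hu.laplacian.integrable μ₀).const_mul ε
    have i4 : Integrable (fun x => u x + ε * Laplacian.laplacian u x) μ₀ := i2.add i3
    have := integral_mono ((hu.heat ε).integrable μ₀) (i4.add (integrable_const (C * B * √ε ^ 3)))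
      fun x => by
        have := (abs_le.1 (hheat u B hu hBu ε hε.le x)).2
        simp only [Pi.add_apply]
        linarith
    simp only [Pi.add_apply] at this
    rw [integral_add i4 (integrable_const _), integral_add i2 i3, integral_const_mul] at this
    simpa using this
  have h5 : ε * ∫ x, Laplacian.laplacian u x ∂μ₀ ≤ J ^ 2 / c * ε + c * ε / 4 * I := by
    refine (mul_le_mul_of_nonneg_left hlap hε.le).trans (le_of_eq ?_)
    simp only [I]
    field_simp
  nlinarith

/-- The solution against iterated Hopf-Lax regularizations of mollified functions. -/
lemma IsSolution.exists_integral_mollify_le (h : IsSolution t₀ T μ₀ μ α)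
    (hA : supNorm t₀ T α < ⊤) {t : ℝ} (ht : t ∈ Ioc t₀ T) {c e A M : ℝ}
    (hAA : (supNorm t₀ T α).toReal ≤ A) (hc : 0 < c) (he : 0 < e) {ρ : Sp d → ℝ}
    (hρ : ContDiff ℝ ∞ ρ) (hρc : HasCompactSupport ρ) (hρ0 : ∀ x, 0 ≤ ρ x)
    (hρ1 : ∫ x, ρ x = 1) :
    ∃ δ > 0, ∀ n : ℕ, 0 < n → (t - t₀) / n < δ → ∀ f : Sp d → ℝ, Measurable f →
      (∀ x, |f x| ≤ M) →
      ∫ x, mollify ρ ((hopfLax (c * ((t - t₀) / n)))^[n] f) x ∂(μ t)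
        ≤ ∫ x, heat (t - t₀) (mollify ρ f) x ∂μ₀ + (A ^ 2 / c + e) * (t - t₀) := by
  have hT : t₀ ≤ T := ht.1.le.trans ht.2
  obtain ⟨B, hB0, hB⟩ := exists_derivBound_mollify hρ hρc M
  obtain ⟨δ, hδ, hstep⟩ := h.exists_drift_step hT hA hAA hB0 hc he
  refine ⟨δ, hδ, fun n hn hnδ f hf hM => ?_⟩
  set ε := (t - t₀) / n with hε
  have hn' : (0 : ℝ) < n := by exact_mod_cast hn
  have hε0 : 0 < ε := div_pos (by linarith [ht.1]) hn'
  have hnε : n * ε = t - t₀ := by rw [hε]; field_simp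
  have hcε : 0 ≤ c * ε := by positivity
  let g : ℕ → Sp d → ℝ := fun k => (hopfLax (c * ε))^[k] f
  have hg : ∀ k, Measurable (g k) := measurable_iterate_hopfLax hcε hM hf
  have hgM : ∀ k x, |g k x| ≤ M := abs_iterate_hopfLax_le hcε hM
  have hgs : ∀ k, HopfLaxBelow (c * ε) (g (k + 1)) (g k) := fun k => by
    simp only [g, Function.iterate_succ_apply']
    exact hopfLaxBelow_hopfLax hcε (hgM k)
  have hmt : ∀ k, IsTest (mollify ρ (g k)) := fun k => isTest_mollify (hg k) (hgM k) hρ hρc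
  have hρi : Integrable ρ := hρ.continuous.integrable_of_hasCompactSupport hρc
  let X : ℕ → ℝ := fun k => ∫ x, heat ((n - k) * ε) (mollify ρ (g k)) x ∂(μ (t₀ + k * ε))
  have key := sub_le_integral_of_steps (a := 0) (G := fun _ => 0) (x := X) (n := n)
    (η := A ^ 2 / c + e) hε0.le intervalIntegrable_const fun k hk => by
      have hk' : (k : ℝ) + 1 ≤ n := by exact_mod_cast hk
      have hk0 : (0 : ℝ) ≤ k := Nat.cast_nonneg k
      have hτ : 0 ≤ (n - ((k + 1 : ℕ) : ℝ)) * ε :=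
        mul_nonneg (by push_cast; linarith) hε0.le
      have hs := hstep (heat ((n - ((k + 1 : ℕ) : ℝ)) * ε) (mollify ρ (g (k + 1))))
        (heat ((n - ((k + 1 : ℕ) : ℝ)) * ε) (mollify ρ (g k)))
        ((hmt _).heat _) ((hmt _).heat _) ((hB _ (hg _) (hgM _)).heat (hmt _) _)
        (t₀ + k * ε) ε (by nlinarith) hε0 hnδ (by nlinarith [ht.2])
        (((hgs k).mollify (hg _) (hg _) (hgM _) (hgM _) hρi hρ0 hρ1).heat (hmt _) (hmt _) _)
      rw [heat_heat (hmt k) hε0.le hτ] at hs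
      have e1 : ε + (n - ((k + 1 : ℕ) : ℝ)) * ε = (n - k) * ε := by push_cast; ring
      have e2 : t₀ + k * ε + ε = t₀ + ((k + 1 : ℕ) : ℝ) * ε := by push_cast; ring
      rw [e1, e2] at hs
      simp only [intervalIntegral.integral_zero, zero_add]
      change ∫ x, heat ((n - ((k + 1 : ℕ) : ℝ)) * ε) (mollify ρ (g (k + 1))) x
        ∂(μ (t₀ + ((k + 1 : ℕ) : ℝ) * ε)) - X k ≤ _
      linarith
  have hX0 : X 0 = ∫ x, heat (t - t₀) (mollify ρ f) x ∂μ₀ := by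
    simp only [X, g, Nat.cast_zero, sub_zero, zero_mul, add_zero, hnε, h.initial,
      Function.iterate_zero, id_eq]
  have hXn : X n = ∫ x, mollify ρ (g n) x ∂(μ t) := by
    simp only [X, sub_self, zero_mul, hnε, heat_zero _ (hmt n).continuous, add_sub_cancel]
  rw [hX0, hXn, hnε] at key
  simp only [intervalIntegral.integral_zero, zero_add] at key
  change ∫ x, mollify ρ (g n) x ∂(μ t) ≤ _
  linarith

/-- The heat flow of the initial measure against iterated Hopf-Lax regularizations. -/
lemma FisherBound.exists_integral_heat_mollify_le [IsProbabilityMeasure μ₀] {J : ℝ}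
    (h : FisherBound J μ₀) {τ : ℝ} (hτ : 0 < τ) {c e M : ℝ} (hc : 0 < c) (he : 0 < e)
    {ρ : Sp d → ℝ} (hρ : ContDiff ℝ ∞ ρ) (hρc : HasCompactSupport ρ) (hρ0 : ∀ x, 0 ≤ ρ x)
    (hρ1 : ∫ x, ρ x = 1) :
    ∃ δ > 0, ∀ n : ℕ, 0 < n → τ / n < δ → ∀ f : Sp d → ℝ, Measurable f → (∀ x, |f x| ≤ M) →
      ∫ x, heat τ (mollify ρ ((hopfLax (c * (τ / n)))^[n] f)) x ∂μ₀
        ≤ ∫ x, mollify ρ f x ∂μ₀ + (J ^ 2 / c + e) * τ := by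
  obtain ⟨B, hB0, hB⟩ := exists_derivBound_mollify hρ hρc M
  obtain ⟨δ, hδ, hstep⟩ := h.exists_heat_step hB0 hc he
  refine ⟨δ, hδ, fun n hn hnδ f hf hM => ?_⟩
  set ε := τ / n with hε
  have hn' : (0 : ℝ) < n := by exact_mod_cast hn
  have hε0 : 0 < ε := div_pos hτ hn'
  have hnε : n * ε = τ := by rw [hε]; field_simp
  have hcε : 0 ≤ c * ε := by positivity
  let g : ℕ → Sp d → ℝ := fun k => (hopfLax (c * ε))^[k] f
  have hg : ∀ k, Measurable (g k) := measurable_iterate_hopfLax hcε hM hf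
  have hgM : ∀ k x, |g k x| ≤ M := abs_iterate_hopfLax_le hcε hM
  have hgs : ∀ k, HopfLaxBelow (c * ε) (g (k + 1)) (g k) := fun k => by
    simp only [g, Function.iterate_succ_apply']
    exact hopfLaxBelow_hopfLax hcε (hgM k)
  have hmt : ∀ k, IsTest (mollify ρ (g k)) := fun k => isTest_mollify (hg k) (hgM k) hρ hρc
  have hρi : Integrable ρ := hρ.continuous.integrable_of_hasCompactSupport hρc
  let X : ℕ → ℝ := fun k => ∫ x, heat (k * ε) (mollify ρ (g k)) x ∂μ₀
  have key := sub_le_integral_of_steps (a := 0) (G := fun _ => 0) (x := X) (n := n)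
    (η := J ^ 2 / c + e) hε0.le intervalIntegrable_const fun k hk => by
      have hs := hstep (heat (k * ε) (mollify ρ (g (k + 1)))) (heat (k * ε) (mollify ρ (g k)))
        ((hmt _).heat _) ((hmt _).heat _) ((hB _ (hg _) (hgM _)).heat (hmt _) _) ε hε0 hnδ
        (((hgs k).mollify (hg _) (hg _) (hgM _) (hgM _) hρi hρ0 hρ1).heat (hmt _) (hmt _) _)
      rw [heat_heat (hmt _) hε0.le (by positivity)] at hs
      have e1 : ε + k * ε = ((k + 1 : ℕ) : ℝ) * ε := by push_cast; ring
      rw [e1] at hs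
      simp only [intervalIntegral.integral_zero, zero_add]
      change ∫ x, heat (((k + 1 : ℕ) : ℝ) * ε) (mollify ρ (g (k + 1))) x ∂μ₀ - X k ≤ _
      linarith
  have hX0 : X 0 = ∫ x, mollify ρ f x ∂μ₀ := by
    simp only [X, Nat.cast_zero, zero_mul, heat_zero _ (hmt 0).continuous]
    rfl
  have hXn : X n = ∫ x, heat τ (mollify ρ (g n)) x ∂μ₀ := by simp only [X, hnε]
  rw [hX0, hXn, hnε] at key
  simp only [intervalIntegral.integral_zero, zero_add] at key
  change ∫ x, heat τ (mollify ρ (g n)) x ∂μ₀ ≤ _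
  linarith

end Lipschitz

/-! ### From the dual estimate to the Wasserstein distance -/

section Wasserstein

variable {d : ℕ} {t₀ T : ℝ} {μ₀ : Measure (Sp d)} {μ : ℝ → Measure (Sp d)}
  {α : ℝ → Sp d → Sp d}

/-- The dual form of the Lipschitz estimate. A fraction `c₂` of the unit transport time is used
against the heat flow of `μ₀` and a fraction `c₁` against the drift, in proportion `J : A`. -/
lemma IsSolution.integral_mollify_le_of_dual (h : IsSolution t₀ T μ₀ μ α)
    (hA : supNorm t₀ T α < ⊤) {t : ℝ} (ht : t ∈ Ioc t₀ T) {A J S : ℝ}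
    (hAA : (supNorm t₀ T α).toReal ≤ A) (hA0 : 0 < A) (hJ : 0 < J) (hF : FisherBound J μ₀)
    (hS : A + J < S) {f ψ : Sp d → ℝ} (hf : Measurable f) (hψ : Measurable ψ) {M : ℝ}
    (hfM : ∀ x, |f x| ≤ M) (hψM : ∀ x, |ψ x| ≤ M) (hψf : ∀ x y, ψ y ≤ f x + ‖x - y‖ ^ 2)
    {ρ : Sp d → ℝ} (hρ : ContDiff ℝ ∞ ρ) (hρc : HasCompactSupport ρ) (hρ0 : ∀ x, 0 ≤ ρ x)
    (hρ1 : ∫ x, ρ x = 1) :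
    ∫ x, mollify ρ ψ x ∂(μ t) ≤ ∫ x, mollify ρ f x ∂μ₀ + (S * (t - t₀)) ^ 2 := by
  have hpt := h.prob (Ioc_subset_Icc_self ht)
  have hp0 : IsProbabilityMeasure μ₀ := by
    rw [← h.initial]
    exact h.prob ⟨le_rfl, ht.1.le.trans ht.2⟩
  set τ := t - t₀
  have hτ : 0 < τ := sub_pos.2 ht.1
  have hS0 : 0 < S := by linarith
  set c₁ := A / (τ * S) with hc₁
  set c₂ := J / (τ * S) with hc₂
  have hc₁0 : 0 < c₁ := by positivity
  have hc₂0 : 0 < c₂ := by positivity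
  -- the excess of `S` over `A + J` leaves a positive transport time, needed to compare `ψ` with the
  -- last Hopf-Lax regularization
  have hcs : c₁ * τ + c₂ * τ < 1 := by
    have : c₁ * τ + c₂ * τ = (A + J) / S := by
      rw [hc₁, hc₂]
      field_simp
    rw [this, div_lt_one hS0]
    exact hS
  -- up to the excess, these proportions minimize `A² / c₁ + J² / c₂` for a given `c₁ + c₂`
  have hcost : (A ^ 2 / c₁) * τ + (J ^ 2 / c₂) * τ ≤ (S * τ) ^ 2 := by
    have : (A ^ 2 / c₁) * τ + (J ^ 2 / c₂) * τ = S * (A + J) * τ ^ 2 := by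
      rw [hc₁, hc₂]
      field_simp
    rw [this, mul_pow, sq S]
    gcongr
  refine le_of_forall_pos_le_add fun e he => ?_
  obtain ⟨δ₁, hδ₁, H₁⟩ := h.exists_integral_mollify_le hA ht (M := M) hAA hc₁0
    (by positivity : 0 < e / (2 * τ)) hρ hρc hρ0 hρ1
  obtain ⟨δ₂, hδ₂, H₂⟩ := hF.exists_integral_heat_mollify_le hτ (M := M) hc₂0
    (by positivity : 0 < e / (2 * τ)) hρ hρc hρ0 hρ1
  obtain ⟨n, hn, hnδ⟩ := exists_nat_step_lt (h := τ) (lt_min hδ₁ hδ₂)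
  have hn' : (0 : ℝ) < n := by exact_mod_cast hn
  have hε0 : 0 < τ / n := by positivity
  have hd1 : 0 < c₁ * (τ / n) := by positivity
  have hd2 : 0 < c₂ * (τ / n) := by positivity
  set f₂ := (hopfLax (c₂ * (τ / n)))^[n] f with hf₂
  have hf₂m : Measurable f₂ := measurable_iterate_hopfLax hd2.le hfM hf n
  have hf₂M : ∀ x, |f₂ x| ≤ M := abs_iterate_hopfLax_le hd2.le hfM n
  set f₁ := (hopfLax (c₁ * (τ / n)))^[n] f₂ with hf₁
  have hf₁m : Measurable f₁ := measurable_iterate_hopfLax hd1.le hf₂M hf₂m n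
  have hf₁M : ∀ x, |f₁ x| ≤ M := abs_iterate_hopfLax_le hd1.le hf₂M n
  have h1 := H₁ n hn (hnδ.trans_le (min_le_left _ _)) f₂ hf₂m hf₂M
  have h2 := H₂ n hn (hnδ.trans_le (min_le_right _ _)) f hf hfM
  have hn1 : ∀ c : ℝ, n * (c * (τ / n)) = c * τ := fun c => by field_simp
  have hbelow : HopfLaxBelow (1 - c₁ * τ - c₂ * τ) ψ f₁ := by
    intro x v
    have := le_iterate_hopfLax_add (ψ := ψ) (f := f₂) (a := 1 - c₁ * τ - c₂ * τ) hd1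
      (by linarith) n (fun x y => ?_) x (x + v)
    · rwa [sub_add_cancel_left, norm_neg] at this
    · rw [hn1, show 1 - c₁ * τ - c₂ * τ + c₁ * τ = 1 - c₂ * τ by ring]
      refine le_iterate_hopfLax_add (a := 1 - c₂ * τ) hd2 (by nlinarith) n (fun x y => ?_) x y
      rw [hn1, sub_add_cancel, div_one]
      exact hψf x y
  have h3 : ∫ x, mollify ρ ψ x ∂(μ t) ≤ ∫ x, mollify ρ f₁ x ∂(μ t) := by
    refine integral_mono ((isTest_mollify hψ hψM hρ hρc).integrable _)
      ((isTest_mollify hf₁m hf₁M hρ hρc).integrable _) fun x => ?_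
    have := hbelow.mollify hψ hf₁m hψM hf₁M
      (hρ.continuous.integrable_of_hasCompactSupport hρc) hρ0 hρ1 x 0
    simpa using this
  have h4 : e / (2 * τ) * τ = e / 2 := by field_simp
  change ∫ x, mollify ρ f₁ x ∂(μ t) ≤ _ at h1
  change ∫ x, heat τ (mollify ρ f₂) x ∂μ₀ ≤ _ at h2
  change _ ≤ ∫ x, heat τ (mollify ρ f₂) x ∂μ₀ + (A ^ 2 / c₁ + e / (2 * τ)) * τ at h1
  rw [add_mul, h4] at h1 h2
  linarith

open scoped BoundedContinuousFunction in
/-- The Lipschitz estimate, with slightly larger constants. -/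
lemma IsSolution.d2_le_of_lt (h : IsSolution t₀ T μ₀ μ α)
    (hA : supNorm t₀ T α < ⊤) {t : ℝ} (ht : t ∈ Ioc t₀ T) {A J S : ℝ}
    (hAA : (supNorm t₀ T α).toReal ≤ A) (hA0 : 0 < A) (hJ : 0 < J) (hF : FisherBound J μ₀)
    (hS : A + J < S) : d2 (μ t) μ₀ ≤ ENNReal.ofReal (S * (t - t₀)) := by
  have hpt := h.prob (Ioc_subset_Icc_self ht)
  have hp0 : IsProbabilityMeasure μ₀ := by
    rw [← h.initial]
    exact h.prob ⟨le_rfl, ht.1.le.trans ht.2⟩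
  have hSt : 0 ≤ S * (t - t₀) := mul_nonneg (by linarith) (by linarith [ht.1])
  obtain ⟨γ, h1, h2, hγ⟩ := exists_coupling_of_dual_bound (μ := μ t) (ν := μ₀)
    (c := fun p : Sp d × Sp d => ‖p.1 - p.2‖ ^ 2) (by fun_prop) (fun p => by positivity)
    (K := (S * (t - t₀)) ^ 2) (fun φ ψ hφψ => by
      set M := max ‖φ‖ ‖ψ‖
      have hφM : ∀ x, |φ x| ≤ M := fun x => (φ.norm_coe_le_norm x).trans (le_max_left _ _)
      have hψM : ∀ x, |-ψ x| ≤ M := fun x => by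
        rw [abs_neg]
        exact (ψ.norm_coe_le_norm x).trans (le_max_right _ _)
      have hψc : Continuous fun x => -ψ x := ψ.continuous.neg
      have key : ∫ x, φ x ∂(μ t) ≤ ∫ x, -ψ x ∂μ₀ + (S * (t - t₀)) ^ 2 := by
        refine le_of_tendsto_of_tendsto'
          (tendsto_integral_mollify_shrinkingBump φ.continuous hφM (μ t))
          ((tendsto_integral_mollify_shrinkingBump hψc hψM μ₀).add_const _) fun j => ?_
        refine h.integral_mollify_le_of_dual hA ht hAA hA0 hJ hF hS hψc.measurable
          φ.continuous.measurable hψM hφM (fun x y => ?_) (shrinkingBump d j).contDiff_normed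
          (shrinkingBump d j).hasCompactSupport_normed (shrinkingBump d j).nonneg_normed
          (shrinkingBump d j).integral_normed
        have := hφψ y x
        simp only at this
        rw [norm_sub_rev] at this
        linarith
      rw [integral_neg] at key
      linarith)
  refine (ENNReal.rpow_le_rpow (iInf₂_le γ ⟨h1, h2⟩) (by norm_num)).trans ?_
  have e : ∫⁻ p, ‖p.1 - p.2‖ₑ ^ 2 ∂γ = ∫⁻ p, ENNReal.ofReal (‖p.1 - p.2‖ ^ 2) ∂γ := by
    refine lintegral_congr fun p => ?_
    rw [ENNReal.ofReal_pow (norm_nonneg _), ofReal_norm]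
  rw [e]
  refine (ENNReal.rpow_le_rpow hγ (by norm_num)).trans (le_of_eq ?_)
  rw [ENNReal.ofReal_pow hSt, ← ENNReal.rpow_natCast, ← ENNReal.rpow_mul]
  norm_num

lemma d2_self (m : Measure (Sp d)) : d2 m m = 0 := by
  have hc : IsCoupling m m (m.map fun x => (x, x)) := by
    constructor
    · rw [Measure.map_map measurable_fst (by fun_prop)]
      exact Measure.map_id
    · rw [Measure.map_map measurable_snd (by fun_prop)]
      exact Measure.map_id
  have : ⨅ (γ : Measure (Sp d × Sp d)) (_ : IsCoupling m m γ), ∫⁻ p, ‖p.1 - p.2‖ₑ ^ 2 ∂γ = 0 := by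
    refine le_antisymm ((iInf₂_le _ hc).trans (le_of_eq ?_)) (zero_le)
    rw [lintegral_map (by fun_prop) (by fun_prop)]
    simp
  rw [d2, this]
  simp

lemma fisherBound_of_sqrt_lt {J : ℝ} (hf : fisher μ₀ < ⊤) (hJ : √(fisher μ₀).toReal < J) :
    FisherBound J μ₀ := by
  have hJ0 : 0 ≤ J := (Real.sqrt_nonneg _).trans hJ.le
  refine fisherBound_of_fisher_lt ?_
  rw [← ENNReal.toReal_lt_toReal hf.ne ENNReal.ofReal_ne_top, ENNReal.toReal_ofReal (by positivity)]
  exact (Real.sqrt_lt' ((Real.sqrt_nonneg _).trans_lt hJ)).1 hJ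

/-- The Lipschitz estimate with its sharp constant, by letting the enlarged constants decrease. -/
theorem IsSolution.d2_le (h : IsSolution t₀ T μ₀ μ α) (hf : fisher μ₀ < ⊤)
    (hA : supNorm t₀ T α < ⊤) {t : ℝ} (ht : t ∈ Icc t₀ T) :
    d2 (μ t) μ₀ ≤ ENNReal.ofReal
      (((supNorm t₀ T α).toReal + √(fisher μ₀).toReal) * (t - t₀)) := by
  rcases eq_or_lt_of_le ht.1 with rfl | hlt
  · rw [h.initial, d2_self]
    exact zero_le
  set s := (supNorm t₀ T α).toReal + √(fisher μ₀).toReal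
  have hcont : Tendsto (fun S : ℝ => ENNReal.ofReal (S * (t - t₀))) (𝓝[>] s)
      (𝓝 (ENNReal.ofReal (s * (t - t₀)))) :=
    ((ENNReal.continuous_ofReal.comp (continuous_mul_const _)).tendsto s).mono_left
      nhdsWithin_le_nhds
  refine ge_of_tendsto hcont ?_
  filter_upwards [self_mem_nhdsWithin] with S hS
  have hS' : s < S := hS
  have h1 : 0 ≤ (supNorm t₀ T α).toReal := ENNReal.toReal_nonneg
  have h2 := Real.sqrt_nonneg (fisher μ₀).toReal
  exact h.d2_le_of_lt hA ⟨hlt, ht.2⟩ (A := (supNorm t₀ T α).toReal + (S - s) / 3)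
    (J := √(fisher μ₀).toReal + (S - s) / 3) (by linarith) (by linarith) (by linarith)
    (fisherBound_of_sqrt_lt hf (by linarith)) (by simp only [s] at hS' ⊢; linarith)

end Wasserstein

/-! ### First-order expansion of the optimal maps -/

section Expansion

variable {d : ℕ} {t₀ T : ℝ} {μ₀ : Measure (Sp d)} {μ : ℝ → Measure (Sp d)}
  {α : ℝ → Sp d → Sp d}

lemma d2_comm (m m' : Measure (Sp d)) : d2 m m' = d2 m' m := by
  have key : ∀ m m' : Measure (Sp d),
      ⨅ (γ : Measure (Sp d × Sp d)) (_ : IsCoupling m m' γ), ∫⁻ p, ‖p.1 - p.2‖ₑ ^ 2 ∂γ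
        ≤ ⨅ (γ : Measure (Sp d × Sp d)) (_ : IsCoupling m' m γ), ∫⁻ p, ‖p.1 - p.2‖ₑ ^ 2 ∂γ := by
    intro m m'
    refine le_iInf₂ fun γ hγ => (iInf₂_le (γ.map Prod.swap) ⟨?_, ?_⟩).trans (le_of_eq ?_)
    · rw [lintegral_map (by fun_prop) measurable_swap]
      refine lintegral_congr fun p => ?_
      rw [Prod.fst_swap, Prod.snd_swap, ← enorm_neg, neg_sub]
    · rw [Measure.map_map measurable_fst measurable_swap]
      exact hγ.2
    · rw [Measure.map_map measurable_snd measurable_swap]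
      exact hγ.1
  rw [d2, d2, le_antisymm (key m m') (key m' m)]

/-- The operator norm of the Hessian, as a linear map and as a bilinear form. -/
lemma norm_fderiv_gradient {φ : Sp d → ℝ} (x : Sp d) :
    ‖fderiv ℝ (gradient φ) x‖ = ‖iteratedFDeriv ℝ 2 φ x‖ := by
  have e : gradient φ = (InnerProductSpace.toDual ℝ (Sp d)).symm ∘ fderiv ℝ φ := rfl
  have h1 : ‖fderiv ℝ (gradient φ) x‖ = ‖iteratedFDeriv ℝ 1 (gradient φ) x‖ := by
    simp
  rw [h1, e, LinearIsometryEquiv.norm_iteratedFDeriv_comp_left, norm_iteratedFDeriv_fderiv]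

lemma norm_iteratedFDeriv_two_le_hessianNorm {φ : Sp d → ℝ} (hφ : IsTest φ) (x : Sp d) :
    ‖iteratedFDeriv ℝ 2 φ x‖ ≤ hessianNorm φ := by
  obtain ⟨B, -, hB⟩ := hφ.exists_derivBound
  rw [← norm_fderiv_gradient]
  refine le_ciSup (f := fun x => ‖fderiv ℝ (gradient φ) x‖) ⟨B, ?_⟩ x
  rintro _ ⟨y, rfl⟩
  simp only
  rw [norm_fderiv_gradient]
  exact hB 2 (by norm_num) y

lemma inner_gradient_eq (φ : Sp d → ℝ) (x v : Sp d) : ⟪gradient φ x, v⟫_ℝ = fderiv ℝ φ x v :=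
  InnerProductSpace.toDual_symm_apply (𝕜 := ℝ)

lemma IsOptimalMap.memLp_sub {m m' : Measure (Sp d)} {S : Sp d → Sp d} (hS : IsOptimalMap m m' S)
    (hd : d2 m m' < ⊤) : MemLp (fun x => S x - x) 2 m := by
  refine ⟨(hS.aemeasurable.sub aemeasurable_id).aestronglyMeasurable, ?_⟩
  rw [eLpNorm_lt_top_iff_lintegral_rpow_enorm_lt_top two_ne_zero (by simp)]
  have : ∫⁻ x, ‖S x - x‖ₑ ^ 2 ∂m < ⊤ := by
    rw [hS.cost_eq]
    exact ENNReal.pow_lt_top hd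
  simpa using this

/-- The increment of `∫ φ` along an optimal map agrees to first order with `∫ ∇φ · (S - id)`. -/
lemma IsOptimalMap.abs_integral_sub_le {m m' : Measure (Sp d)} [IsProbabilityMeasure m]
    {S : Sp d → Sp d} (hS : IsOptimalMap m m' S) {K : ℝ} (hK : 0 ≤ K)
    (hd : d2 m m' ≤ ENNReal.ofReal K) {φ : Sp d → ℝ} (hφ : IsTest φ) :
    |(∫ x, ⟪gradient φ x, S x - x⟫_ℝ ∂m) - (∫ x, φ x ∂m' - ∫ x, φ x ∂m)|
      ≤ hessianNorm φ * K ^ 2 := by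
  have hL2 := hS.memLp_sub (hd.trans_lt ENNReal.ofReal_lt_top)
  obtain ⟨B, hB0, hB⟩ := hφ.exists_derivBound
  have hi : Integrable (fun x => ⟪gradient φ x, S x - x⟫_ℝ) m := by
    have := integrable_inner_of_bound (hL2.integrable (by norm_num)) hφ.continuous_gradient
      hB.norm_gradient_le
    simpa only [real_inner_comm] using this
  have hφS : AEStronglyMeasurable (fun x => φ (S x)) m :=
    (hφ.continuous.measurable.comp_aemeasurable hS.aemeasurable).aestronglyMeasurable
  have hi2 : Integrable (fun x => φ (S x)) m :=
    Integrable.of_bound hφS B (Eventually.of_forall fun x => hB.norm_le _)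
  have hsq : Integrable (fun x => ‖S x - x‖ ^ 2) m := hL2.integrable_norm_pow (by simp)
  have hcost : ∫ x, ‖S x - x‖ ^ 2 ∂m ≤ K ^ 2 := by
    rw [← ENNReal.ofReal_le_ofReal_iff (by positivity), ofReal_integral_eq_lintegral_ofReal hsq
      (Eventually.of_forall fun x => by positivity), ENNReal.ofReal_pow hK]
    refine le_trans (le_of_eq ?_) (pow_le_pow_left' hd 2)
    rw [← hS.cost_eq]
    refine lintegral_congr fun x => ?_
    rw [ENNReal.ofReal_pow (norm_nonneg _), ofReal_norm]
  have hN0 : 0 ≤ hessianNorm φ :=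
    (norm_nonneg _).trans (norm_iteratedFDeriv_two_le_hessianNorm hφ 0)
  rw [← hS.map_eq, integral_map hS.aemeasurable hφ.continuous.aestronglyMeasurable]
  have i3 : Integrable (fun x => φ (S x) - φ x) m := hi2.sub (hφ.integrable m)
  rw [← integral_sub hi2 (hφ.integrable m), ← integral_sub hi i3, ← Real.norm_eq_abs]
  refine (norm_integral_le_of_norm_le (hsq.const_mul (hessianNorm φ))
    (Eventually.of_forall fun x => ?_)).trans ?_
  · have := norm_taylor_one_le hφ (norm_iteratedFDeriv_two_le_hessianNorm hφ) x (S x - x)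
    rw [add_sub_cancel, ← inner_gradient_eq] at this
    rwa [norm_sub_rev]
  · rw [integral_const_mul]
    exact mul_le_mul_of_nonneg_left hcost hN0

/-- Taylor expansion along the optimal map, whose quadratic error is the squared distance already
estimated. -/
theorem IsSolution.abs_expansion_le (h : IsSolution t₀ T μ₀ μ α) (hf : fisher μ₀ < ⊤)
    (hA : supNorm t₀ T α < ⊤) {τ : ℝ} (hτ : 0 < τ) (hτT : t₀ + τ ≤ T) {S : Sp d → Sp d}
    (hS : IsOptimalMap μ₀ (μ (t₀ + τ)) S) {φ : Sp d → ℝ} (hφ : IsTest φ) :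
    |(∫ x, ⟪gradient φ x, S x - x⟫_ℝ ∂μ₀)
        - ∫ t in t₀..(t₀ + τ), ∫ x, (⟪α t x, gradient φ x⟫_ℝ + Laplacian.laplacian φ x) ∂(μ t)|
      ≤ ((supNorm t₀ T α).toReal + √(fisher μ₀).toReal) ^ 2 * hessianNorm φ * τ ^ 2 := by
  have hp0 : IsProbabilityMeasure μ₀ := by
    rw [← h.initial]
    exact h.prob ⟨le_rfl, by linarith⟩
  have h1 := h.d2_le hf hA (t := t₀ + τ) ⟨by linarith, hτT⟩
  rw [d2_comm, add_sub_cancel_left] at h1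
  have h2 := hS.abs_integral_sub_le (mul_nonneg (add_nonneg ENNReal.toReal_nonneg
    (Real.sqrt_nonneg _)) hτ.le) h1 hφ
  have h3 := h.integral_sub hφ le_rfl (by linarith : t₀ < t₀ + τ) hτT
  rw [h.initial] at h3
  rw [← h3]
  refine h2.trans (le_of_eq (by ring))

lemma RightContinuousL2.eventually_abs_integral_sub_le [IsProbabilityMeasure μ₀]
    (hα : RightContinuousL2 t₀ μ₀ α) {G : Sp d → Sp d} (hG : Continuous G) {B : ℝ}
    (hB : ∀ x, ‖G x‖ ≤ B) {e : ℝ} (he : 0 < e) :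
    ∀ᶠ r in 𝓝[>] t₀, Integrable (α r) μ₀ →
      |∫ x, ⟪α r x, G x⟫_ℝ ∂μ₀ - ∫ x, ⟪α t₀ x, G x⟫_ℝ ∂μ₀| ≤ e := by
  have hB0 : 0 ≤ B := (norm_nonneg _).trans (hB 0)
  filter_upwards [hα.2.eventually_lt_const
    (ENNReal.ofReal_pos.2 (by positivity : 0 < e / (B + 1)))] with r hr hri
  have hi0 : Integrable (α t₀) μ₀ := hα.1.integrable (by norm_num)
  have hsub : Integrable (fun x => α r x - α t₀ x) μ₀ := hri.sub hi0
  rw [← integral_sub (integrable_inner_of_bound hri hG hB) (integrable_inner_of_bound hi0 hG hB),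
    ← Real.norm_eq_abs]
  have h1 : ∫ x, ‖α r x - α t₀ x‖ ∂μ₀ ≤ e / (B + 1) := by
    rw [integral_norm_eq_lintegral_enorm hsub.1, ← eLpNorm_one_eq_lintegral_enorm]
    refine ENNReal.toReal_le_of_le_ofReal (by positivity) ?_
    exact (eLpNorm_le_eLpNorm_of_exponent_le (by norm_num) hsub.1).trans hr.le
  refine (norm_integral_le_of_norm_le (hsub.norm.mul_const B)
    (Eventually.of_forall fun x => ?_)).trans ?_
  · rw [← inner_sub_left]
    exact (norm_inner_le_norm _ _).trans (mul_le_mul_of_nonneg_left (hB x) (norm_nonneg _))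
  · rw [integral_mul_const]
    calc _ ≤ e / (B + 1) * (B + 1) := by gcongr; linarith
      _ = e := by field_simp

/-- The drift term is close to its initial value for almost every time near `t₀`. The change of
measure from `μᵣ` to `μ₀` is controlled in total variation, since `αᵣ` is merely bounded. -/
lemma IsSolution.exists_abs_integral_drift_sub_le (hT : t₀ < T) (h : IsSolution t₀ T μ₀ μ α)
    (hac : μ₀ ≪ volume) (hf : fisher μ₀ < ⊤) (hA : supNorm t₀ T α < ⊤)
    (hα : RightContinuousL2 t₀ μ₀ α) {φ : Sp d → ℝ} (hφ : IsTest φ) {e : ℝ} (he : 0 < e) :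
    ∃ δ > 0, ∀ᵐ r : ℝ, r ∈ Ioo t₀ (t₀ + δ) → r ≤ T ∧
      |∫ x, (⟪α r x, gradient φ x⟫_ℝ + Laplacian.laplacian φ x) ∂(μ r)
        - ∫ x, (⟪α t₀ x, gradient φ x⟫_ℝ + Laplacian.laplacian φ x) ∂μ₀| ≤ e := by
  have hp0 : IsProbabilityMeasure μ₀ := by
    rw [← h.initial]
    exact h.prob ⟨le_rfl, hT.le⟩
  obtain ⟨B, hB0, hB⟩ := hφ.exists_derivBound
  set A := (supNorm t₀ T α).toReal
  have hA0 : 0 ≤ A := ENNReal.toReal_nonneg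
  set J := √(fisher μ₀).toReal + 1
  have hJ : 0 < J := by positivity
  have hF : FisherBound J μ₀ := fisherBound_of_sqrt_lt hf (by simp only [J]; linarith)
  have ev1 := hα.eventually_abs_integral_sub_le hφ.continuous_gradient hB.norm_gradient_le
    (by positivity : 0 < e / 3)
  have ev2 : ∀ᶠ r in 𝓝[>] t₀, |∫ x, Laplacian.laplacian φ x ∂(μ r)
      - ∫ x, Laplacian.laplacian φ x ∂μ₀| < e / 3 := by
    have hc := h.curve.continuousOn_integral_test hφ.laplacian t₀ ⟨le_rfl, hT.le⟩
    have hc' : Tendsto (fun t => ∫ x, Laplacian.laplacian φ x ∂(μ t)) (𝓝[>] t₀)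
        (𝓝 (∫ x, Laplacian.laplacian φ x ∂μ₀)) := by
      have := hc.tendsto
      rw [h.initial] at this
      refine this.mono_left ?_
      rw [← nhdsWithin_Ioc_eq_nhdsGT hT]
      exact nhdsWithin_mono _ Ioc_subset_Icc_self
    have := (hc'.sub_const (∫ x, Laplacian.laplacian φ x ∂μ₀)).abs
    rw [sub_self, abs_zero] at this
    exact this.eventually_lt_const (by positivity)
  have ev3 : ∀ᶠ r in 𝓝[>] t₀, (A + J) * (A * B) * √(2 * (r - t₀)) < e / 3 := by
    have : Tendsto (fun r => (A + J) * (A * B) * √(2 * (r - t₀))) (𝓝[>] t₀)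
        (𝓝 ((A + J) * (A * B) * √(2 * (t₀ - t₀)))) :=
      ((by fun_prop : Continuous fun r => (A + J) * (A * B) * √(2 * (r - t₀))).tendsto t₀).mono_left
        nhdsWithin_le_nhds
    rw [sub_self, mul_zero, Real.sqrt_zero, mul_zero] at this
    exact this.eventually_lt_const (by positivity)
  have ev4 : ∀ᶠ r in 𝓝[>] t₀, r ∈ Ioc t₀ T := Ioc_mem_nhdsGT hT
  -- `αᵣ` is known to be bounded only for almost every `r`, hence an interval of times instead of an
  -- eventual statement
  obtain ⟨u, hu, hsub⟩ := mem_nhdsGT_iff_exists_Ioo_subset.1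
    (ev1.and (ev2.and (ev3.and ev4)))
  refine ⟨u - t₀, sub_pos.2 hu, ?_⟩
  filter_upwards [h.ae_norm_le hT.le hA] with r hr hrm
  rw [add_sub_cancel] at hrm
  obtain ⟨h1, h2, h3, h4⟩ := hsub hrm
  refine ⟨h4.2, ?_⟩
  have hpr := h.prob (Ioc_subset_Icc_self h4)
  have hae0 : ∀ᵐ x ∂μ₀, ‖α r x‖ ≤ A := hac.ae_le (hr h4).1
  have haer := (hr h4).2
  have hαm : Measurable (α r) := h.measurable.comp measurable_prodMk_left
  have hir : Integrable (α r) (μ r) := Integrable.of_bound hαm.aestronglyMeasurable _ haer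
  have hi0 : Integrable (α r) μ₀ := Integrable.of_bound hαm.aestronglyMeasurable _ hae0
  have hit : Integrable (α t₀) μ₀ := hα.1.integrable (by norm_num)
  replace h1 := h1 hi0
  -- truncation makes the integrand bounded everywhere, without changing it almost everywhere for
  -- either measure
  let θ : Sp d → ℝ := fun x => max (-(A * B)) (min (A * B) ⟪α r x, gradient φ x⟫_ℝ)
  have hθm : Measurable θ := measurable_const.max (measurable_const.min
    (hαm.inner hφ.continuous_gradient.measurable))
  have hAB : 0 ≤ A * B := by positivity
  have hθM : ∀ x, |θ x| ≤ A * B := fun x =>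
    abs_le.2 ⟨le_max_left _ _, max_le (by linarith) (min_le_left _ _)⟩
  have hθeq : ∀ x, ‖α r x‖ ≤ A → θ x = ⟪α r x, gradient φ x⟫_ℝ := by
    intro x hx
    have := abs_le.1 ((abs_real_inner_le_norm (α r x) (gradient φ x)).trans
      (mul_le_mul hx (hB.norm_gradient_le x) (norm_nonneg _) hA0))
    simp only [θ]
    rw [min_eq_right this.2, max_eq_right this.1]
  have e1 : ∫ x, θ x ∂(μ r) = ∫ x, ⟪α r x, gradient φ x⟫_ℝ ∂(μ r) :=
    integral_congr_ae (haer.mono hθeq)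
  have e2 : ∫ x, θ x ∂μ₀ = ∫ x, ⟪α r x, gradient φ x⟫_ℝ ∂μ₀ :=
    integral_congr_ae (hae0.mono hθeq)
  have htv := h.abs_integral_sub_initial_le_of_measurable hA hJ hF hθm hθM h4
  rw [e1, e2] at htv
  rw [integral_add (integrable_inner_of_bound hir hφ.continuous_gradient hB.norm_gradient_le)
    (hφ.laplacian.integrable _), integral_add (integrable_inner_of_bound hit
    hφ.continuous_gradient hB.norm_gradient_le) (hφ.laplacian.integrable _)]
  have h3' := h3.le
  have h2' := h2.le
  rw [abs_le] at htv h1 h2' ⊢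
  constructor <;> linarith [htv.1, htv.2, h1.1, h1.2, h2'.1, h2'.2]

/-- The derivative at the initial time: the quadratic error of the expansion is negligible, and the
time average of the drift and diffusion terms converges to their initial value. -/
theorem IsSolution.tendsto_expansion (hT : t₀ < T) (h : IsSolution t₀ T μ₀ μ α)
    (hac : μ₀ ≪ volume) (hf : fisher μ₀ < ⊤) (hA : supNorm t₀ T α < ⊤)
    (hα : RightContinuousL2 t₀ μ₀ α) {S : ℝ → Sp d → Sp d}
    (hS : ∀ τ : ℝ, 0 < τ → t₀ + τ ≤ T → IsOptimalMap μ₀ (μ (t₀ + τ)) (S τ)) {φ : Sp d → ℝ}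
    (hφ : IsTest φ) :
    Tendsto (fun τ : ℝ => ∫ x, ⟪gradient φ x, τ⁻¹ • (S τ x - x)⟫_ℝ ∂μ₀) (𝓝[>] 0)
      (𝓝 (∫ x, (⟪α t₀ x, gradient φ x⟫_ℝ + Laplacian.laplacian φ x) ∂μ₀)) := by
  rw [Metric.tendsto_nhds]
  intro e he
  obtain ⟨δ, hδ, hae⟩ := h.exists_abs_integral_drift_sub_le hT hac hf hA hα hφ
    (by positivity : 0 < e / 2)
  set L := ∫ x, (⟪α t₀ x, gradient φ x⟫_ℝ + Laplacian.laplacian φ x) ∂μ₀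
  set G : ℝ → ℝ := fun r => ∫ x, (⟪α r x, gradient φ x⟫_ℝ + Laplacian.laplacian φ x) ∂(μ r)
  set K := ((supNorm t₀ T α).toReal + √(fisher μ₀).toReal) ^ 2 * hessianNorm φ
  have ev1 : ∀ᶠ τ : ℝ in 𝓝[>] 0, K * τ < e / 2 := by
    have : Tendsto (fun τ : ℝ => K * τ) (𝓝[>] 0) (𝓝 (K * 0)) :=
      ((continuous_const_mul K).tendsto 0).mono_left nhdsWithin_le_nhds
    rw [mul_zero] at this
    exact this.eventually_lt_const (by positivity)
  filter_upwards [ev1, Ioo_mem_nhdsGT (lt_min hδ (sub_pos.2 hT))] with τ hτK hτ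
  have hτ0 : 0 < τ := hτ.1
  have hτδ : τ < δ := hτ.2.trans_le (min_le_left _ _)
  have hτT : t₀ + τ ≤ T := by linarith [hτ.2.trans_le (min_le_right δ (T - t₀))]
  have hexp := h.abs_expansion_le hf hA hτ0 hτT (hS τ hτ0 hτT) hφ
  change |_ - ∫ t in t₀..(t₀ + τ), G t| ≤ K * τ ^ 2 at hexp
  have hGi : IntervalIntegrable G volume t₀ (t₀ + τ) :=
    (intervalIntegrable_iff_integrableOn_Ioc_of_le (by linarith)).2
      ((h.integrableOn_rhs hT.le hφ).mono_set
        (Ioc_subset_Icc_self.trans (Icc_subset_Icc le_rfl hτT)))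
  have hav : |(∫ t in t₀..(t₀ + τ), G t) - τ * L| ≤ e / 2 * τ := by
    have hc : τ * L = ∫ t in t₀..(t₀ + τ), L := by
      rw [intervalIntegral.integral_const, add_sub_cancel_left, smul_eq_mul]
    rw [hc, ← intervalIntegral.integral_sub hGi intervalIntegrable_const, ← Real.norm_eq_abs]
    refine (intervalIntegral.norm_integral_le_of_norm_le_const_ae (C := e / 2) ?_).trans
      (le_of_eq (by rw [add_sub_cancel_left, abs_of_pos hτ0]))
    filter_upwards [hae] with r hr hrm
    rw [uIoc_of_le (by linarith)] at hrm
    exact (hr ⟨hrm.1, by linarith [hrm.2]⟩).2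
  rw [Real.dist_eq]
  simp only [inner_smul_right]
  rw [integral_const_mul]
  set P := ∫ x, ⟪gradient φ x, S τ x - x⟫_ℝ ∂μ₀
  have hP : |P - τ * L| < e * τ := by
    have h1 : K * τ ^ 2 < e / 2 * τ := by nlinarith
    rw [abs_le] at hexp hav
    rw [abs_lt]
    constructor <;> linarith [hexp.1, hexp.2, hav.1, hav.2]
  have : τ⁻¹ * P - L = τ⁻¹ * (P - τ * L) := by field_simp
  rw [this, abs_mul, abs_of_pos (inv_pos.2 hτ0), inv_mul_lt_iff₀ hτ0, mul_comm τ e]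
  exact hP

end Expansion

end FokkerPlanck

end

theorem proposition5p3 :
    ∃ C : ℝ → ℝ → ℝ, (∀ I A : ℝ, 0 < C I A) ∧
      ∀ (d : ℕ) (T t₀ : ℝ), t₀ ∈ Icc 0 T →
      ∀ (μ₀ : Measure (FokkerPlanck.Sp d)) (μ : ℝ → Measure (FokkerPlanck.Sp d))
        (α : ℝ → FokkerPlanck.Sp d → FokkerPlanck.Sp d),
      FokkerPlanck.IsP2ac μ₀ →
      FokkerPlanck.fisher μ₀ < ⊤ →
      FokkerPlanck.supNorm t₀ T α < ⊤ →
      FokkerPlanck.IsSolution t₀ T μ₀ μ α →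
      -- (a) the Lipschitz estimate
      (∀ t ∈ Icc t₀ T,
        FokkerPlanck.d2 (μ t) μ₀ ≤
          (FokkerPlanck.supNorm t₀ T α + FokkerPlanck.fisher μ₀ ^ (1 / 2 : ℝ))
            * ENNReal.ofReal |t - t₀|) ∧
      -- (b) the first-order expansion; `S` is the optimal map from `μ₀` to `μ (t₀ + h)`
      (∀ h : ℝ, 0 < h → t₀ + h ≤ T →
        ∀ S : FokkerPlanck.Sp d → FokkerPlanck.Sp d,
        FokkerPlanck.IsOptimalMap μ₀ (μ (t₀ + h)) S →
        ∀ φ : FokkerPlanck.Sp d → ℝ, ContDiff ℝ ∞ φ → HasCompactSupport φ →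
          |(∫ x, ⟪gradient φ x, S x - x⟫_ℝ ∂μ₀)
            - ∫ t in t₀..(t₀ + h), ∫ x,
                (⟪α t x, gradient φ x⟫_ℝ + Laplacian.laplacian φ x) ∂(μ t)|
            ≤ C (FokkerPlanck.fisher μ₀).toReal (FokkerPlanck.supNorm t₀ T α).toReal
                * FokkerPlanck.hessianNorm φ * h ^ 2) ∧
      -- the resulting derivative at `t₀`; `S h` is the optimal map from `μ₀` to `μ (t₀ + h)`
      (t₀ < T → FokkerPlanck.RightContinuousL2 t₀ μ₀ α →
        ∀ S : ℝ → FokkerPlanck.Sp d → FokkerPlanck.Sp d,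
        (∀ h : ℝ, 0 < h → t₀ + h ≤ T →
          FokkerPlanck.IsOptimalMap μ₀ (μ (t₀ + h)) (S h)) →
        ∀ φ : FokkerPlanck.Sp d → ℝ, ContDiff ℝ ∞ φ → HasCompactSupport φ →
          Tendsto (fun h : ℝ => ∫ x, ⟪gradient φ x, h⁻¹ • (S h x - x)⟫_ℝ ∂μ₀) (𝓝[>] 0)
            (𝓝 (∫ x, (⟪α t₀ x, gradient φ x⟫_ℝ + Laplacian.laplacian φ x) ∂μ₀))) := by
  refine ⟨fun I A => (A + √I) ^ 2 + 1, fun I A => by positivity, ?_⟩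
  intro d T t₀ ht₀ μ₀ μ α hμ₀ hf hA h
  have hT : t₀ ≤ T := ht₀.2
  refine ⟨fun t ht => ?_, fun τ hτ hτT S hS φ hφ hc => ?_, fun hlt hα S hS φ hφ hc => ?_⟩
  · refine (h.d2_le hf hA ht).trans (le_of_eq ?_)
    rw [ENNReal.ofReal_mul (add_nonneg ENNReal.toReal_nonneg (Real.sqrt_nonneg _)),
      ENNReal.ofReal_add ENNReal.toReal_nonneg (Real.sqrt_nonneg _), ENNReal.ofReal_toReal hA.ne,
      Real.sqrt_eq_rpow, ← ENNReal.ofReal_rpow_of_nonneg ENNReal.toReal_nonneg (by norm_num),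
      ENNReal.ofReal_toReal hf.ne, abs_of_nonneg (sub_nonneg.2 ht.1)]
  · have hφt := FokkerPlanck.IsTest.of_hasCompactSupport hφ hc
    refine (h.abs_expansion_le hf hA hτ hτT hS hφt).trans ?_
    have hN : 0 ≤ FokkerPlanck.hessianNorm φ :=
      (norm_nonneg _).trans (FokkerPlanck.norm_iteratedFDeriv_two_le_hessianNorm hφt 0)
    gcongr
    linarith
  · exact h.tendsto_expansion hlt hμ₀.absolutelyContinuous hf hA hα hS
      (FokkerPlanck.IsTest.of_hasCompactSupport hφ hc)
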